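/- Let $H$ be a complex Hilbert space and $E$ a finite-dimensional complex Hilbert space, $m=\dim E$, and let $V=(A_1,A_2,H,\Phi,E,\sigma_1,\sigma_2,\gamma^{in},\gamma^{out})$ be a two-operator commutative vessel: $A_1,A_2$ are commuting bounded operators on $H$, $\Phi:H\to E$ is bounded, $\sigma_1,\sigma_2,\gamma^{in},\gamma^{out}$ are selfadjoint operators on $E$, and $$\Phi^*\sigma_j\Phi=\tfrac1i(A_j-A_j^*)\ (j=1,2),\qquad \gamma^{in}\Phi=\sigma_1\Phi A_2^*-\sigma_2\Phi A_1^*,\qquad \gamma^{out}\Phi=\sigma_1\Phi A_2-\sigma_2\Phi A_1,$$ $$\gamma^{out}=\gamma^{in}+i(\sigma_1\Phi\Phi^*\sigma_2-\sigma_2\Phi\Phi^*\sigma_1).$$ The discriminant polynomial of $V$ is $\Delta(y_1,y_2)=\det(y_1\sigma_2-y_2\sigma_1+\gamma^{in})$ and its discriminant variety is $\{y\in\mathbb C^2:\Delta(y)=0\}$. Assume that $\Delta$ is irreducible over $\mathbb C$ and of degree $m$; let $C$ be the curve $\Delta=0$ in $\mathbb C^2$, and regard it also as the projective curve $\Delta(x)=0$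 in $\mathbb P^2(\mathbb C)$, where for $x=(x_0,x_1,x_2)$ we put $D(x)=x_0\gamma^{in}+x_1\sigma_2-x_2\sigma_1$ and $\Delta(x)=\det D(x)$. Let $p_0,p_1,p_2$ be real polynomials in two variables such that $p_0(A_1,A_2)$ is invertible and $r=(p_1/p_0,p_2/p_0)$ is defined at some point of $C$ and is not constant on $C$ (for instance, $r$ is a birational isomorphism of $C$ onto a curve). Let $C'=r(C)$ be the image curve, i.e. the Zariski closure in $\mathbb C^2$ of $\{r(y): y\in C,\ p_0(y)\ne0\}$. Let $n$ be the maximal degree of $p_0,p_1,p_2$, and let $P_0,P_1,P_2$ be their homogenizations of degree $n$ in $x_0,x_1,x_2$. A base point of $r$ on $C$ is a point $x\in\mathbb P^2(\mathbb C)$ with $\Delta(x)=P_0(x)=P_1(x)=P_2(x)=0$. Assume that at every base point $x$ of $r$ on $C$ (if there are any): (a) the determinantal representation is maximal, i.e. $\dim\ker D(x)$ equals the multiplicity of $x$ on $C$ (this is automatic if $C$ is nonsingular at $x$); (b) the base point is simple, i.e. some complex linear combination of $P_0,P_1,P_2$ defines a curve that is nonsingular at $x$ and whose tangent line at $x$ is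 not tangent to $C$ at $x$ (not contained in the tangent cone of $C$ at $x$). Let $W_n=\bigoplus_{|i|=n-1}E$ (indices $i=(i_0,i_1,i_2)$ of nonnegative integers, $|i|=i_0+i_1+i_2$), and let $$V_n=\{(w_i)\in W_n:\ \gamma^{in}w_{j_0+1,j_1,j_2}+\sigma_2w_{j_0,j_1+1,j_2}-\sigma_1w_{j_0,j_1,j_2+1}=0\ \text{ for all } |j|=n-2\}.$$ For real forms $P,Q$ of degree $n$ there are real symmetric matrices $\beta^{10},\beta^{20},\beta^{12}$, indexed by the $i$ with $|i|=n-1$, such that $$P(x)Q(y)-Q(x)P(y)=\sum_{i,j}x^i\big(\beta^{10}_{ij}(x_1y_0-x_0y_1)+\beta^{20}_{ij}(x_2y_0-x_0y_2)+\beta^{12}_{ij}(x_1y_2-x_2y_1)\big)y^j .$$ For any such choice let $B(P,Q)=\beta^{12}\otimes\gamma^{in}+\beta^{10}\otimes\sigma_1+\beta^{20}\otimes\sigma_2$ on $W_n$, and let $B'(P,Q)$ be its compression to $V_n$. The transformed vessel $V'$ has $A_j'=p_j(A_1,A_2)\,p_0(A_1,A_2)^{-1}$ for $j=1,2$, $E'=V_n$,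 and $$\Phi'=\mathcal P_{V_n}\big(\Phi A_1^{*i_1}A_2^{*i_2}p_0(A_1^*,A_2^*)^{-1}\big)_{|i|=n-1},\quad \sigma_1'=B'(P_1,P_0),\quad \sigma_2'=B'(P_2,P_0),\quad \gamma'^{in}=B'(P_1,P_2),$$ $$\gamma'^{out}=\gamma'^{in}+i(\sigma_1'\Phi'\Phi'^*\sigma_2'-\sigma_2'\Phi'\Phi'^*\sigma_1').$$ Let $E''=\bar V_n$ be the orthogonal complement in $V_n$ of all Vandermonde vectors $(x^ie)_{|i|=n-1}$, where $x$ runs over the base points of $r$ on $C$ and $e\in\ker D(x)$, and let $V''$ be obtained from $V'$ by replacing $\Phi'$ by $\mathcal P_{E''}\Phi'$ and $\sigma_1',\sigma_2',\gamma'^{in},\gamma'^{out}$ by their compressions to $E''$. **Theorem 3.4.** The discriminant variety of $V''$ is exactly the image curve $C'$: $$\{y\in\mathbb C^2:\ \det(y_1\sigma_2''-y_2\sigma_1''+\gamma''^{in})=0\}=C'.$$ -/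

import Mathlib

noncomputable section

namespace CommVessel

open MvPolynomial

/-! ### Two-operator commutative vessels -/

/-- The collection `(A₁, A₂, H, Φ, E, σ₁, σ₂, γⁱⁿ, γᵒᵘᵗ)` of operators underlying a two-operator
vessel (no relations imposed yet, see `VesselData.IsVessel`). -/
structure VesselData (H E : Type*) [NormedAddCommGroup H] [InnerProductSpace ℂ H]
    [NormedAddCommGroup E] [InnerProductSpace ℂ E] where
  A₁ : H →L[ℂ] H
  A₂ : H →L[ℂ] H
  Φ : H →L[ℂ] E
  σ₁ : E →L[ℂ] E
  σ₂ : E →L[ℂ] E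
  γin : E →L[ℂ] E
  γout : E →L[ℂ] E

namespace VesselData

variable {H E : Type*} [NormedAddCommGroup H] [InnerProductSpace ℂ H] [CompleteSpace H]
  [NormedAddCommGroup E] [InnerProductSpace ℂ E] [FiniteDimensional ℂ E] [CompleteSpace E]

/-- The axioms of a two-operator commutative vessel. -/
structure IsVessel (V : VesselData H E) : Prop where
  commute : V.A₁ ∘L V.A₂ = V.A₂ ∘L V.A₁
  selfAdjoint_σ₁ : IsSelfAdjoint V.σ₁
  selfAdjoint_σ₂ : IsSelfAdjoint V.σ₂
  selfAdjoint_γin : IsSelfAdjoint V.γin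
  selfAdjoint_γout : IsSelfAdjoint V.γout
  colligation₁ : V.Φ.adjoint ∘L V.σ₁ ∘L V.Φ = (1 / Complex.I) • (V.A₁ - V.A₁.adjoint)
  colligation₂ : V.Φ.adjoint ∘L V.σ₂ ∘L V.Φ = (1 / Complex.I) • (V.A₂ - V.A₂.adjoint)
  input : V.γin ∘L V.Φ = V.σ₁ ∘L V.Φ ∘L V.A₂.adjoint - V.σ₂ ∘L V.Φ ∘L V.A₁.adjoint
  output : V.γout ∘L V.Φ = V.σ₁ ∘L V.Φ ∘L V.A₂ - V.σ₂ ∘L V.Φ ∘L V.A₁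
  linkage : V.γout = V.γin + Complex.I •
    (V.σ₁ ∘L V.Φ ∘L V.Φ.adjoint ∘L V.σ₂ - V.σ₂ ∘L V.Φ ∘L V.Φ.adjoint ∘L V.σ₁)

/-- The matrix of an operator on `E` (in a fixed orthonormal basis), with entries regarded as
constant polynomials. -/
def polyMatrix (ι : Type) (T : E →L[ℂ] E) :
    Matrix (Fin (Module.finrank ℂ E)) (Fin (Module.finrank ℂ E)) (MvPolynomial ι ℂ) :=
  (LinearMap.toMatrix (stdOrthonormalBasis ℂ E).toBasis (stdOrthonormalBasis ℂ E).toBasis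
    (T : E →ₗ[ℂ] E)).map C

/-- The discriminant polynomial `Δ(y₁, y₂) = det (y₁ σ₂ - y₂ σ₁ + γⁱⁿ)`; the variables `y₁, y₂`
are `X 0, X 1`. -/
def discriminant (V : VesselData H E) : MvPolynomial (Fin 2) ℂ :=
  ((X 0 : MvPolynomial (Fin 2) ℂ) • polyMatrix (Fin 2) V.σ₂
    - (X 1 : MvPolynomial (Fin 2) ℂ) • polyMatrix (Fin 2) V.σ₁ + polyMatrix (Fin 2) V.γin).det

/-- The discriminant variety `{y ∈ ℂ² : Δ(y) = 0}`. -/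
def discriminantVariety (V : VesselData H E) : Set (Fin 2 → ℂ) :=
  {y | eval y V.discriminant = 0}

/-- The homogeneous discriminant polynomial `det (x₀ γⁱⁿ + x₁ σ₂ - x₂ σ₁)`. -/
def homDiscriminant (V : VesselData H E) : MvPolynomial (Fin 3) ℂ :=
  ((X 0 : MvPolynomial (Fin 3) ℂ) • polyMatrix (Fin 3) V.γin
    + (X 1 : MvPolynomial (Fin 3) ℂ) • polyMatrix (Fin 3) V.σ₂
    - (X 2 : MvPolynomial (Fin 3) ℂ) • polyMatrix (Fin 3) V.σ₁).det

/-- The operator `x₀ γⁱⁿ + x₁ σ₂ - x₂ σ₁` on `E`. -/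
def pencil (V : VesselData H E) (x : Fin 3 → ℂ) : E →L[ℂ] E :=
  x 0 • V.γin + x 1 • V.σ₂ - x 2 • V.σ₁

/-- Compression of an operator to a subspace. -/
def compress (F : Submodule ℂ E) (T : E →L[ℂ] E) : F →L[ℂ] F :=
  F.orthogonalProjectionOnto ∘L T ∘L F.subtypeL

/-- Compression of the external space of a vessel to a subspace `F ⊆ E`. -/
def restrict (V : VesselData H E) (F : Submodule ℂ E) : VesselData H F where
  A₁ := V.A₁
  A₂ := V.A₂
  Φ := F.orthogonalProjectionOnto ∘L V.Φ
  σ₁ := compress F V.σ₁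
  σ₂ := compress F V.σ₂
  γin := compress F V.γin
  γout := compress F V.γout

end VesselData

/-! ### Blown up space, Vandermonde vectors, principal subspace -/

/-- Multi-indices `(i₀, i₁, i₂)` with `i₀ + i₁ + i₂ = k`. -/
abbrev MultiIdx (k : ℕ) : Type := ↥(Finset.Nat.antidiagonalTuple 3 k)

/-- The monomial `x₀^{i₀} x₁^{i₁} x₂^{i₂}`. -/
def mon (x : Fin 3 → ℂ) (i : Fin 3 → ℕ) : ℂ := ∏ l, x l ^ i l

/-- The blown up space: vectors of `E` indexed by the multi-indices of degree `k`, with its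
Hilbert space structure (it is written `W_n`, `n = k + 1`, in terms of polynomials of degree `n`). -/
abbrev BlownUp (E : Type*) (k : ℕ) : Type _ := PiLp 2 (fun _ : MultiIdx k => E)

section Spaces

variable {H E : Type*} [NormedAddCommGroup H] [InnerProductSpace ℂ H] [CompleteSpace H]
  [NormedAddCommGroup E] [InnerProductSpace ℂ E] [FiniteDimensional ℂ E] [CompleteSpace E]

/-- The Vandermonde vector `(x^i e)_{|i| = k}`. -/
def vandermonde (k : ℕ) (x : Fin 3 → ℂ) (e : E) : BlownUp E k :=
  WithLp.toLp 2 fun i => mon x i.1 • e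

/-- The principal subspace: all `w` in the blown up space with
`γⁱⁿ w_{j₀+1,j₁,j₂} + σ₂ w_{j₀,j₁+1,j₂} - σ₁ w_{j₀,j₁,j₂+1} = 0` for all `j` with `|j| = k - 1`
(no condition if `k = 0`). -/
def principalSubspace (V : VesselData H E) (k : ℕ) : Submodule ℂ (BlownUp E k) where
  carrier := {w | ∀ (j : Fin 3 → ℕ) (a b c : MultiIdx k),
    a.1 = j + Pi.single 0 1 → b.1 = j + Pi.single 1 1 → c.1 = j + Pi.single 2 1 →
      V.γin (w a) + V.σ₂ (w b) - V.σ₁ (w c) = 0}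
  zero_mem' := by intro j a b c _ _ _; simp
  add_mem' := by
    intro v w hv hw j a b c ha hb hc
    have h1 := hv j a b c ha hb hc
    have h2 := hw j a b c ha hb hc
    simp only [PiLp.add_apply, map_add]
    calc _ = (V.γin (v a) + V.σ₂ (v b) - V.σ₁ (v c))
          + (V.γin (w a) + V.σ₂ (w b) - V.σ₁ (w c)) := by abel
      _ = 0 := by rw [h1, h2, add_zero]
  smul_mem' := by
    intro t w hw j a b c ha hb hc
    have h1 := hw j a b c ha hb hc
    simp only [PiLp.smul_apply, map_smul]
    rw [← smul_add, ← smul_sub, h1, smul_zero]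

instance (V : VesselData H E) (k : ℕ) : FiniteDimensional ℂ (principalSubspace V k) :=
  FiniteDimensional.finiteDimensional_submodule _

instance (V : VesselData H E) (k : ℕ) : CompleteSpace (principalSubspace V k) :=
  FiniteDimensional.complete ℂ _

end Spaces

/-! ### Bezout matrices along a curve -/

/-- A choice of three real symmetric matrices `β¹⁰, β²⁰, β¹²` with
`p(x) q(y) - q(x) p(y) = ∑_{i,j} β¹⁰_{ij} x^i (x₁y₀ - x₀y₁) y^j
  + β²⁰_{ij} x^i (x₂y₀ - x₀y₂) y^j + β¹²_{ij} x^i (x₁y₂ - x₂y₁) y^j`,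
the indices running over `|i| = |j| = k`. Such a choice exists for any two real forms of degree
`k + 1`, see `BezoutCoeffs.nonempty`. -/
structure BezoutCoeffs (k : ℕ) (p q : MvPolynomial (Fin 3) ℝ) where
  b10 : Matrix (MultiIdx k) (MultiIdx k) ℝ
  b20 : Matrix (MultiIdx k) (MultiIdx k) ℝ
  b12 : Matrix (MultiIdx k) (MultiIdx k) ℝ
  symm10 : b10.IsSymm
  symm20 : b20.IsSymm
  symm12 : b12.IsSymm
  identity : ∀ x y : Fin 3 → ℂ,
    aeval x p * aeval y q - aeval x q * aeval y p =
      ∑ i, ∑ j,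
        ((b10 i j : ℂ) * (mon x i.1 * (x 1 * y 0 - x 0 * y 1) * mon y j.1)
        + (b20 i j : ℂ) * (mon x i.1 * (x 2 * y 0 - x 0 * y 2) * mon y j.1)
        + (b12 i j : ℂ) * (mon x i.1 * (x 1 * y 2 - x 2 * y 1) * mon y j.1))

section BezoutOperator

variable {H E : Type*} [NormedAddCommGroup H] [InnerProductSpace ℂ H] [CompleteSpace H]
  [NormedAddCommGroup E] [InnerProductSpace ℂ E] [FiniteDimensional ℂ E] [CompleteSpace E]

/-- The block matrix `B(p,q) = β¹² ⊗ γⁱⁿ + β¹⁰ ⊗ σ₁ + β²⁰ ⊗ σ₂` acting on the blown up space. -/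
def bezoutOperator (V : VesselData H E) {k : ℕ} {p q : MvPolynomial (Fin 3) ℝ}
    (β : BezoutCoeffs k p q) : BlownUp E k →L[ℂ] BlownUp E k :=
  (PiLp.continuousLinearEquiv 2 ℂ (fun _ : MultiIdx k => E)).symm.toContinuousLinearMap ∘L
    ContinuousLinearMap.pi fun i => ∑ j,
      ((β.b12 i j : ℂ) • V.γin + (β.b10 i j : ℂ) • V.σ₁ + (β.b20 i j : ℂ) • V.σ₂) ∘L
        PiLp.proj 2 (fun _ : MultiIdx k => E) j

end BezoutOperator

/-! ### Rational transformations `r = (p₁ / p₀, p₂ / p₀)` -/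

/-- The maximal degree `n` of `p₀, p₁, p₂`. -/
def mapDegree (p : Fin 3 → MvPolynomial (Fin 2) ℝ) : ℕ :=
  Finset.univ.sup fun i => (p i).totalDegree

/-- Homogenization `x₀^n p(x₁/x₀, x₂/x₀)` up to degree `n` (for `n ≥ deg p`). -/
def homogenize (n : ℕ) (p : MvPolynomial (Fin 2) ℝ) : MvPolynomial (Fin 3) ℝ :=
  ∑ d ∈ p.support, C (p.coeff d) * (X 0 ^ (n - d 0 - d 1) * X 1 ^ d 0 * X 2 ^ d 1)

/-- The three forms `P₀, P₁, P₂` of degree `n` attached to `p₀, p₁, p₂`. -/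
def form (p : Fin 3 → MvPolynomial (Fin 2) ℝ) (i : Fin 3) : MvPolynomial (Fin 3) ℝ :=
  homogenize (mapDegree p) (p i)

/-- The operator `p(A₁, A₂)` for a real polynomial `p` (used for commuting `A₁, A₂`). -/
def opEval {H : Type*} [NormedAddCommGroup H] [InnerProductSpace ℂ H]
    (p : MvPolynomial (Fin 2) ℝ) (A₁ A₂ : H →L[ℂ] H) : H →L[ℂ] H :=
  ∑ d ∈ p.support, ((p.coeff d : ℝ) : ℂ) • (A₁ ^ d 0 * A₂ ^ d 1)

/-- The points `(p₁(y)/p₀(y), p₂(y)/p₀(y))` for `y` on the affine curve `C` with `p₀(y) ≠ 0`. -/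
def imagePoints (p : Fin 3 → MvPolynomial (Fin 2) ℝ) (C : Set (Fin 2 → ℂ)) :
    Set (Fin 2 → ℂ) :=
  (fun y => ![aeval y (p 1) / aeval y (p 0), aeval y (p 2) / aeval y (p 0)]) ''
    {y | y ∈ C ∧ aeval y (p 0) ≠ 0}

/-- The image curve `r(C)`: the Zariski closure in `ℂ²` of the set of points `r(y)`, `y ∈ C`. -/
def imageCurve (p : Fin 3 → MvPolynomial (Fin 2) ℝ) (C : Set (Fin 2 → ℂ)) :
    Set (Fin 2 → ℂ) :=
  zeroLocus ℂ (vanishingIdeal ℂ (imagePoints p C))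

/-! ### Points of plane projective curves -/

/-- The Taylor expansion `F(x + X)` of `F` at the point `x`. -/
def translate (F : MvPolynomial (Fin 3) ℂ) (x : Fin 3 → ℂ) : MvPolynomial (Fin 3) ℂ :=
  aeval (fun i => X i + C (x i)) F

/-- The multiplicity of `x` on `F = 0`: the lowest degree occurring in the Taylor expansion. -/
def pointMultiplicity (F : MvPolynomial (Fin 3) ℂ) (x : Fin 3 → ℂ) : ℕ :=
  sInf {k | homogeneousComponent k (translate F x) ≠ 0}

/-- The leading form of `F` at `x`; its zeros are the directions tangent to `F = 0` at `x`. -/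
def tangentCone (F : MvPolynomial (Fin 3) ℂ) (x : Fin 3 → ℂ) : MvPolynomial (Fin 3) ℂ :=
  homogeneousComponent (pointMultiplicity F x) (translate F x)

section Transformation

variable {H E : Type*} [NormedAddCommGroup H] [InnerProductSpace ℂ H] [CompleteSpace H]
  [NormedAddCommGroup E] [InnerProductSpace ℂ E] [FiniteDimensional ℂ E] [CompleteSpace E]

/-- `x` represents a base point of `r` on the projective curve `C`. -/
def IsBasePoint (V : VesselData H E) (p : Fin 3 → MvPolynomial (Fin 2) ℝ) (x : Fin 3 → ℂ) :
    Prop :=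
  x ≠ 0 ∧ eval x V.homDiscriminant = 0 ∧ ∀ i, aeval x (form p i) = 0

/-- The determinantal representation is maximal at `x`: the kernel of `x₀ γⁱⁿ + x₁ σ₂ - x₂ σ₁` has
the largest possible dimension, the multiplicity of `x` on `C`. (Automatic at nonsingular
points.) -/
def IsMaximalAt (V : VesselData H E) (x : Fin 3 → ℂ) : Prop :=
  Module.finrank ℂ (LinearMap.ker (V.pencil x : E →ₗ[ℂ] E)) = pointMultiplicity V.homDiscriminant x

/-- The base point `x` is simple: some complex linear combination `q` of `P₀, P₁, P₂` is
nonsingular at `x` and its tangent direction `v` there is not tangent to `C` at `x`. -/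
def IsSimpleAt (V : VesselData H E) (p : Fin 3 → MvPolynomial (Fin 2) ℝ) (x : Fin 3 → ℂ) :
    Prop :=
  ∃ a g v : Fin 3 → ℂ, (∀ i, g i = ∑ l, a l * aeval x (pderiv i (form p l))) ∧
    g ≠ 0 ∧ ∑ i, g i * v i = 0 ∧ eval v (tangentCone V.homDiscriminant x) ≠ 0

/-- The vessel `V'` on the principal subspace `E' = V_n`, `n = mapDegree p`. -/
def transform (V : VesselData H E) (p : Fin 3 → MvPolynomial (Fin 2) ℝ)
    (β : ∀ i j, BezoutCoeffs (mapDegree p - 1) (form p i) (form p j)) :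
    VesselData H (principalSubspace V (mapDegree p - 1)) :=
  let E' := principalSubspace V (mapDegree p - 1)
  let Φ' : H →L[ℂ] E' := E'.orthogonalProjectionOnto ∘L
    (PiLp.continuousLinearEquiv 2 ℂ
      (fun _ : MultiIdx (mapDegree p - 1) => E)).symm.toContinuousLinearMap ∘L
      ContinuousLinearMap.pi fun i => V.Φ ∘L (V.A₁.adjoint ^ i.1 1 * V.A₂.adjoint ^ i.1 2 *
        Ring.inverse (opEval (p 0) V.A₁.adjoint V.A₂.adjoint))
  let σ₁' : E' →L[ℂ] E' := VesselData.compress E' (bezoutOperator V (β 1 0))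
  let σ₂' : E' →L[ℂ] E' := VesselData.compress E' (bezoutOperator V (β 2 0))
  let γin' : E' →L[ℂ] E' := VesselData.compress E' (bezoutOperator V (β 1 2))
  { A₁ := opEval (p 1) V.A₁ V.A₂ * Ring.inverse (opEval (p 0) V.A₁ V.A₂)
    A₂ := opEval (p 2) V.A₁ V.A₂ * Ring.inverse (opEval (p 0) V.A₁ V.A₂)
    Φ := Φ'
    σ₁ := σ₁'
    σ₂ := σ₂'
    γin := γin'
    γout := γin' + Complex.I •
      (σ₁' ∘L Φ' ∘L Φ'.adjoint ∘L σ₂' - σ₂' ∘L Φ' ∘L Φ'.adjoint ∘L σ₁') }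

/-- The subspace `E'' ⊆ E'`: the orthogonal complement in `V_n` of the Vandermonde vectors
`(x^i e)` at all base points `x` of `r` on `C`, `e ∈ ker (x₀ γⁱⁿ + x₁ σ₂ - x₂ σ₁)`. -/
def reducedSubspace (V : VesselData H E) (p : Fin 3 → MvPolynomial (Fin 2) ℝ) :
    Submodule ℂ (principalSubspace V (mapDegree p - 1)) :=
  (Submodule.span ℂ {w | ∃ (x : Fin 3 → ℂ) (e : E), IsBasePoint V p x ∧ V.pencil x e = 0 ∧
    (w : BlownUp E (mapDegree p - 1)) = vandermonde (mapDegree p - 1) x e})ᗮ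

/-- The vessel `V''`, the compression of `V'` to `E''`. -/
def reducedTransform (V : VesselData H E) (p : Fin 3 → MvPolynomial (Fin 2) ℝ)
    (β : ∀ i j, BezoutCoeffs (mapDegree p - 1) (form p i) (form p j)) :
    VesselData H (reducedSubspace V p) :=
  (transform V p β).restrict (reducedSubspace V p)

end Transformation

/-! ### Existence of the Bezout coefficients -/

section Existence

/-- The functions `x^i y^j` with `|i| = |j| = k`. -/
def bimon (k : ℕ) (ij : MultiIdx k × MultiIdx k) : (Fin 3 → ℂ) → (Fin 3 → ℂ) → ℂ :=
  fun x y => mon x ij.1.1 * mon y ij.2.1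

/-- The real span of the functions `x^i y^j` with `|i| = |j| = k`. -/
def bispan (k : ℕ) : Submodule ℝ ((Fin 3 → ℂ) → (Fin 3 → ℂ) → ℂ) :=
  Submodule.span ℝ (Set.range (bimon k))

/-- `F` is a combination of the three minors with coefficients in `bispan k`. -/
def Rep (k : ℕ) (F : (Fin 3 → ℂ) → (Fin 3 → ℂ) → ℂ) : Prop :=
  ∃ f ∈ bispan k, ∃ g ∈ bispan k, ∃ h ∈ bispan k, ∀ x y, F x y =
    f x y * (x 1 * y 0 - x 0 * y 1) + g x y * (x 2 * y 0 - x 0 * y 2)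
      + h x y * (x 1 * y 2 - x 2 * y 1)

theorem Rep.zero (k : ℕ) : Rep k 0 :=
  ⟨0, zero_mem _, 0, zero_mem _, 0, zero_mem _, fun x y => by simp⟩

theorem Rep.add {k : ℕ} {F G : (Fin 3 → ℂ) → (Fin 3 → ℂ) → ℂ} (hF : Rep k F) (hG : Rep k G) :
    Rep k (F + G) := by
  obtain ⟨f, hf, g, hg, h, hh, e⟩ := hF
  obtain ⟨f', hf', g', hg', h', hh', e'⟩ := hG
  refine ⟨f + f', add_mem hf hf', g + g', add_mem hg hg', h + h', add_mem hh hh', fun x y => ?_⟩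
  simp only [Pi.add_apply, e, e']
  ring

theorem Rep.smul {k : ℕ} {F : (Fin 3 → ℂ) → (Fin 3 → ℂ) → ℂ} (c : ℝ) (hF : Rep k F) :
    Rep k (c • F) := by
  obtain ⟨f, hf, g, hg, h, hh, e⟩ := hF
  refine ⟨c • f, Submodule.smul_mem _ c hf, c • g, Submodule.smul_mem _ c hg,
    c • h, Submodule.smul_mem _ c hh, fun x y => ?_⟩
  simp only [Pi.smul_apply, e, Complex.real_smul]
  ring

theorem Rep.sum {k : ℕ} {ι : Type*} (s : Finset ι)
    (F : ι → (Fin 3 → ℂ) → (Fin 3 → ℂ) → ℂ) (hF : ∀ i ∈ s, Rep k (F i)) :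
    Rep k (∑ i ∈ s, F i) :=
  Finset.sum_induction F (Rep k) (fun _ _ => Rep.add) (Rep.zero k) hF

theorem mon_mul_mem {k : ℕ} {a b : Fin 3 → ℕ} (ha : ∑ l, a l = k) (hb : ∑ l, b l = k) :
    (fun x y => mon x a * mon y b) ∈ bispan k :=
  Submodule.subset_span ⟨(⟨a, Finset.Nat.mem_antidiagonalTuple.2 ha⟩,
    ⟨b, Finset.Nat.mem_antidiagonalTuple.2 hb⟩), rfl⟩

theorem mon_add_single (x : Fin 3 → ℂ) (a : Fin 3 → ℕ) (s : Fin 3) :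
    mon x (a + Pi.single s 1) = x s * mon x a := by
  fin_cases s <;> simp [mon, Fin.prod_univ_three, pow_succ] <;> ring

theorem sum_add_single (a : Fin 3 → ℕ) (s : Fin 3) :
    ∑ l, (a + Pi.single s 1 : Fin 3 → ℕ) l = ∑ l, a l + 1 := by
  simp [Finset.sum_add_distrib]

theorem exists_add_single {k : ℕ} {a : Fin 3 → ℕ} (ha : ∑ l, a l = k + 1) :
    ∃ (s : Fin 3) (a' : Fin 3 → ℕ), a = a' + Pi.single s 1 ∧ ∑ l, a' l = k := by
  obtain ⟨s, hs⟩ : ∃ s, a s ≠ 0 := by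
    by_contra! h
    simp [h] at ha
  have e : a = (a - Pi.single s 1) + Pi.single s 1 := by
    funext l
    by_cases h : l = s
    · subst h
      simp only [Pi.add_apply, Pi.sub_apply, Pi.single_eq_same]
      omega
    · simp [h]
  refine ⟨s, a - Pi.single s 1, e, ?_⟩
  have := sum_add_single (a - Pi.single s 1) s
  rw [← e, ha] at this
  omega

theorem shift_mem {k : ℕ} {f : (Fin 3 → ℂ) → (Fin 3 → ℂ) → ℂ} (s t : Fin 3)
    (hf : f ∈ bispan k) : (fun x y => x s * y t * f x y) ∈ bispan (k + 1) := by
  induction hf using Submodule.span_induction with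
  | mem f h =>
    obtain ⟨ij, rfl⟩ := h
    have h1 : ∑ l, (ij.1.1 + Pi.single s 1 : Fin 3 → ℕ) l = k + 1 := by
      rw [sum_add_single, Finset.Nat.mem_antidiagonalTuple.1 ij.1.2]
    have h2 : ∑ l, (ij.2.1 + Pi.single t 1 : Fin 3 → ℕ) l = k + 1 := by
      rw [sum_add_single, Finset.Nat.mem_antidiagonalTuple.1 ij.2.2]
    convert mon_mul_mem h1 h2 using 3 with x y
    rw [mon_add_single, mon_add_single, bimon]
    ring
  | zero => convert zero_mem (bispan (k + 1)) using 3; simp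
  | add f g _ _ hf hg =>
    convert add_mem hf hg using 1
    funext x y
    simp only [Pi.add_apply]
    ring
  | smul c f _ hf =>
    convert Submodule.smul_mem _ c hf using 1
    funext x y
    simp only [Pi.smul_apply, Complex.real_smul]
    ring

theorem exists_minor (s t : Fin 3) : ∃ c d e : ℝ, ∀ x y : Fin 3 → ℂ,
    x s * y t - x t * y s = c * (x 1 * y 0 - x 0 * y 1) + d * (x 2 * y 0 - x 0 * y 2)
      + e * (x 1 * y 2 - x 2 * y 1) := by
  fin_cases s <;> fin_cases t
  · exact ⟨0, 0, 0, fun x y => by simp⟩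
  · exact ⟨-1, 0, 0, fun x y => by simp⟩
  · exact ⟨0, -1, 0, fun x y => by simp⟩
  · exact ⟨1, 0, 0, fun x y => by simp⟩
  · exact ⟨0, 0, 0, fun x y => by simp⟩
  · exact ⟨0, 0, 1, fun x y => by simp⟩
  · exact ⟨0, 1, 0, fun x y => by simp⟩
  · exact ⟨0, 0, -1, fun x y => by simp⟩
  · exact ⟨0, 0, 0, fun x y => by simp⟩

theorem rep_mon (k : ℕ) : ∀ a b : Fin 3 → ℕ, ∑ l, a l = k + 1 → ∑ l, b l = k + 1 →
    Rep k (fun x y => mon x a * mon y b - mon x b * mon y a) := by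
  induction k with
  | zero =>
    intro a b ha hb
    obtain ⟨s, a', rfl, ha'⟩ := exists_add_single ha
    obtain ⟨t, b', rfl, hb'⟩ := exists_add_single hb
    have ha0 : a' = 0 := by
      funext l; exact (Finset.sum_eq_zero_iff.1 ha') l (Finset.mem_univ l)
    have hb0 : b' = 0 := by
      funext l; exact (Finset.sum_eq_zero_iff.1 hb') l (Finset.mem_univ l)
    subst ha0 hb0
    obtain ⟨c, d, e, h⟩ := exists_minor s t
    have h1 := mon_mul_mem (k := 0) (a := 0) (b := 0) (by simp) (by simp)
    refine ⟨_, Submodule.smul_mem _ c h1, _, Submodule.smul_mem _ d h1,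
      _, Submodule.smul_mem _ e h1, fun x y => ?_⟩
    have h0 : ∀ z : Fin 3 → ℂ, mon z 0 = 1 := fun z => by simp [mon]
    simp only [mon_add_single, Pi.smul_apply, Complex.real_smul, h0, mul_one]
    linear_combination h x y
  | succ k ih =>
    intro a b ha hb
    obtain ⟨s, a', rfl, ha'⟩ := exists_add_single ha
    obtain ⟨t, b', rfl, hb'⟩ := exists_add_single hb
    obtain ⟨c, d, e, h⟩ := exists_minor s t
    have h1 := mon_mul_mem hb' ha'
    obtain ⟨f, hf, g, hg, r, hr, hE⟩ := ih a' b' ha' hb'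
    refine ⟨_, add_mem (shift_mem s t hf) (Submodule.smul_mem _ c h1),
      _, add_mem (shift_mem s t hg) (Submodule.smul_mem _ d h1),
      _, add_mem (shift_mem s t hr) (Submodule.smul_mem _ e h1), fun x y => ?_⟩
    have hE' := hE x y
    simp only [mon_add_single, Pi.add_apply, Pi.smul_apply, Complex.real_smul] at hE' ⊢
    linear_combination (x s * y t) * hE' + (mon x b' * mon y a') * h x y

theorem aeval_eq_sum_mon (p : MvPolynomial (Fin 3) ℝ) (x : Fin 3 → ℂ) :
    aeval x p = ∑ d ∈ p.support, ((p.coeff d : ℝ) : ℂ) * mon x d := by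
  rw [aeval_def, eval₂_eq']
  rfl

theorem sum_of_mem_support {n : ℕ} {p : MvPolynomial (Fin 3) ℝ} (hp : p.IsHomogeneous n)
    {d : Fin 3 →₀ ℕ} (hd : d ∈ p.support) : ∑ l, d l = n := by
  rw [← hp (mem_support_iff.1 hd), Finsupp.weight_apply, Finsupp.sum_fintype _ _ (by simp)]
  simp

/-- Any two real forms of the same degree `k + 1` admit Bezout coefficients. -/
theorem BezoutCoeffs.nonempty {k : ℕ} {p q : MvPolynomial (Fin 3) ℝ}
    (hp : p.IsHomogeneous (k + 1)) (hq : q.IsHomogeneous (k + 1)) :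
    Nonempty (BezoutCoeffs k p q) := by
  have hrep : Rep k (∑ d ∈ p.support, ∑ e ∈ q.support, (p.coeff d * q.coeff e) •
      fun x y => mon x d * mon y e - mon x e * mon y d) :=
    Rep.sum _ _ fun d hd => Rep.sum _ _ fun e he => Rep.smul _
      (rep_mon k d e (sum_of_mem_support hp hd) (sum_of_mem_support hq he))
  obtain ⟨f, hf, g, hg, h, hh, hE⟩ := hrep
  obtain ⟨cf, rfl⟩ := (Submodule.mem_span_range_iff_exists_fun ℝ).1 hf
  obtain ⟨cg, rfl⟩ := (Submodule.mem_span_range_iff_exists_fun ℝ).1 hg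
  obtain ⟨ch, rfl⟩ := (Submodule.mem_span_range_iff_exists_fun ℝ).1 hh
  have hF : ∀ x y : Fin 3 → ℂ, aeval x p * aeval y q - aeval x q * aeval y p =
      (∑ ij, (cf ij : ℂ) * bimon k ij x y) * (x 1 * y 0 - x 0 * y 1)
      + (∑ ij, (cg ij : ℂ) * bimon k ij x y) * (x 2 * y 0 - x 0 * y 2)
      + (∑ ij, (ch ij : ℂ) * bimon k ij x y) * (x 1 * y 2 - x 2 * y 1) := by
    intro x y
    have := hE x y
    simp only [Finset.sum_apply, Pi.smul_apply, Complex.real_smul] at this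
    rw [← this]
    simp only [aeval_eq_sum_mon, Finset.sum_mul_sum]
    rw [Finset.sum_comm (s := q.support), ← Finset.sum_sub_distrib]
    refine Finset.sum_congr rfl fun d _ => ?_
    rw [← Finset.sum_sub_distrib]
    refine Finset.sum_congr rfl fun e _ => ?_
    push_cast
    ring
  let S : (MultiIdx k × MultiIdx k → ℝ) → Matrix (MultiIdx k) (MultiIdx k) ℝ :=
    fun c => Matrix.of fun i j => (c (i, j) + c (j, i)) / 2
  have hS : ∀ c, (S c).IsSymm := fun c => by
    ext i j
    simp [S, add_comm]
  have key : ∀ (c : MultiIdx k × MultiIdx k → ℝ) (x y : Fin 3 → ℂ) (m : ℂ),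
      ∑ i, ∑ j, ((S c i j : ℝ) : ℂ) * (mon x i.1 * m * mon y j.1) =
      ((∑ ij, (c ij : ℂ) * bimon k ij x y) * m + (∑ ij, (c ij : ℂ) * bimon k ij y x) * m) / 2 := by
    intro c x y m
    have h2 : ∑ ij, (c ij : ℂ) * bimon k ij y x
        = ∑ i, ∑ j, (c (j, i) : ℂ) * bimon k (j, i) y x := by
      rw [Fintype.sum_prod_type, Finset.sum_comm]
    rw [h2, Fintype.sum_prod_type, Finset.sum_mul, Finset.sum_mul, ← Finset.sum_add_distrib,
      Finset.sum_div]
    refine Finset.sum_congr rfl fun i _ => ?_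
    rw [Finset.sum_mul, Finset.sum_mul, ← Finset.sum_add_distrib, Finset.sum_div]
    refine Finset.sum_congr rfl fun j _ => ?_
    simp only [S, Matrix.of_apply, bimon]
    push_cast
    ring
  refine ⟨⟨S cf, S cg, S ch, hS _, hS _, hS _, fun x y => ?_⟩⟩
  simp only [Finset.sum_add_distrib, key]
  linear_combination (hF x y - hF y x) / 2

theorem form_isHomogeneous (p : Fin 3 → MvPolynomial (Fin 2) ℝ) (i : Fin 3) :
    (form p i).IsHomogeneous (mapDegree p) := by
  refine IsHomogeneous.sum _ _ _ fun d hd => ?_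
  have h1 : d 0 + d 1 ≤ mapDegree p := by
    have h2 : (d.sum fun _ e => e) ≤ (p i).totalDegree := le_totalDegree hd
    rw [Finsupp.sum_fintype _ _ (by simp), Fin.sum_univ_two] at h2
    exact h2.trans (Finset.le_sup (f := fun i => (p i).totalDegree) (Finset.mem_univ i))
  have h3 := (((isHomogeneous_X_pow (R := ℝ) (0 : Fin 3) (mapDegree p - d 0 - d 1)).mul
    (isHomogeneous_X_pow (1 : Fin 3) (d 0))).mul (isHomogeneous_X_pow (2 : Fin 3) (d 1)))
  have h4 := (isHomogeneous_C (Fin 3) ((p i).coeff d)).mul h3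
  convert h4 using 1
  omega

/-- The Bezout coefficients used for the transformation of a vessel exist. -/
theorem BezoutCoeffs.nonempty_form (p : Fin 3 → MvPolynomial (Fin 2) ℝ) (i j : Fin 3) :
    Nonempty (BezoutCoeffs (mapDegree p - 1) (form p i) (form p j)) := by
  have hi := form_isHomogeneous p i
  have hj := form_isHomogeneous p j
  rcases Nat.eq_zero_or_pos (mapDegree p) with h | h
  · rw [h] at hi hj
    have hc : ∀ f : MvPolynomial (Fin 3) ℝ, f.IsHomogeneous 0 → ∀ x y : Fin 3 → ℂ,
        aeval x f = aeval y f := by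
      intro f hf x y
      rw [aeval_eq_sum_mon, aeval_eq_sum_mon]
      refine Finset.sum_congr rfl fun d hd => ?_
      have h0 := sum_of_mem_support hf hd
      have h1 : ∀ l, d l = 0 := fun l => (Finset.sum_eq_zero_iff.1 h0) l (Finset.mem_univ l)
      simp [mon, h1]
    refine ⟨⟨0, 0, 0, by ext; simp, by ext; simp, by ext; simp, fun x y => ?_⟩⟩
    rw [hc _ hi x y, hc _ hj x y]
    simp
    ring
  · obtain ⟨k, hk⟩ : ∃ k, mapDegree p = k + 1 := ⟨mapDegree p - 1, by omega⟩
    rw [hk] at hi hj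
    have hk' : mapDegree p - 1 = k := by omega
    rw [hk']
    exact BezoutCoeffs.nonempty hi hj

end Existence

end CommVessel

end

noncomputable section

namespace CommVessel

open MvPolynomial

/-! Let S = ℂ[x₀,x₁,x₂]. The principal subspace V_n is the degree n-1 part of `pencilKernel`: the
E-valued functionals v on S with γⁱⁿ v(x₀f) + σ₂ v(x₁f) - σ₁ v(x₂f) = 0 for all f, that is, the dual
of the cokernel of the transposed pencil, a module supported on C. At a point y the pencil of V' is
the Bezout form of Q₁ = P₁ - y₁P₀ and Q₂ = P₂ - y₂P₀ (`pencilForm_eq`), so the theorem is a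
computation of the kernel of this form on V_n.

The form has a symmetry. For v in the kernel of the pencil and ω in that of its transpose, the
vector of pairings ω(f)(D_l v(g)), l = 0, 1, 2, is annihilated by both sets of variables, hence
parallel to their cross product (`pairing_minor`). With the Bezout identity this lets linear forms
be exchanged between the two arguments whenever v kills Q₁ and Q₂ (`IsBezout.shiftedForm_symm`).
Moreover every ω is a multiple of a suitable linear form L (`IsSeparating.exists_shift_eq`). Two
consequences follow. Functionals at common points of C, Q₁, Q₂ lie in the kernel
(`IsBezout.pointFunctional_mem_bezoutKernel`). Conversely, any kernel element lifts degree by degree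
to a functional on the affine chart L = 1 annihilating Q₁ and Q₂ (`IsBezout.exists_extension`). Such
functionals form a finite-dimensional space with commuting multiplications by the coordinates; it is
spanned by point functionals if no first-order functional occurs (`affineKernel_le_span`).

Suppose y is off C'. A polynomial that vanishes on C' but not at y pulls back to a multiple of Δ.
Hence the common points of C, Q₁, Q₂ are base points, and directions in the tangent cone of C that
respect the equations Q₁ = Q₂ = 0 to first order are killed by the differential of (P₀,P₁,P₂).
Maximality makes the pencil nondegenerate in every direction outside the tangent cone, and
simplicity reduces the remaining directions to such a one (`hasNoTangent`). So the kernel on V_n is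
the span of the base point Vandermonde vectors, whose orthogonal complement is E''.

Suppose y = r(z). The Vandermonde vector at z is in the kernel. It is not in the base span, because
extension to the chart is unique and P₀ annihilates extensions from the base span but not the
functional at z (`vandermonde_notMem_baseSpan`). As the base span lies in the radical of the form on
both sides, compression to E'' divides it out and leaves a nonzero kernel vector. Vanishing of the
determinant then passes to the Zariski closure. -/

theorem homogeneousComponent_mul_of_isHomogeneous {k d : ℕ} {g : MvPolynomial (Fin 3) ℂ}
    (hg : g.IsHomogeneous d) (f : MvPolynomial (Fin 3) ℂ) :
    homogeneousComponent (k + d) (g * f) = g * homogeneousComponent k f := by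
  conv_lhs => rw [← sum_homogeneousComponent f, Finset.mul_sum, map_sum]
  have h : ∀ i, homogeneousComponent (k + d) (g * homogeneousComponent i f) =
      if k = i then g * homogeneousComponent k f else 0 := by
    intro i
    rw [homogeneousComponent_of_mem (hg.mul (homogeneousComponent_isHomogeneous i f))]
    by_cases hi : k = i
    · subst hi
      rw [if_pos (add_comm _ _), if_pos rfl]
    · rw [if_neg (by omega), if_neg hi]
  simp only [h, Finset.sum_ite_eq, Finset.mem_range]
  split_ifs with hk
  · rfl
  · rw [homogeneousComponent_eq_zero _ _ (by omega), mul_zero]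

theorem homogeneousComponent_mul_eq_zero {k d : ℕ} {g : MvPolynomial (Fin 3) ℂ}
    (hg : g.IsHomogeneous d) (hk : k < d) (f : MvPolynomial (Fin 3) ℂ) :
    homogeneousComponent k (g * f) = 0 := by
  rw [← sum_homogeneousComponent f, Finset.mul_sum, map_sum]
  refine Finset.sum_eq_zero fun i _ => ?_
  rw [homogeneousComponent_of_mem (hg.mul (homogeneousComponent_isHomogeneous i f)),
    if_neg (by omega)]

/-! ### Vector-valued functionals on the graded polynomial ring -/

section GradedFunctionals

variable {E : Type*} [AddCommGroup E] [Module ℂ E]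

/-- The operation `v ↦ v (g · )` on `E`-valued functionals of polynomials. -/
def shift (g : MvPolynomial (Fin 3) ℂ) :
    (MvPolynomial (Fin 3) ℂ →ₗ[ℂ] E) →ₗ[ℂ] (MvPolynomial (Fin 3) ℂ →ₗ[ℂ] E) :=
  LinearMap.lcomp ℂ E (LinearMap.mulLeft ℂ g)

@[simp] theorem shift_apply (g f : MvPolynomial (Fin 3) ℂ) (v : MvPolynomial (Fin 3) ℂ →ₗ[ℂ] E) :
    shift g v f = v (g * f) := rfl

theorem shift_comm (g h : MvPolynomial (Fin 3) ℂ) (v : MvPolynomial (Fin 3) ℂ →ₗ[ℂ] E) :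
    shift g (shift h v) = shift h (shift g v) := by
  refine LinearMap.ext fun f => ?_
  simp [mul_left_comm]

theorem shift_mul (g h : MvPolynomial (Fin 3) ℂ) (v : MvPolynomial (Fin 3) ℂ →ₗ[ℂ] E) :
    shift (g * h) v = shift g (shift h v) := by
  refine LinearMap.ext fun f => ?_
  simp [mul_assoc, mul_left_comm]

/-- The functionals that only see the homogeneous component of degree `k`. -/
def gradedPart (E : Type*) [AddCommGroup E] [Module ℂ E] (k : ℕ) :
    Submodule ℂ (MvPolynomial (Fin 3) ℂ →ₗ[ℂ] E) where
  carrier := {v | ∀ f d, f.IsHomogeneous d → d ≠ k → v f = 0}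
  zero_mem' := fun _ _ _ _ => rfl
  add_mem' := fun hv hw f d hf hd => by simp [hv f d hf hd, hw f d hf hd]
  smul_mem' := fun c v hv f d hf hd => by simp [hv f d hf hd]

theorem gradedPart_apply {k : ℕ} {v : MvPolynomial (Fin 3) ℂ →ₗ[ℂ] E} (hv : v ∈ gradedPart E k)
    (f : MvPolynomial (Fin 3) ℂ) : v f = v (homogeneousComponent k f) := by
  conv_lhs => rw [← sum_homogeneousComponent f]
  rw [map_sum]
  by_cases h : k ∈ Finset.range (f.totalDegree + 1)
  · exact Finset.sum_eq_single_of_mem k h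
      fun d _ hd => hv _ d (homogeneousComponent_isHomogeneous d f) hd
  · rw [homogeneousComponent_eq_zero, map_zero]
    · exact Finset.sum_eq_zero fun d hd =>
        hv _ d (homogeneousComponent_isHomogeneous d f) (by rintro rfl; exact h hd)
    · simpa using h

theorem gradedPart_ext {k : ℕ} {v w : MvPolynomial (Fin 3) ℂ →ₗ[ℂ] E} (hv : v ∈ gradedPart E k)
    (hw : w ∈ gradedPart E k) (h : ∀ f, f.IsHomogeneous k → v f = w f) : v = w := by
  refine LinearMap.ext fun f => ?_
  rw [gradedPart_apply hv, gradedPart_apply hw, h _ (homogeneousComponent_isHomogeneous k f)]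

theorem shift_mem_gradedPart {k d : ℕ} {g : MvPolynomial (Fin 3) ℂ} (hg : g.IsHomogeneous d)
    {v : MvPolynomial (Fin 3) ℂ →ₗ[ℂ] E} (hv : v ∈ gradedPart E (k + d)) :
    shift g v ∈ gradedPart E k :=
  fun f e hf he => hv _ (d + e) (hg.mul hf) (by omega)

theorem gradedPart_shift_eq_zero {k d : ℕ} {g : MvPolynomial (Fin 3) ℂ} (hg : g.IsHomogeneous d)
    (hk : k < d) {v : MvPolynomial (Fin 3) ℂ →ₗ[ℂ] E} (hv : v ∈ gradedPart E k) :
    shift g v = 0 := by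
  refine LinearMap.ext fun f => ?_
  rw [shift_apply, gradedPart_apply hv]
  rw [homogeneousComponent_mul_eq_zero hg hk, map_zero, LinearMap.zero_apply]

/-- The degree `k` part of a functional. -/
def component (k : ℕ) (v : MvPolynomial (Fin 3) ℂ →ₗ[ℂ] E) : MvPolynomial (Fin 3) ℂ →ₗ[ℂ] E :=
  v ∘ₗ homogeneousComponent k

theorem component_mem (k : ℕ) (v : MvPolynomial (Fin 3) ℂ →ₗ[ℂ] E) :
    component k v ∈ gradedPart E k := by
  intro f d hf hd
  rw [component, LinearMap.comp_apply, homogeneousComponent_of_mem hf, if_neg hd.symm, map_zero]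

theorem component_apply_of_isHomogeneous {k : ℕ} (v : MvPolynomial (Fin 3) ℂ →ₗ[ℂ] E)
    {f : MvPolynomial (Fin 3) ℂ} (hf : f.IsHomogeneous k) : component k v f = v f := by
  rw [component, LinearMap.comp_apply, homogeneousComponent_of_mem hf, if_pos rfl]

theorem shift_component {k d : ℕ} {g : MvPolynomial (Fin 3) ℂ} (hg : g.IsHomogeneous d)
    (v : MvPolynomial (Fin 3) ℂ →ₗ[ℂ] E) :
    shift g (component (k + d) v) = component k (shift g v) := by
  refine LinearMap.ext fun f => ?_
  simp only [component, shift_apply, LinearMap.comp_apply,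
    homogeneousComponent_mul_of_isHomogeneous hg]

/-- The exponent vector of a multi-index. -/
def MultiIdx.toFinsupp {k : ℕ} (i : MultiIdx k) : Fin 3 →₀ ℕ := Finsupp.equivFunOnFinite.symm i.1

/-- The monomial `X^i`. -/
def MultiIdx.monomial {k : ℕ} (i : MultiIdx k) : MvPolynomial (Fin 3) ℂ :=
  MvPolynomial.monomial i.toFinsupp 1

theorem MultiIdx.toFinsupp_injective {k : ℕ} :
    Function.Injective (MultiIdx.toFinsupp : MultiIdx k → _) :=
  fun _ _ h => Subtype.ext (Finsupp.equivFunOnFinite.symm.injective h)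

theorem MultiIdx.degree_toFinsupp {k : ℕ} (i : MultiIdx k) : i.toFinsupp.degree = k := by
  rw [Finsupp.degree_eq_sum]
  exact Finset.Nat.mem_antidiagonalTuple.1 i.2

theorem MultiIdx.isHomogeneous_monomial {k : ℕ} (i : MultiIdx k) :
    i.monomial.IsHomogeneous k :=
  MvPolynomial.isHomogeneous_monomial _ i.degree_toFinsupp

theorem MultiIdx.eval_monomial {k : ℕ} (i : MultiIdx k) (x : Fin 3 → ℂ) :
    eval x i.monomial = mon x i.1 := by
  rw [MultiIdx.monomial, MvPolynomial.eval_monomial, one_mul, Finsupp.prod_fintype _ _ (by simp)]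
  rfl

theorem eq_sum_monomial {k : ℕ} {f : MvPolynomial (Fin 3) ℂ} (hf : f.IsHomogeneous k) :
    f = ∑ i : MultiIdx k, coeff i.toFinsupp f • i.monomial := by
  ext d
  simp only [coeff_sum, coeff_smul, MultiIdx.monomial, coeff_monomial, smul_eq_mul]
  by_cases hd : d.degree = k
  · have hd' : (⇑d : Fin 3 → ℕ) ∈ Finset.Nat.antidiagonalTuple 3 k := by
      rw [Finset.Nat.mem_antidiagonalTuple, ← hd, Finsupp.degree_eq_sum]
    have e : MultiIdx.toFinsupp ⟨d, hd'⟩ = d := by ext; rfl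
    rw [Finset.sum_eq_single ⟨d, hd'⟩]
    · simp [e]
    · intro j _ hj
      rw [if_neg, mul_zero]
      exact fun h => hj (MultiIdx.toFinsupp_injective (h.trans e.symm))
    · simp
  · rw [hf.coeff_eq_zero hd, Finset.sum_eq_zero]
    intro j _
    rw [if_neg, mul_zero]
    rintro rfl
    exact hd j.degree_toFinsupp

theorem MultiIdx.exists_monomial_eq {k : ℕ} (i : MultiIdx (k + 1)) :
    ∃ (s : Fin 3) (j : MultiIdx k), i.monomial = X s * j.monomial := by
  obtain ⟨s, a, e, ha⟩ := exists_add_single (Finset.Nat.mem_antidiagonalTuple.1 i.2)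
  refine ⟨s, ⟨a, Finset.Nat.mem_antidiagonalTuple.2 ha⟩, ?_⟩
  have hi : i.toFinsupp = Finsupp.single s 1 +
      MultiIdx.toFinsupp ⟨a, Finset.Nat.mem_antidiagonalTuple.2 ha⟩ := by
    refine Finsupp.ext fun l => ?_
    rw [Finsupp.add_apply, Finsupp.single_apply, MultiIdx.toFinsupp]
    change i.1 l = _ + a l
    rw [e, Pi.add_apply, Pi.single_apply, add_comm]
    simp only [eq_comm]
  rw [MultiIdx.monomial, MultiIdx.monomial, X, monomial_mul, one_mul, hi]

/-- Reduces statements that are linear in a form of each degree to multiplication by one variable at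
a time. -/
theorem isHomogeneous_induction (S : ℕ → Submodule ℂ (MvPolynomial (Fin 3) ℂ)) (h0 : 1 ∈ S 0)
    (hX : ∀ n l f, f ∈ S n → X l * f ∈ S (n + 1)) {n : ℕ} {f : MvPolynomial (Fin 3) ℂ}
    (hf : f.IsHomogeneous n) : f ∈ S n := by
  have key : ∀ n, ∀ i : MultiIdx n, i.monomial ∈ S n := by
    intro n
    induction n with
    | zero =>
      intro i
      have : i.toFinsupp = 0 := (Finsupp.degree_eq_zero_iff _).1 i.degree_toFinsupp
      rw [MultiIdx.monomial, this]
      exact h0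
    | succ n ih =>
      intro i
      obtain ⟨s, j, hi⟩ := i.exists_monomial_eq
      rw [hi]
      exact hX n s _ (ih j)
  rw [eq_sum_monomial hf]
  exact Submodule.sum_mem _ fun i _ => Submodule.smul_mem _ _ (key n i)

/-- The functional with prescribed values on the monomials of degree `k`. -/
def expand (k : ℕ) : (MultiIdx k → E) →ₗ[ℂ] (MvPolynomial (Fin 3) ℂ →ₗ[ℂ] E) where
  toFun w := ∑ i, (lcoeff ℂ i.toFinsupp).smulRight (w i)
  map_add' v w := by refine LinearMap.ext fun f => ?_; simp [Finset.sum_add_distrib]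
  map_smul' c w := by refine LinearMap.ext fun f => ?_; simp [Finset.smul_sum, smul_comm c]

theorem expand_apply {k : ℕ} (w : MultiIdx k → E) (f : MvPolynomial (Fin 3) ℂ) :
    expand k w f = ∑ i, coeff i.toFinsupp f • w i := by
  simp [expand]

theorem expand_monomial {k : ℕ} (w : MultiIdx k → E) (i : MultiIdx k) :
    expand k w i.monomial = w i := by
  rw [expand_apply, Finset.sum_eq_single i]
  · simp [MultiIdx.monomial]
  · intro j _ hj
    rw [MultiIdx.monomial, coeff_monomial, if_neg, zero_smul]
    exact fun h => hj (MultiIdx.toFinsupp_injective h.symm)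
  · simp

theorem expand_mem {k : ℕ} (w : MultiIdx k → E) : expand k w ∈ gradedPart E k := by
  intro f d hf hd
  rw [expand_apply]
  refine Finset.sum_eq_zero fun i _ => ?_
  rw [hf.coeff_eq_zero, zero_smul]
  rw [i.degree_toFinsupp]
  exact hd.symm

theorem expand_eq {k : ℕ} {v : MvPolynomial (Fin 3) ℂ →ₗ[ℂ] E} (hv : v ∈ gradedPart E k) :
    expand k (fun i => v i.monomial) = v := by
  refine gradedPart_ext (expand_mem _) hv fun f hf => ?_
  conv_rhs => rw [eq_sum_monomial hf]
  rw [expand_apply, map_sum]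
  simp

/-- Functionals of degree `k` are given by their values on the monomials. -/
def gradedPartEquiv (k : ℕ) : gradedPart E k ≃ₗ[ℂ] (MultiIdx k → E) where
  toFun v i := v.1 i.monomial
  map_add' _ _ := rfl
  map_smul' _ _ := rfl
  invFun w := ⟨expand k w, expand_mem w⟩
  left_inv v := Subtype.ext (expand_eq v.2)
  right_inv w := by ext i; exact expand_monomial w i

theorem card_multiIdx_zero : Fintype.card (MultiIdx 0) = 1 := by
  rw [Fintype.card_coe]; rfl

/-- Multiples of x₀ account for the first summand and monomials free of x₀ for the other k + 2. The
inequality is all that the dimension count needs. -/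
theorem card_multiIdx_succ (k : ℕ) :
    Fintype.card (MultiIdx k) + (k + 2) ≤ Fintype.card (MultiIdx (k + 1)) := by
  let φ : MultiIdx k ⊕ Fin (k + 2) → MultiIdx (k + 1) := Sum.elim
    (fun i => ⟨i.1 + Pi.single 0 1, by
      rw [Finset.Nat.mem_antidiagonalTuple, sum_add_single,
        Finset.Nat.mem_antidiagonalTuple.1 i.2]⟩)
    (fun t => ⟨![0, t, k + 1 - t], by
      rw [Finset.Nat.mem_antidiagonalTuple, Fin.sum_univ_three]
      have := t.2
      change 0 + (t : ℕ) + (k + 1 - t) = k + 1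
      omega⟩)
  have hφ : Function.Injective φ := by
    rintro (i | s) (j | t) h
    · exact congrArg Sum.inl (Subtype.ext (add_right_cancel (Subtype.ext_iff.1 h)))
    · have := congrFun (Subtype.ext_iff.1 h) 0
      simp [φ] at this
    · have := congrFun (Subtype.ext_iff.1 h) 0
      simp [φ] at this
    · have h1 : (s : ℕ) = t := congrFun (Subtype.ext_iff.1 h) 1
      rw [Fin.ext h1]
  simpa using Fintype.card_le_of_injective φ hφ

variable [FiniteDimensional ℂ E]

instance finiteDimensional_gradedPart (k : ℕ) : FiniteDimensional ℂ (gradedPart E k) :=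
  Module.Finite.equiv (gradedPartEquiv k).symm

theorem finrank_gradedPart (k : ℕ) :
    Module.finrank ℂ (gradedPart E k) = Fintype.card (MultiIdx k) * Module.finrank ℂ E := by
  rw [(gradedPartEquiv k).finrank_eq, Module.finrank_pi_fintype,
    Finset.sum_const, Finset.card_univ, smul_eq_mul]

end GradedFunctionals

/-! ### The kernel of the pencil on functionals -/

section PencilKernel

variable {E : Type*} [AddCommGroup E] [Module ℂ E] (D : Fin 3 → E →ₗ[ℂ] E)

/-- The functionals annihilating the image of the pencil `∑ X l • D l`. -/
def pencilKernel : Submodule ℂ (MvPolynomial (Fin 3) ℂ →ₗ[ℂ] E) where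
  carrier := {v | ∀ f, ∑ l, D l (v (X l * f)) = 0}
  zero_mem' := fun f => by simp
  add_mem' := fun {v w} hv hw f => by
    simp only [LinearMap.add_apply, map_add, Finset.sum_add_distrib, hv f, hw f, add_zero]
  smul_mem' := fun c v hv f => by
    simp only [LinearMap.smul_apply, map_smul, ← Finset.smul_sum, hv f, smul_zero]

theorem shift_mem_pencilKernel (g : MvPolynomial (Fin 3) ℂ)
    {v : MvPolynomial (Fin 3) ℂ →ₗ[ℂ] E} (hv : v ∈ pencilKernel D) :
    shift g v ∈ pencilKernel D := by
  intro f
  simpa [mul_left_comm] using hv (g * f)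

/-- The elements of degree `k` of `pencilKernel D`: functionals on the degree `k` part of the
cokernel of the pencil. -/
def gradedKernel (k : ℕ) : Submodule ℂ (MvPolynomial (Fin 3) ℂ →ₗ[ℂ] E) :=
  gradedPart E k ⊓ pencilKernel D

variable {D}

theorem shift_mem_gradedKernel {k d : ℕ} {g : MvPolynomial (Fin 3) ℂ} (hg : g.IsHomogeneous d)
    {v : MvPolynomial (Fin 3) ℂ →ₗ[ℂ] E} (hv : v ∈ gradedKernel D (k + d)) :
    shift g v ∈ gradedKernel D k :=
  ⟨shift_mem_gradedPart hg hv.1, shift_mem_pencilKernel D g hv.2⟩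

theorem component_mem_gradedKernel (k : ℕ) {v : MvPolynomial (Fin 3) ℂ →ₗ[ℂ] E}
    (hv : v ∈ pencilKernel D) : component k v ∈ gradedKernel D k := by
  refine ⟨component_mem k v, fun f => ?_⟩
  cases k with
  | zero =>
    refine Finset.sum_eq_zero fun l _ => ?_
    rw [component, LinearMap.comp_apply,
      homogeneousComponent_mul_eq_zero (isHomogeneous_X ℂ l) zero_lt_one, map_zero, map_zero]
  | succ k =>
    simp only [component, LinearMap.comp_apply,
      homogeneousComponent_mul_of_isHomogeneous (isHomogeneous_X ℂ _)]
    exact hv _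

theorem gradedPart_eq_zero_of_shift_X {k : ℕ} {v : MvPolynomial (Fin 3) ℂ →ₗ[ℂ] E}
    (hv : v ∈ gradedPart E (k + 1)) (h : ∀ l, shift (X l) v = 0) : v = 0 := by
  refine gradedPart_ext hv (zero_mem _) fun f hf => ?_
  rw [eq_sum_monomial hf, map_sum, map_sum]
  refine Finset.sum_congr rfl fun i _ => ?_
  obtain ⟨s, j, hi⟩ := i.exists_monomial_eq
  have h2 := LinearMap.congr_fun (h s) j.monomial
  rw [shift_apply] at h2
  rw [map_smul, map_smul, hi, h2]
  simp

theorem gradedPart_zero_eq_zero {v : MvPolynomial (Fin 3) ℂ →ₗ[ℂ] E}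
    (hv : v ∈ gradedPart E 0) (h : v 1 = 0) : v = 0 := by
  refine gradedPart_ext hv (zero_mem _) fun f hf => ?_
  rw [totalDegree_eq_zero_iff_eq_C.1 (Nat.le_zero.1 hf.totalDegree_le), C_eq_smul_one, map_smul, h]
  simp

variable [FiniteDimensional ℂ E]

instance finiteDimensional_gradedKernel (k : ℕ) : FiniteDimensional ℂ (gradedKernel D k) :=
  Submodule.finiteDimensional_of_le (inf_le_left : _ ≤ gradedPart E k)

/-- Count of unknowns and equations: passing from degree k + 1 to degree k loses at least k + 2
monomials. No assumption on the determinant enters here; it enters for equality, in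
`IsSeparating.finrank_gradedKernel`. -/
theorem le_finrank_gradedKernel (k : ℕ) :
    (k + 1) * Module.finrank ℂ E ≤ Module.finrank ℂ (gradedKernel D k) := by
  cases k with
  | zero =>
    have : gradedKernel D 0 = gradedPart E 0 := by
      refine inf_eq_left.2 fun v hv f => Finset.sum_eq_zero fun l _ => ?_
      rw [← shift_apply, gradedPart_shift_eq_zero (isHomogeneous_X ℂ l) zero_lt_one hv]
      simp
    rw [this, finrank_gradedPart, card_multiIdx_zero]
  | succ k =>
    let T : gradedPart E (k + 1) →ₗ[ℂ] gradedPart E k :=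
      LinearMap.codRestrict _ ((∑ l, LinearMap.compRight ℂ (D l) ∘ₗ shift (X l)) ∘ₗ
        (gradedPart E (k + 1)).subtype) (by
          intro v f d hf hd
          simp only [LinearMap.comp_apply, LinearMap.sum_apply, LinearMap.compRight_apply,
            Submodule.subtype_apply]
          refine Finset.sum_eq_zero fun l _ => ?_
          rw [shift_mem_gradedPart (isHomogeneous_X ℂ l) v.2 f d hf hd, map_zero])
    have hT : ∀ v, T v = 0 ↔ v.1 ∈ pencilKernel D := by
      intro v
      rw [Subtype.ext_iff, LinearMap.ext_iff]
      refine forall_congr' fun f => ?_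
      change (∑ l, LinearMap.compRight ℂ (D l) ∘ₗ shift (X l)) v.1 f = 0 ↔ _
      rw [LinearMap.sum_apply, LinearMap.sum_apply]
      rfl
    have hker : Module.finrank ℂ (LinearMap.ker T) ≤ Module.finrank ℂ (gradedKernel D (k + 1)) := by
      let ψ : LinearMap.ker T →ₗ[ℂ] gradedKernel D (k + 1) :=
        LinearMap.codRestrict _ ((gradedPart E (k + 1)).subtype ∘ₗ (LinearMap.ker T).subtype)
          fun v => ⟨v.1.2, (hT _).1 v.2⟩
      refine LinearMap.finrank_le_finrank_of_injective (f := ψ) fun a b h => ?_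
      have h' := Subtype.ext_iff.1 h
      exact Subtype.ext (Subtype.ext h')
    have h1 := LinearMap.finrank_range_add_finrank_ker T
    have h2 := (LinearMap.range T).finrank_le
    rw [finrank_gradedPart] at h1 h2
    have h3 := Nat.mul_le_mul_right (Module.finrank ℂ E) (card_multiIdx_succ k)
    rw [add_mul] at h3
    linarith

end PencilKernel

/-! ### Restriction to a line and division by forms -/

section Lines

variable {E : Type*} [AddCommGroup E] [Module ℂ E]

/-- Two linear forms meeting at a point outside of the curve. -/
def IsSeparating (D : Fin 3 → E →ₗ[ℂ] E) (G H : MvPolynomial (Fin 3) ℂ) : Prop :=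
  ∀ v ∈ pencilKernel D, shift G v = 0 → shift H v = 0 → ∀ l, shift (X l) v = 0

theorem IsSeparating.symm {D : Fin 3 → E →ₗ[ℂ] E} {G H : MvPolynomial (Fin 3) ℂ}
    (h : IsSeparating D G H) : IsSeparating D H G :=
  fun v hv h1 h2 => h v hv h2 h1

/-- The functionals of degree `k` supported on the line `G = 0`. -/
def lineKernel (D : Fin 3 → E →ₗ[ℂ] E) (G : MvPolynomial (Fin 3) ℂ) (k : ℕ) :
    Submodule ℂ (MvPolynomial (Fin 3) ℂ →ₗ[ℂ] E) :=
  gradedKernel D k ⊓ LinearMap.ker (shift G)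

theorem shift_mem_lineKernel {D : Fin 3 → E →ₗ[ℂ] E} {G : MvPolynomial (Fin 3) ℂ} {k d : ℕ}
    {g : MvPolynomial (Fin 3) ℂ} (hg : g.IsHomogeneous d)
    {v : MvPolynomial (Fin 3) ℂ →ₗ[ℂ] E} (hv : v ∈ lineKernel D G (k + d)) :
    shift g v ∈ lineKernel D G k := by
  refine ⟨shift_mem_gradedKernel hg hv.1, ?_⟩
  have h : shift G v = 0 := hv.2
  change shift G (shift g v) = 0
  rw [shift_comm, h, map_zero]

variable {D : Fin 3 → E →ₗ[ℂ] E} {G H : MvPolynomial (Fin 3) ℂ}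

/-- By induction on the degree H v = 0, and separation then kills every X_l v. Thus a functional on
the line G = 0 is determined by one value in E, which bounds `lineKernel` by dim E. -/
theorem IsSeparating.eq_zero_of_pow (hGH : IsSeparating D G H) (hH : H.IsHomogeneous 1) {k : ℕ}
    {v : MvPolynomial (Fin 3) ℂ →ₗ[ℂ] E} (hv : v ∈ lineKernel D G k) (h : v (H ^ k) = 0) :
    v = 0 := by
  induction k generalizing v with
  | zero => exact gradedPart_zero_eq_zero hv.1.1 (by simpa using h)
  | succ k ih =>
    have h1 : shift H v = 0 := ih (shift_mem_lineKernel hH hv) (by rwa [shift_apply, ← pow_succ'])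
    exact gradedPart_eq_zero_of_shift_X hv.1.1 (hGH v hv.1.2 hv.2 h1)

/-- Multiplication by a form, on the spaces `gradedKernel`. -/
def gradedShift (D : Fin 3 → E →ₗ[ℂ] E) {G : MvPolynomial (Fin 3) ℂ} (hG : G.IsHomogeneous 1)
    (k : ℕ) : gradedKernel D (k + 1) →ₗ[ℂ] gradedKernel D k :=
  (shift G).restrict fun _ hv => shift_mem_gradedKernel hG hv

theorem finrank_ker_gradedShift (hG : G.IsHomogeneous 1) (k : ℕ) :
    Module.finrank ℂ (LinearMap.ker (gradedShift D hG k)) =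
      Module.finrank ℂ (lineKernel D G (k + 1)) := by
  refine LinearEquiv.finrank_eq
    { toFun := fun v => ⟨v.1.1, v.1.2, Subtype.ext_iff.1 v.2⟩
      map_add' := fun _ _ => rfl
      map_smul' := fun _ _ => rfl
      invFun := fun v => ⟨⟨v.1, v.2.1⟩, Subtype.ext v.2.2⟩
      left_inv := fun _ => rfl
      right_inv := fun _ => rfl }

/-- The linear form `x₂ - δ x₁ - u x₀`. -/
def lineForm (δ u : ℂ) : MvPolynomial (Fin 3) ℂ := X 2 - C δ * X 1 - C u * X 0

theorem isHomogeneous_lineForm (δ u : ℂ) : (lineForm δ u).IsHomogeneous 1 :=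
  ((isHomogeneous_X ℂ 2).sub ((isHomogeneous_X ℂ 1).C_mul δ)).sub ((isHomogeneous_X ℂ 0).C_mul u)

theorem eval_lineForm (δ u : ℂ) (x : Fin 3 → ℂ) :
    eval x (lineForm δ u) = x 2 - δ * x 1 - u * x 0 := by
  simp [lineForm]

theorem apply_X_two_mul (δ u : ℂ) (v : MvPolynomial (Fin 3) ℂ →ₗ[ℂ] E)
    (f : MvPolynomial (Fin 3) ℂ) :
    v (X 2 * f) = v (lineForm δ u * f) + δ • v (X 1 * f) + u • v (X 0 * f) := by
  rw [← map_smul, ← map_smul, ← map_add, ← map_add, lineForm, smul_eq_C_mul, smul_eq_C_mul]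
  congr 1
  ring

theorem pencil_lineForm {δ u : ℂ} {v : MvPolynomial (Fin 3) ℂ →ₗ[ℂ] E} (hv : v ∈ pencilKernel D)
    (h : shift (lineForm δ u) v = 0) (f : MvPolynomial (Fin 3) ℂ) :
    (D 1 + δ • D 2) (v (X 1 * f)) = -(D 0 + u • D 2) (v (X 0 * f)) := by
  have h1 := hv f
  have h2 : v (lineForm δ u * f) = 0 := LinearMap.congr_fun h f
  rw [Fin.sum_univ_three, apply_X_two_mul δ u, h2, zero_add, map_add, map_smul, map_smul] at h1
  rw [eq_neg_iff_add_eq_zero, ← h1]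
  simp only [LinearMap.add_apply, LinearMap.smul_apply]
  abel

/-- The forms L and x₀ meet at (0, 1, δ). If both kill v, the pencil relation reduces to (D₁ + δD₂)
v(x₁f) = 0. -/
theorem isSeparating_lineForm {δ : ℂ} (hδ : Function.Injective (D 1 + δ • D 2)) (u : ℂ) :
    IsSeparating D (lineForm δ u) (X 0) := by
  intro v hv h1 h0
  have h00 : ∀ f, v (X 0 * f) = 0 := fun f => LinearMap.congr_fun h0 f
  have h11 : ∀ f, v (X 1 * f) = 0 := fun f => hδ (by
    rw [pencil_lineForm hv h1, h00, map_zero, map_zero, neg_zero])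
  intro l
  refine LinearMap.ext fun f => ?_
  fin_cases l
  · exact h00 f
  · exact h11 f
  · refine (apply_X_two_mul δ u v f).trans ?_
    rw [h00, h11, ← shift_apply, h1]
    simp

/-- The line `x₂ = δ x₁ + u x₀` meets the line at infinity outside of the curve `det D = 0`, and
meets the curve outside of `Q = 0`. -/
structure TransversalLine (D : Fin 3 → E →ₗ[ℂ] E) (Q : MvPolynomial (Fin 3) ℂ) (δ u : ℂ) :
    Prop where
  injective : Function.Injective (D 1 + δ • D 2)
  disjoint : ∀ s : ℂ, eval ![1, s, u + δ * s] Q = 0 →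
    Function.Injective (D 0 + u • D 2 + s • (D 1 + δ • D 2))

/-- Restriction of a polynomial to the affine line `(1, s, u + δ s)`. -/
def restrictLine (δ u : ℂ) : MvPolynomial (Fin 3) ℂ →ₐ[ℂ] Polynomial ℂ :=
  aeval ![1, Polynomial.X, Polynomial.C u + Polynomial.C δ * Polynomial.X]

theorem eval_restrictLine (δ u s : ℂ) (f : MvPolynomial (Fin 3) ℂ) :
    (restrictLine δ u f).eval s = eval ![1, s, u + δ * s] f := by
  rw [← Polynomial.coe_aeval_eq_eval, ← coe_aeval_eq_eval, restrictLine]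
  have h : (Polynomial.aeval s).comp (aeval ![1, Polynomial.X,
      Polynomial.C u + Polynomial.C δ * Polynomial.X]) =
      (aeval ![1, s, u + δ * s] : MvPolynomial (Fin 3) ℂ →ₐ[ℂ] ℂ) := by
    refine algHom_ext fun i => ?_
    fin_cases i <;> simp
  exact DFunLike.congr_fun h f

/-- On the line L = 0 the coordinate x₁/x₀ acts on the values of v through Z, so a form acts through
its restriction to the line, evaluated at Z. -/
theorem apply_eq_aeval {δ u : ℂ} {v : MvPolynomial (Fin 3) ℂ →ₗ[ℂ] E}
    (hL : shift (lineForm δ u) v = 0) {Z : Module.End ℂ E}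
    (hZ : ∀ h, v (X 1 * h) = Z (v (X 0 * h))) {n : ℕ} {f : MvPolynomial (Fin 3) ℂ}
    (hf : f.IsHomogeneous n) (h : MvPolynomial (Fin 3) ℂ) :
    v (f * h) = Polynomial.aeval Z (restrictLine δ u f) (v (X 0 ^ n * h)) := by
  let S : ℕ → Submodule ℂ (MvPolynomial (Fin 3) ℂ) := fun n =>
    { carrier := {f | ∀ h, v (f * h) =
        Polynomial.aeval Z (restrictLine δ u f) (v (X 0 ^ n * h))}
      zero_mem' := fun h => by simp
      add_mem' := fun {f g} hf hg h => by simp only [add_mul, map_add, hf h, hg h,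
        LinearMap.add_apply]
      smul_mem' := fun c f hf h => by simp only [smul_mul_assoc, map_smul, hf h,
        LinearMap.smul_apply] }
  refine isHomogeneous_induction S (fun h => ?_) (fun n l f hf h => ?_) hf h
  · simp
  · have key : ∀ g, v (X l * g) = Polynomial.aeval Z (restrictLine δ u (X l)) (v (X 0 * g)) := by
      intro g
      have h2 : v (lineForm δ u * g) = 0 := LinearMap.congr_fun hL g
      rw [restrictLine, aeval_X]
      fin_cases l
      · simp
      · simpa using hZ g
      · refine (apply_X_two_mul δ u v g).trans ?_
        rw [h2, hZ]
        simp [add_comm]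
    rw [mul_assoc, mul_left_comm, hf, mul_left_comm, key, map_mul (restrictLine δ u),
      mul_comm (restrictLine δ u (X l)), map_mul (Polynomial.aeval Z), Module.End.mul_apply,
      ← mul_assoc, ← pow_succ']

theorem TransversalLine.isSeparating {Q : MvPolynomial (Fin 3) ℂ} {δ u : ℂ}
    (hT : TransversalLine D Q δ u) : IsSeparating D (lineForm δ u) (X 0) :=
  isSeparating_lineForm hT.injective u

variable [FiniteDimensional ℂ E]

instance finiteDimensional_lineKernel (k : ℕ) : FiniteDimensional ℂ (lineKernel D G k) :=
  Submodule.finiteDimensional_of_le (inf_le_left : _ ≤ gradedKernel D k)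

theorem IsSeparating.finrank_lineKernel_le (hGH : IsSeparating D G H) (hH : H.IsHomogeneous 1)
    (k : ℕ) : Module.finrank ℂ (lineKernel D G k) ≤ Module.finrank ℂ E := by
  let ψ : lineKernel D G k →ₗ[ℂ] E := LinearMap.applyₗ (H ^ k) ∘ₗ (lineKernel D G k).subtype
  refine LinearMap.finrank_le_finrank_of_injective (f := ψ) ?_
  rw [injective_iff_map_eq_zero]
  exact fun v hv => Subtype.ext (hGH.eq_zero_of_pow hH v.2 hv)

/-- The lower bound counts equations. For the upper bound, multiplication by G maps degree k + 1 to
degree k with kernel `lineKernel`, of dimension at most dim E. Equality then forces this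
multiplication to be onto, which is what makes division by G possible. -/
theorem IsSeparating.finrank_gradedKernel (hGH : IsSeparating D G H) (hG : G.IsHomogeneous 1)
    (hH : H.IsHomogeneous 1) (k : ℕ) :
    Module.finrank ℂ (gradedKernel D k) = (k + 1) * Module.finrank ℂ E := by
  refine le_antisymm ?_ (le_finrank_gradedKernel k)
  induction k with
  | zero =>
    have h := Submodule.finrank_mono (inf_le_left : gradedKernel D 0 ≤ gradedPart E 0)
    rwa [finrank_gradedPart, card_multiIdx_zero] at h
  | succ k ih =>
    have h1 := LinearMap.finrank_range_add_finrank_ker (gradedShift D hG k)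
    have h2 := (LinearMap.range (gradedShift D hG k)).finrank_le
    rw [finrank_ker_gradedShift] at h1
    have h3 := hGH.finrank_lineKernel_le hH (k + 1)
    rw [add_mul (k + 1)]
    linarith

theorem IsSeparating.finrank_range_gradedShift (hGH : IsSeparating D G H)
    (hG : G.IsHomogeneous 1) (hH : H.IsHomogeneous 1) (k : ℕ) :
    Module.finrank ℂ (LinearMap.range (gradedShift D hG k)) =
      Module.finrank ℂ (gradedKernel D k) ∧
    Module.finrank ℂ (lineKernel D G (k + 1)) = Module.finrank ℂ E := by
  have h1 := LinearMap.finrank_range_add_finrank_ker (gradedShift D hG k)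
  have h2 := (LinearMap.range (gradedShift D hG k)).finrank_le
  rw [finrank_ker_gradedShift, hGH.finrank_gradedKernel hG hH, add_mul (k + 1)] at h1
  have h3 := hGH.finrank_lineKernel_le hH (k + 1)
  rw [hGH.finrank_gradedKernel hG hH] at h2 ⊢
  omega

theorem IsSeparating.finrank_lineKernel (hGH : IsSeparating D G H) (hG : G.IsHomogeneous 1)
    (hH : H.IsHomogeneous 1) (k : ℕ) :
    Module.finrank ℂ (lineKernel D G k) = Module.finrank ℂ E := by
  cases k with
  | succ k => exact (hGH.finrank_range_gradedShift hG hH k).2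
  | zero =>
    have : lineKernel D G 0 = gradedKernel D 0 :=
      inf_eq_left.2 fun v hv => gradedPart_shift_eq_zero hG zero_lt_one hv.1
    rw [this, hGH.finrank_gradedKernel hG hH, zero_add, one_mul]

/-- Division by a linear form. -/
theorem IsSeparating.exists_shift_eq (hGH : IsSeparating D G H) (hG : G.IsHomogeneous 1)
    (hH : H.IsHomogeneous 1) {k : ℕ} {w : MvPolynomial (Fin 3) ℂ →ₗ[ℂ] E}
    (hw : w ∈ gradedKernel D k) : ∃ v ∈ gradedKernel D (k + 1), shift G v = w := by
  have h := Submodule.eq_top_of_finrank_eq (hGH.finrank_range_gradedShift hG hH k).1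
  obtain ⟨v, hv⟩ := LinearMap.range_eq_top.1 h ⟨w, hw⟩
  exact ⟨v.1, v.2, Subtype.ext_iff.1 hv⟩

/-- Spectral mapping: 0 is an eigenvalue of q(Z) only if q vanishes at some eigenvalue of Z. -/
theorem injective_aeval_of_disjoint {Z : Module.End ℂ E} {q : Polynomial ℂ}
    (h : ∀ s e, Z e = s • e → q.eval s = 0 → e = 0) : Function.Injective (Polynomial.aeval Z q) := by
  rcases subsingleton_or_nontrivial E with hE | hE
  · exact Function.injective_of_subsingleton _
  by_contra hq
  have h0 : (0 : ℂ) ∈ spectrum ℂ (Polynomial.aeval Z q) := by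
    rw [spectrum.zero_mem_iff, Module.End.isUnit_iff]
    exact fun h => hq h.1
  have hne : (spectrum ℂ Z).Nonempty :=
    spectrum.nonempty_of_isAlgClosed_of_finiteDimensional ℂ Z
  rw [spectrum.map_polynomial_aeval_of_nonempty Z q hne] at h0
  obtain ⟨s, hs, hqs⟩ := h0
  obtain ⟨e, he⟩ := (Module.End.hasEigenvalue_iff_mem_spectrum.2 hs).exists_hasEigenvector
  exact he.2 (h s e he.apply_eq_smul hqs)

namespace TransversalLine

variable {Q : MvPolynomial (Fin 3) ℂ} {δ u : ℂ}

/-- With Z = -(D₁ + δD₂)⁻¹(D₀ + uD₂), multiplication by Q acts as the restriction of Q to the line,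
evaluated at Z. An eigenvector of Z for s is a kernel vector of the pencil at (1, s, u + δs), and
transversality forbids Q to vanish there. -/
theorem shift_injective (hT : TransversalLine D Q δ u) {n k : ℕ} (hQ : Q.IsHomogeneous n)
    {v : MvPolynomial (Fin 3) ℂ →ₗ[ℂ] E} (hv : v ∈ lineKernel D (lineForm δ u) (k + n))
    (h : shift Q v = 0) : v = 0 := by
  let e := LinearEquiv.ofInjectiveEndo (D 1 + δ • D 2) hT.injective
  let Z : Module.End ℂ E := -(e.symm.toLinearMap ∘ₗ (D 0 + u • D 2))
  have he : ∀ a, e a = (D 1 + δ • D 2) a := fun a => rfl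
  have hZ : ∀ a, (D 1 + δ • D 2) (Z a) = -(D 0 + u • D 2) a := fun a => by
    rw [← he]
    simp [Z]
  have hvZ : ∀ f, v (X 1 * f) = Z (v (X 0 * f)) := fun f => hT.injective (by
    rw [hZ, pencil_lineForm hv.1.2 hv.2])
  refine hT.isSeparating.eq_zero_of_pow (isHomogeneous_X ℂ 0) hv ?_
  have h1 : v (Q * X 0 ^ k) = 0 := LinearMap.congr_fun h (X 0 ^ k)
  rw [apply_eq_aeval hv.2 hvZ hQ, ← pow_add, add_comm] at h1
  refine injective_aeval_of_disjoint (Z := Z) (q := restrictLine δ u Q) (fun s a ha hs => ?_)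
    (h1.trans (map_zero _).symm)
  rw [eval_restrictLine] at hs
  refine hT.disjoint s hs ?_
  have h2 := hZ a
  rw [ha, map_smul] at h2
  rw [map_zero, LinearMap.add_apply, LinearMap.smul_apply, h2, add_neg_cancel]

/-- Multiplication by Q is injective between two spaces of the same dimension dim E, hence onto. -/
theorem exists_shift_eq (hT : TransversalLine D Q δ u) {n k : ℕ} (hQ : Q.IsHomogeneous n)
    {w : MvPolynomial (Fin 3) ℂ →ₗ[ℂ] E} (hw : w ∈ lineKernel D (lineForm δ u) k) :
    ∃ v ∈ lineKernel D (lineForm δ u) (k + n), shift Q v = w := by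
  let ψ : lineKernel D (lineForm δ u) (k + n) →ₗ[ℂ] lineKernel D (lineForm δ u) k :=
    (shift Q).restrict fun _ hv => shift_mem_lineKernel hQ hv
  have hψ : Function.Injective ψ := by
    rw [injective_iff_map_eq_zero]
    exact fun v hv => Subtype.ext (hT.shift_injective hQ v.2 (Subtype.ext_iff.1 hv))
  have hd : Module.finrank ℂ (lineKernel D (lineForm δ u) (k + n)) =
      Module.finrank ℂ (lineKernel D (lineForm δ u) k) := by
    rw [hT.isSeparating.finrank_lineKernel (isHomogeneous_lineForm δ u) (isHomogeneous_X ℂ 0),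
      hT.isSeparating.finrank_lineKernel (isHomogeneous_lineForm δ u) (isHomogeneous_X ℂ 0)]
  obtain ⟨v, hv⟩ := (LinearMap.injective_iff_surjective_of_finrank_eq_finrank hd).1 hψ ⟨w, hw⟩
  exact ⟨v.1, v.2, Subtype.ext_iff.1 hv⟩

/-- A functional on the affine curve annihilating `Q` is determined by its values on the forms of
degree `k = deg Q - 1`. -/
theorem eq_zero_of_degree (hT : TransversalLine D Q δ u) {k : ℕ} (hQ : Q.IsHomogeneous (k + 1))
    {v : MvPolynomial (Fin 3) ℂ →ₗ[ℂ] E} (hv : v ∈ pencilKernel D)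
    (hL : shift (lineForm δ u) v = v) (hvQ : shift Q v = 0)
    (h : ∀ f, f.IsHomogeneous k → v f = 0) : v = 0 := by
  have hpow : ∀ d f, v (lineForm δ u ^ d * f) = v f := by
    intro d f
    induction d with
    | zero => simp
    | succ d ih => rw [pow_succ', mul_assoc, ← shift_apply, hL, ih]
  -- As L v = v, multiplying the component of degree k + d + 1 by L gives that of degree k + d. If
  -- the latter is zero, the former lives on the line and is killed by Q. Its degree is at least deg
  -- Q = k + 1, so `shift_injective` applies; k is the least starting degree for which this works.
  have hhi : ∀ d, component (k + d) v = 0 := by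
    intro d
    induction d with
    | zero =>
      refine gradedPart_ext (component_mem k v) (zero_mem _) fun f hf => ?_
      rw [add_zero, component_apply_of_isHomogeneous v hf, h f hf, LinearMap.zero_apply]
    | succ d ih =>
      have e : k + (d + 1) = d + (k + 1) := by omega
      have h1 : shift (lineForm δ u) (component (k + (d + 1)) v) = 0 := by
        rw [← add_assoc, shift_component (isHomogeneous_lineForm δ u), hL, ih]
      rw [e] at h1 ⊢
      refine hT.shift_injective hQ ⟨component_mem_gradedKernel _ hv, h1⟩ ?_
      rw [shift_component hQ, hvQ]
      rfl
  refine LinearMap.ext fun f => ?_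
  rw [← sum_homogeneousComponent f, map_sum, LinearMap.zero_apply]
  refine Finset.sum_eq_zero fun d _ => ?_
  have hf := homogeneousComponent_isHomogeneous d f
  -- Below degree k, a power of L raises the degree to k without changing the value.
  rcases le_total d k with hdk | hdk
  · rw [← hpow (k - d)]
    refine h _ ?_
    have := ((isHomogeneous_lineForm δ u).pow (k - d)).mul hf
    rwa [one_mul, Nat.sub_add_cancel hdk] at this
  · obtain ⟨j, rfl⟩ := Nat.exists_eq_add_of_le hdk
    rw [← component_apply_of_isHomogeneous v hf, hhi j, LinearMap.zero_apply]

end TransversalLine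

end Lines

open scoped TensorProduct

/-! ### Polynomials in two sets of variables and the pairing -/

section Tensors

/-- Evaluation of a polynomial in two sets of variables. -/
def evalPair (x y : Fin 3 → ℂ) :
    MvPolynomial (Fin 3) ℂ ⊗[ℂ] MvPolynomial (Fin 3) ℂ →ₐ[ℂ] ℂ :=
  Algebra.TensorProduct.lift (aeval x) (aeval y) fun _ _ => Commute.all _ _

@[simp] theorem evalPair_tmul (x y : Fin 3 → ℂ) (f g : MvPolynomial (Fin 3) ℂ) :
    evalPair x y (f ⊗ₜ g) = eval x f * eval y g := by
  simp [evalPair]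

/-- Polynomial functions over an infinite field determine the polynomial, one set of variables at a
time. It turns the pointwise Bezout identity into an identity in the tensor product, where
functionals can be applied. -/
theorem eq_zero_of_evalPair {a : MvPolynomial (Fin 3) ℂ ⊗[ℂ] MvPolynomial (Fin 3) ℂ}
    (h : ∀ x y, evalPair x y a = 0) : a = 0 := by
  let e := algebraTensorAlgEquiv (σ := Fin 3) ℂ (MvPolynomial (Fin 3) ℂ)
  have key : ∀ (x y : Fin 3 → ℂ) (a : MvPolynomial (Fin 3) ℂ ⊗[ℂ] MvPolynomial (Fin 3) ℂ),
      eval y (MvPolynomial.map (eval x) (e a)) = evalPair x y a := by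
    intro x y a
    induction a with
    | zero => simp
    | add a b ha hb => simp only [map_add, ha, hb]
    | tmul f g =>
      simp only [e, algebraTensorAlgEquiv_tmul, evalPair_tmul, smul_eq_C_mul, map_mul, map_C,
        eval_C, MvPolynomial.map_map]
      congr 1
      have h1 : (eval x).comp (algebraMap ℂ (MvPolynomial (Fin 3) ℂ)) = RingHom.id ℂ := by
        ext r
        simp
      rw [h1, MvPolynomial.map_id]
  refine e.injective ?_
  rw [map_zero]
  ext1 d
  refine MvPolynomial.funext fun x => ?_
  have h1 : MvPolynomial.map (eval x) (e a) = 0 :=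
    MvPolynomial.funext fun y => by rw [key, h, map_zero]
  have h2 := congrArg (coeff d) h1
  rwa [coeff_map, coeff_zero] at h2

/-- The `l`-th coordinate of the cross product of the two sets of variables. -/
def minor (l : Fin 3) : MvPolynomial (Fin 3) ℂ ⊗[ℂ] MvPolynomial (Fin 3) ℂ :=
  X (l + 1) ⊗ₜ X (l + 2) - X (l + 2) ⊗ₜ X (l + 1)

end Tensors

section Pairing

variable {E : Type*} [AddCommGroup E] [Module ℂ E]

/-- The functional `f ⊗ g ↦ ω f (T (v g))`. -/
def pairing (T : E →ₗ[ℂ] E) (v : MvPolynomial (Fin 3) ℂ →ₗ[ℂ] E)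
    (ω : MvPolynomial (Fin 3) ℂ →ₗ[ℂ] Module.Dual ℂ E) :
    MvPolynomial (Fin 3) ℂ ⊗[ℂ] MvPolynomial (Fin 3) ℂ →ₗ[ℂ] ℂ :=
  TensorProduct.lift (LinearMap.compl₂ ω (T ∘ₗ v))

@[simp] theorem pairing_tmul (T : E →ₗ[ℂ] E) (v : MvPolynomial (Fin 3) ℂ →ₗ[ℂ] E)
    (ω : MvPolynomial (Fin 3) ℂ →ₗ[ℂ] Module.Dual ℂ E) (f g : MvPolynomial (Fin 3) ℂ) :
    pairing T v ω (f ⊗ₜ g) = ω f (T (v g)) := by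
  simp [pairing]

theorem pairing_shift (T : E →ₗ[ℂ] E) (v : MvPolynomial (Fin 3) ℂ →ₗ[ℂ] E)
    (ω : MvPolynomial (Fin 3) ℂ →ₗ[ℂ] Module.Dual ℂ E) (f g : MvPolynomial (Fin 3) ℂ)
    (a : MvPolynomial (Fin 3) ℂ ⊗[ℂ] MvPolynomial (Fin 3) ℂ) :
    pairing T (shift g v) (shift f ω) a = pairing T v ω (f ⊗ₜ g * a) := by
  induction a with
  | zero => simp
  | add a b ha hb => rw [mul_add, map_add, map_add, ha, hb]
  | tmul p q => simp

theorem pairing_add (T : E →ₗ[ℂ] E) (v w : MvPolynomial (Fin 3) ℂ →ₗ[ℂ] E)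
    (ω : MvPolynomial (Fin 3) ℂ →ₗ[ℂ] Module.Dual ℂ E) :
    pairing T (v + w) ω = pairing T v ω + pairing T w ω :=
  TensorProduct.ext' fun f g => by simp

theorem pairing_smul (T : E →ₗ[ℂ] E) (c : ℂ) (v : MvPolynomial (Fin 3) ℂ →ₗ[ℂ] E)
    (ω : MvPolynomial (Fin 3) ℂ →ₗ[ℂ] Module.Dual ℂ E) :
    pairing T (c • v) ω = c • pairing T v ω :=
  TensorProduct.ext' fun f g => by simp

theorem pairing_zero_right (T : E →ₗ[ℂ] E) (v : MvPolynomial (Fin 3) ℂ →ₗ[ℂ] E) :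
    pairing T v 0 = 0 :=
  TensorProduct.ext' fun f g => by simp

/-- The transposed pencil. -/
def dualPencil (D : Fin 3 → E →ₗ[ℂ] E) (l : Fin 3) : Module.Dual ℂ E →ₗ[ℂ] Module.Dual ℂ E :=
  (D l).dualMap

variable {D : Fin 3 → E →ₗ[ℂ] E} {v : MvPolynomial (Fin 3) ℂ →ₗ[ℂ] E}
  {ω : MvPolynomial (Fin 3) ℂ →ₗ[ℂ] Module.Dual ℂ E}

theorem sum_pairing_right (hv : v ∈ pencilKernel D)
    (a : MvPolynomial (Fin 3) ℂ ⊗[ℂ] MvPolynomial (Fin 3) ℂ) :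
    ∑ l, pairing (D l) v ω (1 ⊗ₜ X l * a) = 0 := by
  induction a with
  | zero => simp
  | add a b ha hb => simp only [mul_add, map_add, Finset.sum_add_distrib, ha, hb, add_zero]
  | tmul f g =>
    simp only [Algebra.TensorProduct.tmul_mul_tmul, pairing_tmul]
    rw [← map_sum, hv g, map_zero]

theorem sum_pairing_left (hω : ω ∈ pencilKernel (dualPencil D))
    (a : MvPolynomial (Fin 3) ℂ ⊗[ℂ] MvPolynomial (Fin 3) ℂ) :
    ∑ l, pairing (D l) v ω (X l ⊗ₜ 1 * a) = 0 := by
  induction a with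
  | zero => simp
  | add a b ha hb => simp only [mul_add, map_add, Finset.sum_add_distrib, ha, hb, add_zero]
  | tmul f g =>
    simp only [Algebra.TensorProduct.tmul_mul_tmul, pairing_tmul, one_mul]
    have := LinearMap.congr_fun (hω f) (v g)
    simpa [dualPencil] using this

/-- Multiply the relation in the first variables by y_{l+2}, that in the second variables by
x_{l+2}, and subtract: the term with D_{l+2} cancels. -/
theorem pairing_minor_succ (hv : v ∈ pencilKernel D) (hω : ω ∈ pencilKernel (dualPencil D))
    (l : Fin 3) (a : MvPolynomial (Fin 3) ℂ ⊗[ℂ] MvPolynomial (Fin 3) ℂ) :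
    pairing (D (l + 1)) v ω (minor l * a) = pairing (D l) v ω (minor (l + 1) * a) := by
  have h1 := sum_pairing_left (v := v) hω (1 ⊗ₜ X (l + 2) * a)
  have h2 := sum_pairing_right (ω := ω) hv (X (l + 2) ⊗ₜ 1 * a)
  simp only [← mul_assoc, Algebra.TensorProduct.tmul_mul_tmul, mul_one, one_mul] at h1 h2
  have hs : ∀ F : Fin 3 → ℂ, ∑ k, F k = F l + F (l + 1) + F (l + 2) := by
    intro F
    fin_cases l <;> simp [Fin.sum_univ_three] <;> ring
  rw [hs] at h1 h2
  have e1 : l + 1 + 1 = l + 2 := by fin_cases l <;> rfl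
  have e2 : l + 1 + 2 = l := by fin_cases l <;> rfl
  rw [minor, minor, e1, e2, sub_mul, sub_mul, map_sub, map_sub]
  linear_combination h1 - h2

/-- The vector of pairings with D₀, D₁, D₂ is annihilated by both x and y, so it is parallel to x ×
y: its cross product with the vector of minors is zero. -/
theorem pairing_minor (hv : v ∈ pencilKernel D) (hω : ω ∈ pencilKernel (dualPencil D))
    (k l : Fin 3) (a : MvPolynomial (Fin 3) ℂ ⊗[ℂ] MvPolynomial (Fin 3) ℂ) :
    pairing (D k) v ω (minor l * a) = pairing (D l) v ω (minor k * a) := by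
  have h := fun l => pairing_minor_succ hv hω l a
  have h0 := h 0
  have h1 := h 1
  have h2 := h 2
  fin_cases k <;> fin_cases l
  · rfl
  · exact h0.symm
  · exact h2
  · exact h0
  · rfl
  · exact h1.symm
  · exact h2.symm
  · exact h1
  · rfl

end Pairing

/-- Complex Bezout coefficients of two forms. -/
structure IsBezout {k : ℕ} (c : Fin 3 → MultiIdx k → MultiIdx k → ℂ)
    (P Q : MvPolynomial (Fin 3) ℂ) : Prop where
  left_isHomogeneous : P.IsHomogeneous (k + 1)
  right_isHomogeneous : Q.IsHomogeneous (k + 1)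
  identity : ∀ x y : Fin 3 → ℂ, eval x P * eval y Q - eval x Q * eval y P =
    ∑ l, ∑ i, ∑ j, c l i j *
      (mon x i.1 * (x (l + 1) * y (l + 2) - x (l + 2) * y (l + 1)) * mon y j.1)

/-! ### The Bezout form and its symmetry -/

section BezoutForm

variable {k : ℕ} {c : Fin 3 → MultiIdx k → MultiIdx k → ℂ} {P Q : MvPolynomial (Fin 3) ℂ}

/-- The bihomogeneous polynomial with coefficients `c i j`. -/
def bihom (c : MultiIdx k → MultiIdx k → ℂ) :
    MvPolynomial (Fin 3) ℂ ⊗[ℂ] MvPolynomial (Fin 3) ℂ :=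
  ∑ i, ∑ j, c i j • (i.monomial ⊗ₜ j.monomial)

theorem IsBezout.tensor_identity (hc : IsBezout c P Q) :
    P ⊗ₜ Q - Q ⊗ₜ P = ∑ l, minor l * bihom (c l) := by
  rw [← sub_eq_zero]
  refine eq_zero_of_evalPair fun x y => ?_
  simp only [map_sub, map_sum, map_mul, minor, bihom, map_smul, evalPair_tmul, eval_X,
    MultiIdx.eval_monomial, smul_eq_mul]
  rw [hc.identity, sub_eq_zero]
  refine Finset.sum_congr rfl fun l _ => ?_
  rw [Finset.mul_sum]
  refine Finset.sum_congr rfl fun i _ => ?_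
  rw [Finset.mul_sum]
  refine Finset.sum_congr rfl fun j _ => ?_
  ring

theorem IsBezout.swap (hc : IsBezout c P Q) : IsBezout (-c) Q P where
  left_isHomogeneous := hc.2
  right_isHomogeneous := hc.1
  identity x y := by
    simp only [Pi.neg_apply, neg_mul, Finset.sum_neg_distrib]
    rw [← hc.identity]
    ring

variable {E : Type*} [AddCommGroup E] [Module ℂ E] (D : Fin 3 → E →ₗ[ℂ] E)

/-- The bilinear form of the Bezout matrix. -/
def bezoutForm (c : Fin 3 → MultiIdx k → MultiIdx k → ℂ) (v : MvPolynomial (Fin 3) ℂ →ₗ[ℂ] E)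
    (ω : MvPolynomial (Fin 3) ℂ →ₗ[ℂ] Module.Dual ℂ E) : ℂ :=
  ∑ l, pairing (D l) v ω (bihom (c l))

theorem bezoutForm_eq (c : Fin 3 → MultiIdx k → MultiIdx k → ℂ)
    (v : MvPolynomial (Fin 3) ℂ →ₗ[ℂ] E) (ω : MvPolynomial (Fin 3) ℂ →ₗ[ℂ] Module.Dual ℂ E) :
    bezoutForm D c v ω = ∑ l, ∑ i, ∑ j, c l i j * ω i.monomial (D l (v j.monomial)) := by
  simp [bezoutForm, bihom]

theorem bezoutForm_neg (c : Fin 3 → MultiIdx k → MultiIdx k → ℂ)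
    (v : MvPolynomial (Fin 3) ℂ →ₗ[ℂ] E) (ω : MvPolynomial (Fin 3) ℂ →ₗ[ℂ] Module.Dual ℂ E) :
    bezoutForm D (-c) v ω = -bezoutForm D c v ω := by
  simp [bezoutForm_eq, Finset.sum_neg_distrib]

/-- The right kernel of the Bezout form, on functionals of degree `k`. -/
def bezoutKernel (c : Fin 3 → MultiIdx k → MultiIdx k → ℂ) :
    Submodule ℂ (MvPolynomial (Fin 3) ℂ →ₗ[ℂ] E) where
  carrier := {v | ∀ ω ∈ gradedKernel (dualPencil D) k, bezoutForm D c v ω = 0}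
  zero_mem' := fun ω _ => by simp [bezoutForm_eq]
  add_mem' := fun {v w} hv hw ω hω => by
    have h1 := hv ω hω
    have h2 := hw ω hω
    simp only [bezoutForm, pairing_add, LinearMap.add_apply, Finset.sum_add_distrib] at h1 h2 ⊢
    rw [h1, h2, add_zero]
  smul_mem' := fun t v hv ω hω => by
    have h1 := hv ω hω
    simp only [bezoutForm, pairing_smul, LinearMap.smul_apply, ← Finset.smul_sum] at h1 ⊢
    rw [h1, smul_zero]

/-- `bezoutForm` with multiplications by forms in both sets of variables. -/
def shiftedForm (c : Fin 3 → MultiIdx k → MultiIdx k → ℂ) (v : MvPolynomial (Fin 3) ℂ →ₗ[ℂ] E)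
    (ω : MvPolynomial (Fin 3) ℂ →ₗ[ℂ] Module.Dual ℂ E) :
    MvPolynomial (Fin 3) ℂ ⊗[ℂ] MvPolynomial (Fin 3) ℂ →ₗ[ℂ] ℂ :=
  ∑ l, pairing (D l) v ω ∘ₗ LinearMap.mulRight ℂ (bihom (c l))

variable {D}

theorem shiftedForm_tmul (c : Fin 3 → MultiIdx k → MultiIdx k → ℂ)
    (v : MvPolynomial (Fin 3) ℂ →ₗ[ℂ] E) (ω : MvPolynomial (Fin 3) ℂ →ₗ[ℂ] Module.Dual ℂ E)
    (f g : MvPolynomial (Fin 3) ℂ) :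
    shiftedForm D c v ω (f ⊗ₜ g) = bezoutForm D c (shift g v) (shift f ω) := by
  simp [shiftedForm, bezoutForm, pairing_shift]

variable {v : MvPolynomial (Fin 3) ℂ →ₗ[ℂ] E}
  {ω : MvPolynomial (Fin 3) ℂ →ₗ[ℂ] Module.Dual ℂ E}

/-- By `pairing_minor` the index of the minor and that of the coefficient can be interchanged; the
minors then recombine with the c_j to P ⊗ Q - Q ⊗ P. -/
theorem IsBezout.shiftedForm_minor (hc : IsBezout c P Q) (hv : v ∈ pencilKernel D)
    (hω : ω ∈ pencilKernel (dualPencil D)) (l : Fin 3) :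
    shiftedForm D c v ω (minor l) = ω P (D l (v Q)) - ω Q (D l (v P)) := by
  have h : shiftedForm D c v ω (minor l) = ∑ j, pairing (D j) v ω (minor l * bihom (c j)) := by
    simp [shiftedForm]
  rw [h, Finset.sum_congr rfl fun j _ => pairing_minor hv hω j l (bihom (c j)), ← map_sum,
    ← hc.tensor_identity, map_sub, pairing_tmul, pairing_tmul]

/-- When v P = v Q = 0 the form annihilates all minors, so variables acting on the two arguments may
be exchanged. The lifting of kernel elements rests on this. -/
theorem IsBezout.shiftedForm_symm (hc : IsBezout c P Q) (hv : v ∈ pencilKernel D)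
    (hω : ω ∈ pencilKernel (dualPencil D)) (hP : v P = 0) (hQ : v Q = 0) (a b : Fin 3) :
    shiftedForm D c v ω (X a ⊗ₜ X b) = shiftedForm D c v ω (X b ⊗ₜ X a) := by
  have h : ∀ l, shiftedForm D c v ω (X (l + 1) ⊗ₜ X (l + 2)) =
      shiftedForm D c v ω (X (l + 2) ⊗ₜ X (l + 1)) := by
    intro l
    have h1 := hc.shiftedForm_minor hv hω l
    rw [hP, hQ, map_zero, map_zero, map_zero, sub_zero, minor, map_sub, sub_eq_zero] at h1
    exact h1
  have h0 := h 0
  have h1 := h 1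
  have h2 := h 2
  fin_cases a <;> fin_cases b
  · rfl
  · exact h2
  · exact h1.symm
  · exact h2.symm
  · rfl
  · exact h0
  · exact h1
  · exact h0.symm
  · rfl

theorem IsBezout.shiftedForm_symm_lineForm (hc : IsBezout c P Q) (hv : v ∈ pencilKernel D)
    (hω : ω ∈ pencilKernel (dualPencil D)) (hP : v P = 0) (hQ : v Q = 0) (δ u : ℂ) (a : Fin 3) :
    bezoutForm D c (shift (lineForm δ u) v) (shift (X a) ω) =
      bezoutForm D c (shift (X a) v) (shift (lineForm δ u) ω) := by
  have h := hc.shiftedForm_symm hv hω hP hQ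
  rw [← shiftedForm_tmul, ← shiftedForm_tmul, lineForm, ← smul_eq_C_mul, ← smul_eq_C_mul]
  simp only [TensorProduct.sub_tmul, TensorProduct.tmul_sub, TensorProduct.tmul_smul, map_sub,
    ← TensorProduct.smul_tmul', map_smul, h a]

/-- The exchange of L and x₀ without assuming that v kills P and Q; the defect on the right is what
later forces v Q = 0. -/
theorem IsBezout.bezoutForm_lineForm (hc : IsBezout c P Q) (hv : v ∈ pencilKernel D)
    (hω : ω ∈ pencilKernel (dualPencil D)) (δ u : ℂ) :
    bezoutForm D c (shift (X 0) v) (shift (lineForm δ u) ω) -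
      bezoutForm D c (shift (lineForm δ u) v) (shift (X 0) ω) =
    ω P ((D 1 + δ • D 2) (v Q)) - ω Q ((D 1 + δ • D 2) (v P)) := by
  have h1 := hc.shiftedForm_minor hv hω 1
  have h2 := hc.shiftedForm_minor hv hω 2
  have e1 : minor 1 = X 2 ⊗ₜ X 0 - X 0 ⊗ₜ X 2 := rfl
  have e2 : minor 2 = X 0 ⊗ₜ X 1 - X 1 ⊗ₜ X 0 := rfl
  rw [e1, map_sub] at h1
  rw [e2, map_sub] at h2
  rw [← shiftedForm_tmul, ← shiftedForm_tmul, lineForm, ← smul_eq_C_mul, ← smul_eq_C_mul]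
  simp only [TensorProduct.sub_tmul, TensorProduct.tmul_sub, TensorProduct.tmul_smul, map_sub,
    ← TensorProduct.smul_tmul', map_smul, LinearMap.add_apply, LinearMap.smul_apply, map_add,
    smul_eq_mul]
  linear_combination h1 + δ * h2

end BezoutForm

section PointFunctionals

variable {E : Type*} [AddCommGroup E] [Module ℂ E]

/-- The functional `f ↦ f(x) e`. -/
def pointFunctional (x : Fin 3 → ℂ) (e : E) : MvPolynomial (Fin 3) ℂ →ₗ[ℂ] E :=
  (aeval x : MvPolynomial (Fin 3) ℂ →ₐ[ℂ] ℂ).toLinearMap.smulRight e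

@[simp] theorem pointFunctional_apply (x : Fin 3 → ℂ) (e : E) (f : MvPolynomial (Fin 3) ℂ) :
    pointFunctional x e f = eval x f • e := by
  simp [pointFunctional]

theorem shift_pointFunctional (x : Fin 3 → ℂ) (e : E) (g : MvPolynomial (Fin 3) ℂ) :
    shift g (pointFunctional x e) = eval x g • pointFunctional x e :=
  LinearMap.ext fun f => by simp [mul_smul]

theorem pointFunctional_mem {D : Fin 3 → E →ₗ[ℂ] E} {x : Fin 3 → ℂ} {e : E}
    (h : ∑ l, x l • D l e = 0) : pointFunctional x e ∈ pencilKernel D := by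
  intro f
  simp only [pointFunctional_apply, map_mul, eval_X, map_smul]
  rw [← smul_zero (eval x f), ← h, Finset.smul_sum]
  exact Finset.sum_congr rfl fun l _ => by rw [smul_smul, mul_comm]

theorem pointFunctional_zero_mem (D : Fin 3 → E →ₗ[ℂ] E) (e : E) :
    pointFunctional 0 e ∈ gradedKernel D 0 := by
  refine ⟨fun f d hf hd => ?_, pointFunctional_mem (by simp)⟩
  have : eval 0 f = constantCoeff f := by simp
  rw [pointFunctional_apply, this, constantCoeff_eq, hf.coeff_eq_zero, zero_smul]
  simpa using hd.symm

end PointFunctionals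

/-! ### Elements of the Bezout kernel -/

section Lifting

variable {E : Type*} [AddCommGroup E] [Module ℂ E] [FiniteDimensional ℂ E]
  {D : Fin 3 → E →ₗ[ℂ] E} {k : ℕ} {c : Fin 3 → MultiIdx k → MultiIdx k → ℂ}
  {P Q : MvPolynomial (Fin 3) ℂ} {δ u : ℂ}

theorem injective_of_transpose {T : E →ₗ[ℂ] E} {T' : Module.Dual ℂ E →ₗ[ℂ] Module.Dual ℂ E}
    (h : Function.Injective T) (hT : ∀ φ e, T' φ e = φ (T e)) : Function.Injective T' := by
  have : T' = T.dualMap := LinearMap.ext fun φ => LinearMap.ext fun e => hT φ e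
  rw [this]
  exact LinearMap.dualMap_injective_of_surjective (LinearMap.injective_iff_surjective.1 h)

theorem TransversalLine.dual (hT : TransversalLine D P δ u) :
    TransversalLine (dualPencil D) P δ u where
  injective := injective_of_transpose hT.injective fun φ e => by simp [dualPencil]
  disjoint s hs := injective_of_transpose (hT.disjoint s hs) fun φ e => by simp [dualPencil]

/-- Take a linear form L vanishing at x and divide, ω = L ω'. Exchanging L with x_a moves L onto the
point functional, where it acts as L(x) = 0. -/
theorem IsBezout.pointFunctional_mem_bezoutKernel (hc : IsBezout c P Q)
    (hδ : Function.Injective (D 1 + δ • D 2)) {x : Fin 3 → ℂ} (hx : x ≠ 0) {e : E}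
    (he : ∑ l, x l • D l e = 0) (hP : eval x P = 0) (hQ : eval x Q = 0) :
    pointFunctional x e ∈ bezoutKernel D c := by
  intro ω hω
  have hv := pointFunctional_mem he
  have h1 : pointFunctional x e P = 0 := by simp [hP]
  have h2 : pointFunctional x e Q = 0 := by simp [hQ]
  have hsep := fun u => isSeparating_lineForm (D := dualPencil D)
    (δ := δ) (injective_of_transpose hδ fun φ e => by simp [dualPencil]) u
  suffices h : ∀ a, x a * bezoutForm D c (pointFunctional x e) ω = 0 by
    obtain ⟨a, ha⟩ := Function.ne_iff.1 hx
    exact (mul_eq_zero.1 (h a)).resolve_left ha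
  have hmul : ∀ (a : Fin 3) (ω : MvPolynomial (Fin 3) ℂ →ₗ[ℂ] Module.Dual ℂ E),
      bezoutForm D c (shift (X a) (pointFunctional x e)) ω =
        x a * bezoutForm D c (pointFunctional x e) ω := by
    intro a ω
    simp [shift_pointFunctional, bezoutForm, pairing_smul, Finset.mul_sum]
  have hzero : ∀ ω : MvPolynomial (Fin 3) ℂ →ₗ[ℂ] Module.Dual ℂ E, bezoutForm D c 0 ω = 0 :=
    fun ω => by simp [bezoutForm_eq]
  intro a
  -- The linear form vanishing at x is x₀ itself if x is at infinity; otherwise u' is chosen so that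
  -- the line passes through x and (0, 1, δ).
  by_cases h0 : x 0 = 0
  · obtain ⟨ω', hω', rfl⟩ := (hsep 0).symm.exists_shift_eq (isHomogeneous_X ℂ 0)
      (isHomogeneous_lineForm δ 0) hω
    rw [← hmul, ← shiftedForm_tmul, hc.shiftedForm_symm hv hω'.2 h1 h2, shiftedForm_tmul,
      shift_pointFunctional, eval_X, h0, zero_smul, hzero]
  · let u' := (x 2 - δ * x 1) / x 0
    obtain ⟨ω', hω', rfl⟩ := (hsep u').exists_shift_eq (isHomogeneous_lineForm δ u')
      (isHomogeneous_X ℂ 0) hω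
    rw [← hmul, ← hc.shiftedForm_symm_lineForm hv hω'.2 h1 h2, shift_pointFunctional,
      eval_lineForm]
    have : x 2 - δ * x 1 - u' * x 0 = 0 := by
      simp only [u']
      field_simp
      ring
    rw [this, zero_smul, hzero]

/-- The value z Q is detected by test functionals ω supported on the line L = 0 with ω P arbitrary,
for which all other terms of `bezoutForm_lineForm` vanish. Once z Q = 0, dividing a general ω by L
and exchanging L with X_l reduces to the hypothesis on L z. -/
theorem IsBezout.shift_mem_bezoutKernel (hc : IsBezout c P Q) (hT : TransversalLine D P δ u)
    {z : MvPolynomial (Fin 3) ℂ →ₗ[ℂ] E} (hz : z ∈ gradedKernel D (k + 1)) (hP : z P = 0)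
    (hL : shift (lineForm δ u) z ∈ bezoutKernel D c) :
    z Q = 0 ∧ ∀ l, shift (X l) z ∈ bezoutKernel D c := by
  have hQ : z Q = 0 := by
    refine hT.injective (Eq.trans ?_ (map_zero _).symm)
    refine (Module.forall_dual_apply_eq_zero_iff ℂ _).1 fun φ => ?_
    -- Dividing the degree zero functional f ↦ f(0) φ by P within the line gives ω with L ω = 0 and
    -- ω P = φ.
    obtain ⟨ω, hω, hω'⟩ := hT.dual.exists_shift_eq (k := 0) hc.left_isHomogeneous
      (w := pointFunctional 0 φ) ⟨pointFunctional_zero_mem _ φ,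
        gradedPart_shift_eq_zero (isHomogeneous_lineForm δ u) zero_lt_one
          (pointFunctional_zero_mem (dualPencil D) φ).1⟩
    rw [zero_add] at hω
    have h1 := hc.bezoutForm_lineForm hz.2 hω.1.2 δ u
    have h2 : shift (lineForm δ u) ω = 0 := hω.2
    have h3 := hL _ (shift_mem_gradedKernel (isHomogeneous_X ℂ 0) hω.1)
    have h4 : ω P = φ := by
      have := LinearMap.congr_fun hω' 1
      simpa using this
    have h5 : bezoutForm D c (shift (X 0) z) 0 = 0 := by simp [bezoutForm, pairing_zero_right]
    rw [h2, h3, h5, h4, hP, map_zero, map_zero, sub_zero, sub_zero] at h1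
    exact h1.symm
  refine ⟨hQ, fun l ω hω => ?_⟩
  obtain ⟨ω', hω', rfl⟩ := hT.dual.isSeparating.exists_shift_eq (isHomogeneous_lineForm δ u)
    (isHomogeneous_X ℂ 0) hω
  rw [← hc.shiftedForm_symm_lineForm hz.2 hω'.2 hP hQ]
  exact hL _ (shift_mem_gradedKernel (isHomogeneous_X ℂ l) hω')

end Lifting

theorem linearMap_ext_isHomogeneous {E : Type*} [AddCommGroup E] [Module ℂ E]
    {v w : MvPolynomial (Fin 3) ℂ →ₗ[ℂ] E} (h : ∀ d f, f.IsHomogeneous d → v f = w f) : v = w := by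
  refine LinearMap.ext fun f => ?_
  rw [← sum_homogeneousComponent f, map_sum, map_sum]
  exact Finset.sum_congr rfl fun d _ => h d _ (homogeneousComponent_isHomogeneous d f)

theorem exists_tower {α : Type*} {I : ℕ → α → Prop} {r : α → α → Prop} {v : α} (h0 : I 0 v)
    (hstep : ∀ d v, I d v → ∃ w, I (d + 1) w ∧ r w v) :
    ∃ s : ℕ → α, s 0 = v ∧ ∀ d, I d (s d) ∧ r (s (d + 1)) (s d) := by
  choose! next hnext using hstep
  let s : ∀ d, {v // I d v} := fun d =>
    Nat.rec ⟨v, h0⟩ (fun d v => ⟨next d v.1, (hnext d v.1 v.2).1⟩) d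
  exact ⟨fun d => (s d).1, rfl, fun d => ⟨(s d).2, (hnext d (s d).1 (s d).2).2⟩⟩

/-- The functional given by `s d` on the multiples by `g` of forms of degree `d`. -/
def glue {E : Type*} [AddCommGroup E] [Module ℂ E] (s : ℕ → MvPolynomial (Fin 3) ℂ →ₗ[ℂ] E)
    (g : MvPolynomial (Fin 3) ℂ) : MvPolynomial (Fin 3) ℂ →ₗ[ℂ] E :=
  (basisMonomials (Fin 3) ℂ).constr ℂ fun i => s i.degree (g * monomial i 1)

theorem glue_apply {E : Type*} [AddCommGroup E] [Module ℂ E]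
    (s : ℕ → MvPolynomial (Fin 3) ℂ →ₗ[ℂ] E) (g : MvPolynomial (Fin 3) ℂ) (d : ℕ)
    (f : MvPolynomial (Fin 3) ℂ) (hf : f.IsHomogeneous d) : glue s g f = s d (g * f) := by
  rw [eq_sum_monomial hf, map_sum, Finset.mul_sum, map_sum]
  refine Finset.sum_congr rfl fun i _ => ?_
  rw [map_smul, mul_smul_comm, map_smul]
  congr 1
  have h := (basisMonomials (Fin 3) ℂ).constr_basis ℂ
    (fun i => s i.degree (g * monomial i 1)) i.toFinsupp
  rw [coe_basisMonomials, i.degree_toFinsupp] at h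
  exact h

/-! ### Extension of kernel elements to the affine curve -/

section Extension

variable {E : Type*} [AddCommGroup E] [Module ℂ E]

/-- The functionals on the affine chart `x₂ - δ x₁ - u x₀ = 1` of the curve which annihilate the
multiples of `P` and `Q`. -/
def affineKernel (D : Fin 3 → E →ₗ[ℂ] E) (δ u : ℂ) (P Q : MvPolynomial (Fin 3) ℂ) :
    Submodule ℂ (MvPolynomial (Fin 3) ℂ →ₗ[ℂ] E) :=
  pencilKernel D ⊓ LinearMap.ker (shift (lineForm δ u) - LinearMap.id) ⊓
    LinearMap.ker (shift P) ⊓ LinearMap.ker (shift Q)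

theorem mem_affineKernel {D : Fin 3 → E →ₗ[ℂ] E} {δ u : ℂ} {P Q : MvPolynomial (Fin 3) ℂ}
    {v : MvPolynomial (Fin 3) ℂ →ₗ[ℂ] E} : v ∈ affineKernel D δ u P Q ↔
      v ∈ pencilKernel D ∧ shift (lineForm δ u) v = v ∧ shift P v = 0 ∧ shift Q v = 0 := by
  simp [affineKernel, sub_eq_zero, and_assoc]

theorem shift_mem_affineKernel {D : Fin 3 → E →ₗ[ℂ] E} {δ u : ℂ} {P Q : MvPolynomial (Fin 3) ℂ}
    {v : MvPolynomial (Fin 3) ℂ →ₗ[ℂ] E} (hv : v ∈ affineKernel D δ u P Q)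
    (g : MvPolynomial (Fin 3) ℂ) : shift g v ∈ affineKernel D δ u P Q := by
  rw [mem_affineKernel] at hv ⊢
  obtain ⟨h1, h2, h3, h4⟩ := hv
  exact ⟨shift_mem_pencilKernel D g h1, by rw [shift_comm, h2], by rw [shift_comm, h3, map_zero],
    by rw [shift_comm, h4, map_zero]⟩

variable [FiniteDimensional ℂ E]
  {D : Fin 3 → E →ₗ[ℂ] E} {k : ℕ} {c : Fin 3 → MultiIdx k → MultiIdx k → ℂ}
  {P Q : MvPolynomial (Fin 3) ℂ} {δ u : ℂ}

/-- One step of the extension of a functional in the kernel of the Bezout form to forms of higher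
degree. -/
theorem IsBezout.exists_lift (hc : IsBezout c P Q) (hT : TransversalLine D P δ u) {d : ℕ}
    {v : MvPolynomial (Fin 3) ℂ →ₗ[ℂ] E} (hv : v ∈ gradedKernel D (k + d)) (hP : shift P v = 0)
    (hK : ∀ f, f.IsHomogeneous d → shift f v ∈ bezoutKernel D c) :
    ∃ w ∈ gradedKernel D (k + (d + 1)), shift (lineForm δ u) w = v ∧ shift P w = 0 ∧
      shift Q w = 0 ∧ ∀ f, f.IsHomogeneous (d + 1) → shift f w ∈ bezoutKernel D c := by
  obtain ⟨w₀, hw₀, hLw₀⟩ := hT.isSeparating.exists_shift_eq (isHomogeneous_lineForm δ u)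
    (isHomogeneous_X ℂ 0) hv
  have e : k + d + 1 = d + (k + 1) := by omega
  have hPw₀ : shift P w₀ ∈ lineKernel D (lineForm δ u) d := by
    refine ⟨shift_mem_gradedKernel hc.left_isHomogeneous (e ▸ hw₀), ?_⟩
    change shift _ (shift _ _) = 0
    rw [shift_comm, hLw₀, hP]
  obtain ⟨κ, hκ, hPκ⟩ := hT.exists_shift_eq hc.left_isHomogeneous hPw₀
  have hLκ : shift (lineForm δ u) κ = 0 := hκ.2
  have hw : w₀ - κ ∈ gradedKernel D (k + (d + 1)) := sub_mem hw₀ (e.symm ▸ hκ.1)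
  have hLw : shift (lineForm δ u) (w₀ - κ) = v := by rw [map_sub, hLw₀, hLκ, sub_zero]
  have hPw : shift P (w₀ - κ) = 0 := by rw [map_sub, hPκ, sub_self]
  have e2 : k + (d + 1) = k + 1 + d := by omega
  -- For w = w₀ - κ the functional g w has degree k + 1, kills P, and L (g w) = g v is in the Bezout
  -- kernel.
  have key : ∀ g, g.IsHomogeneous d → (w₀ - κ) (g * Q) = 0 ∧
      ∀ l, shift (X l * g) (w₀ - κ) ∈ bezoutKernel D c := by
    intro g hg
    have := hc.shift_mem_bezoutKernel hT (z := shift g (w₀ - κ))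
      (shift_mem_gradedKernel hg (e2 ▸ hw))
      (by rw [shift_apply, mul_comm]; exact LinearMap.congr_fun hPw g)
      (by rw [shift_comm, hLw]; exact hK g hg)
    refine ⟨this.1, fun l => ?_⟩
    rw [shift_mul]
    exact this.2 l
  refine ⟨w₀ - κ, hw, hLw, hPw, ?_, fun f hf => ?_⟩
  · refine gradedPart_ext (k := d) (shift_mem_gradedPart hc.right_isHomogeneous ?_) (zero_mem _)
      fun g hg => ?_
    · rw [show d + (k + 1) = k + (d + 1) by omega]
      exact hw.1
    · rw [shift_apply, mul_comm, (key g hg).1, LinearMap.zero_apply]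
  · have hsum : shift f (w₀ - κ) = ∑ i : MultiIdx (d + 1), coeff i.toFinsupp f •
        shift i.monomial (w₀ - κ) := by
      refine LinearMap.ext fun g => ?_
      rw [shift_apply, LinearMap.sum_apply]
      conv_lhs => rw [eq_sum_monomial hf, Finset.sum_mul, map_sum]
      exact Finset.sum_congr rfl fun i _ => by rw [smul_mul_assoc, map_smul]; rfl
    rw [hsum]
    refine Submodule.sum_mem _ fun i _ => Submodule.smul_mem _ _ ?_
    obtain ⟨s, j, hi⟩ := i.exists_monomial_eq
    rw [hi]
    exact (key _ j.isHomogeneous_monomial).2 s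

/-- A functional in the kernel of the Bezout form extends to the affine curve. -/
theorem IsBezout.exists_extension (hc : IsBezout c P Q) (hT : TransversalLine D P δ u)
    {v : MvPolynomial (Fin 3) ℂ →ₗ[ℂ] E} (hv : v ∈ gradedKernel D k)
    (hK : v ∈ bezoutKernel D c) :
    ∃ w ∈ affineKernel D δ u P Q, ∀ f, f.IsHomogeneous k → w f = v f := by
  let I : ℕ → (MvPolynomial (Fin 3) ℂ →ₗ[ℂ] E) → Prop := fun d v =>
    v ∈ gradedKernel D (k + d) ∧ shift P v = 0 ∧ shift Q v = 0 ∧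
      ∀ f, f.IsHomogeneous d → shift f v ∈ bezoutKernel D c
  have h0 : I 0 v := by
    refine ⟨hv, gradedPart_shift_eq_zero hc.left_isHomogeneous (Nat.lt_succ_self k) hv.1,
      gradedPart_shift_eq_zero hc.right_isHomogeneous (Nat.lt_succ_self k) hv.1, fun f hf => ?_⟩
    have : shift f v = coeff 0 f • v := by
      refine LinearMap.ext fun g => ?_
      rw [shift_apply, totalDegree_eq_zero_iff_eq_C.1 (Nat.le_zero.1 hf.totalDegree_le),
        ← smul_eq_C_mul, map_smul]
      simp
    rw [this]
    exact Submodule.smul_mem _ _ hK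
  have hstep : ∀ d v, I d v → ∃ w, I (d + 1) w ∧ shift (lineForm δ u) w = v := by
    rintro d v ⟨h1, h2, -, h3⟩
    obtain ⟨w, hw, hL, hP, hQ, hK⟩ := hc.exists_lift hT h1 h2 h3
    exact ⟨w, ⟨hw, hP, hQ, hK⟩, hL⟩
  obtain ⟨s, hs00, hs⟩ := exists_tower (r := fun w v => shift (lineForm δ u) w = v) h0 hstep
  have hs0 : ∀ d, shift (lineForm δ u ^ d) (s d) = v := by
    intro d
    induction d with
    | zero =>
      refine LinearMap.ext fun f => ?_
      rw [shift_apply, pow_zero, one_mul, hs00]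
    | succ d ih => rw [pow_succ, shift_mul, (hs d).2, ih]
  -- In the tower, s d has degree k + d and L s (d + 1) = s d. In the chart L = 1 a form f of degree
  -- d has the same value as L ^ k * f, which is in the degree that s d sees.
  obtain ⟨w, hw⟩ : ∃ w : MvPolynomial (Fin 3) ℂ →ₗ[ℂ] E, ∀ d f, f.IsHomogeneous d →
      w f = s d (lineForm δ u ^ k * f) := ⟨_, glue_apply s (lineForm δ u ^ k)⟩
  refine ⟨w, mem_affineKernel.2 ⟨fun f => ?_, ?_, ?_, ?_⟩, fun f hf => ?_⟩
  · have h : (∑ l, LinearMap.compRight ℂ (D l) ∘ₗ shift (X l)) w = 0 := by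
      refine linearMap_ext_isHomogeneous fun d f hf => ?_
      have h2 := (hs (d + 1)).1.1.2 (lineForm δ u ^ k * f)
      rw [LinearMap.sum_apply, LinearMap.sum_apply, LinearMap.zero_apply, ← h2]
      refine Finset.sum_congr rfl fun l _ => ?_
      have h3 := (isHomogeneous_X ℂ l).mul hf
      rw [add_comm] at h3
      change D l (w (X l * f)) = _
      rw [hw _ _ h3, mul_left_comm]
    have h2 := LinearMap.congr_fun h f
    rw [LinearMap.sum_apply, LinearMap.sum_apply] at h2
    exact h2
  · refine linearMap_ext_isHomogeneous fun d f hf => ?_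
    have h3 := (isHomogeneous_lineForm δ u).mul hf
    rw [add_comm] at h3
    rw [shift_apply, hw _ _ h3, hw _ _ hf, mul_left_comm, ← shift_apply, (hs d).2]
  · refine linearMap_ext_isHomogeneous fun d f hf => ?_
    rw [shift_apply, hw _ _ (hc.left_isHomogeneous.mul hf), mul_left_comm, ← shift_apply,
      (hs _).1.2.1]
    rfl
  · refine linearMap_ext_isHomogeneous fun d f hf => ?_
    rw [shift_apply, hw _ _ (hc.right_isHomogeneous.mul hf), mul_left_comm, ← shift_apply,
      (hs _).1.2.2.1]
    rfl
  · rw [hw _ _ hf, ← shift_apply, hs0]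

end Extension

/-! ### Point functionals as joint eigenvectors -/

section Eigenvectors

variable {E : Type*} [AddCommGroup E] [Module ℂ E]
  {D : Fin 3 → E →ₗ[ℂ] E} {P Q : MvPolynomial (Fin 3) ℂ} {δ u : ℂ}

theorem pointFunctional_zero (x : Fin 3 → ℂ) : pointFunctional x (0 : E) = 0 :=
  LinearMap.ext fun f => by simp

theorem eq_pointFunctional {v : MvPolynomial (Fin 3) ℂ →ₗ[ℂ] E} {x : Fin 3 → ℂ}
    (h : ∀ l, shift (X l) v = x l • v) : v = pointFunctional x (v 1) := by
  refine LinearMap.ext fun f => ?_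
  have hl : ∀ l f, v (X l * f) = x l • v f := fun l f => LinearMap.congr_fun (h l) f
  induction f using MvPolynomial.induction_on with
  | C a => rw [pointFunctional_apply, eval_C, ← map_smul, C_eq_smul_one]
  | add p q hp hq => rw [map_add, map_add, hp, hq]
  | mul_X p i hp =>
    rw [mul_comm, hl, hp, pointFunctional_apply, pointFunctional_apply, map_mul, eval_X, mul_smul]

theorem pointFunctional_mem_affineKernel_iff {x : Fin 3 → ℂ} {e : E} :
    pointFunctional x e ∈ affineKernel D δ u P Q ↔ e = 0 ∨
      (∑ l, x l • D l e = 0 ∧ eval x (lineForm δ u) = 1 ∧ eval x P = 0 ∧ eval x Q = 0) := by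
  rw [mem_affineKernel]
  simp only [shift_pointFunctional]
  have hp : pointFunctional x e = 0 ↔ e = 0 := by
    refine ⟨fun h => by simpa using LinearMap.congr_fun h 1, ?_⟩
    rintro rfl
    exact LinearMap.ext fun f => by simp
  have h1 : pointFunctional x e ∈ pencilKernel D ↔ ∑ l, x l • D l e = 0 := by
    refine ⟨fun h => ?_, pointFunctional_mem⟩
    simpa using h 1
  have h2 : eval x (lineForm δ u) • pointFunctional x e = pointFunctional x e ↔
      e = 0 ∨ eval x (lineForm δ u) = 1 := by
    have : eval x (lineForm δ u) • pointFunctional x e = pointFunctional x e ↔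
        (eval x (lineForm δ u) - 1) • pointFunctional x e = 0 := by
      rw [sub_smul, one_smul, sub_eq_zero]
    rw [this, smul_eq_zero, hp, sub_eq_zero, or_comm]
  rw [h1, h2, smul_eq_zero, smul_eq_zero, hp]
  constructor
  · tauto
  · rintro (rfl | h)
    · simp
    · tauto

/-- The functionals with a tangent vector at `x`. -/
theorem apply_of_second_order {v : MvPolynomial (Fin 3) ℂ →ₗ[ℂ] E} {x : Fin 3 → ℂ}
    {e : Fin 3 → E} (h : ∀ l, shift (X l) v = x l • v + pointFunctional x (e l))
    (f : MvPolynomial (Fin 3) ℂ) :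
    v f = eval x f • v 1 + ∑ l, eval x (pderiv l f) • e l := by
  have hl : ∀ l f, v (X l * f) = x l • v f + eval x f • e l := fun l f => by
    have := LinearMap.congr_fun (h l) f
    simpa using this
  induction f using MvPolynomial.induction_on with
  | C a =>
    simp only [pderiv_C, map_zero, zero_smul, Finset.sum_const_zero, add_zero, eval_C]
    rw [C_eq_smul_one, map_smul]
  | add p q hp hq =>
    rw [map_add, hp, hq]
    simp only [map_add, add_smul, Finset.sum_add_distrib]
    abel
  | mul_X p i hp =>
    rw [mul_comm, hl, hp]
    simp only [pderiv_mul, pderiv_X, map_add, map_mul, eval_X, add_smul, smul_add, mul_smul,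
      Finset.sum_add_distrib, Finset.smul_sum]
    have : ∑ l, eval x (Pi.single (M := fun _ => MvPolynomial (Fin 3) ℂ) l 1 i) • eval x p • e l
        = eval x p • e i := by
      rw [Finset.sum_eq_single i]
      · simp
      · intro l _ hl
        rw [Pi.single_eq_of_ne hl.symm]
        simp
      · simp
    rw [this]
    abel

variable (D P Q δ u) in
/-- The functionals at `x` on the curve `P = Q = 0` have no tangent component. -/
def HasNoTangent (x : Fin 3 → ℂ) : Prop :=
  ∀ (e : Fin 3 → E) (f : E), (∀ l, ∑ i, x i • D i (e l) = 0) →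
    (eval x (lineForm δ u) = 1) → eval x P = 0 → eval x Q = 0 →
    (∑ l, eval x (pderiv l (lineForm δ u)) • e l = 0) →
    (∑ l, D l (e l) + ∑ l, x l • D l f = 0) →
    (∑ l, eval x (pderiv l P) • e l = 0) → (∑ l, eval x (pderiv l Q) • e l = 0) → e = 0

/-- Each (X_l - x_l) v is a point functional with some vector e_l, so v is the first-order
functional f ↦ f(x) v(1) + ∑ ∂_l f(x) e_l. Evaluating the equations of the affine kernel at f = 1
yields the system in `HasNoTangent`, with v 1 in the role of its vector f. -/
theorem HasNoTangent.eq_zero {x : Fin 3 → ℂ} (hx : HasNoTangent D P Q δ u x)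
    {v : MvPolynomial (Fin 3) ℂ →ₗ[ℂ] E} (hv : v ∈ affineKernel D δ u P Q)
    (h : ∀ a b, shift (X a - C (x a)) (shift (X b - C (x b)) v) = 0) (l : Fin 3) :
    shift (X l - C (x l)) v = 0 := by
  have hsub : ∀ (a : Fin 3) (w : MvPolynomial (Fin 3) ℂ →ₗ[ℂ] E),
      shift (X a - C (x a)) w = shift (X a) w - x a • w := by
    intro a w
    refine LinearMap.ext fun f => ?_
    simp [sub_mul, ← smul_eq_C_mul]
  set e : Fin 3 → E := fun l => shift (X l - C (x l)) v 1 with he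
  have hw : ∀ l, shift (X l - C (x l)) v = pointFunctional x (e l) := by
    intro l
    refine eq_pointFunctional fun a => ?_
    rw [← sub_eq_zero, ← hsub, h]
  by_contra hne
  have hel : e l ≠ 0 := by
    intro h0
    rw [hw, h0] at hne
    exact hne (LinearMap.ext fun f => by simp)
  have hmem : ∀ l, pointFunctional x (e l) ∈ affineKernel D δ u P Q := fun l =>
    hw l ▸ shift_mem_affineKernel hv _
  have hx0 := (pointFunctional_mem_affineKernel_iff.1 (hmem l)).resolve_left hel
  have hX : ∀ l, shift (X l) v = x l • v + pointFunctional x (e l) := by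
    intro l
    rw [← hw, hsub]
    abel
  have hform := apply_of_second_order hX
  obtain ⟨h1, h2, h3, h4⟩ := mem_affineKernel.1 hv
  refine hel (congrFun (hx e (v 1) (fun l => ?_) hx0.2.1 hx0.2.2.1 hx0.2.2.2 ?_ ?_ ?_ ?_) l)
  · rcases pointFunctional_mem_affineKernel_iff.1 (hmem l) with h0 | h0
    · simp [h0]
    · exact h0.1
  · have h5 := LinearMap.congr_fun h2 1
    rw [shift_apply, mul_one, hform, hx0.2.1, one_smul] at h5
    simpa using h5
  · have h5 := h1 1
    have h6 : ∀ l, D l (v (X l * 1)) = x l • D l (v 1) + D l (e l) := by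
      intro l
      have := LinearMap.congr_fun (hX l) 1
      rw [shift_apply] at this
      rw [this]
      simp
    simp only [h6, Finset.sum_add_distrib] at h5
    rw [add_comm]
    exact h5
  · have h5 := LinearMap.congr_fun h3 1
    rw [shift_apply, mul_one, hform, hx0.2.2.1, zero_smul, zero_add] at h5
    exact h5
  · have h5 := LinearMap.congr_fun h4 1
    rw [shift_apply, mul_one, hform, hx0.2.2.2, zero_smul, zero_add] at h5
    exact h5

/-- The functionals killed by all products of `r` of the polynomials `X l - x l`. -/
def nilpotentPart (E : Type*) [AddCommGroup E] [Module ℂ E] (x : Fin 3 → ℂ) :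
    ℕ → (MvPolynomial (Fin 3) ℂ →ₗ[ℂ] E) → Prop
  | 0, v => v = 0
  | r + 1, v => ∀ l, nilpotentPart E x r (shift (X l - C (x l)) v)

theorem nilpotentPart_zero (x : Fin 3 → ℂ) (r : ℕ) : nilpotentPart E x r 0 := by
  induction r with
  | zero => rfl
  | succ r ih =>
    intro l
    rwa [map_zero]

/-- Every factor X_l - x_l lowers one exponent, and an exponent that has reached 0 says that the
functional is zero; hence the sum of the exponents bounds the common order. -/
theorem nilpotentPart_of_pow (x : Fin 3 → ℂ) : ∀ (a : Fin 3 → ℕ)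
    (v : MvPolynomial (Fin 3) ℂ →ₗ[ℂ] E), (∀ l, shift ((X l - C (x l)) ^ a l) v = 0) →
    nilpotentPart E x (a 0 + a 1 + a 2) v := by
  intro a
  generalize hr : a 0 + a 1 + a 2 = r
  induction r generalizing a with
  | zero =>
    intro v h
    have h0 := h 0
    rw [show a 0 = 0 by omega, pow_zero] at h0
    refine LinearMap.ext fun f => ?_
    simpa using LinearMap.congr_fun h0 f
  | succ r ih =>
    intro v h l
    by_cases hl : a l = 0
    · have h0 := h l
      rw [hl, pow_zero] at h0
      have : v = 0 := LinearMap.ext fun f => by simpa using LinearMap.congr_fun h0 f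
      rw [this, map_zero]
      exact nilpotentPart_zero x r
    · refine ih (Function.update a l (a l - 1)) ?_ _ fun m => ?_
      · fin_cases l <;> simp [Function.update] at hl ⊢ <;> omega
      · by_cases hm : m = l
        · subst hm
          rw [Function.update_self, ← shift_mul, ← pow_succ, Nat.sub_add_cancel (by omega)]
          exact h m
        · rw [Function.update_of_ne hm, shift_comm, h m, map_zero]

/-- A functional of higher order would have a first-order one among its multiples by products of X_l
- x_l. So the order drops to one, where v is a joint eigenvector. -/
theorem HasNoTangent.eq_pointFunctional {x : Fin 3 → ℂ} (hx : HasNoTangent D P Q δ u x) {r : ℕ}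
    {v : MvPolynomial (Fin 3) ℂ →ₗ[ℂ] E} (hv : v ∈ affineKernel D δ u P Q)
    (h : nilpotentPart E x r v) : v = pointFunctional x (v 1) := by
  have hdown : ∀ (r : ℕ) (v : MvPolynomial (Fin 3) ℂ →ₗ[ℂ] E), v ∈ affineKernel D δ u P Q →
      nilpotentPart E x (r + 2) v → nilpotentPart E x (r + 1) v := by
    intro r
    induction r with
    | zero => exact fun v hv h l => hx.eq_zero hv (fun a b => h b a) l
    | succ r ih => exact fun v hv h l => ih _ (shift_mem_affineKernel hv _) (h l)
  have h1 : nilpotentPart E x 1 v := by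
    rcases r with _ | r
    · rw [show v = 0 from h]
      exact nilpotentPart_zero x 1
    · induction r with
      | zero => exact h
      | succ r ih => exact ih (hdown r v hv h)
  refine CommVessel.eq_pointFunctional fun l => ?_
  refine LinearMap.ext fun f => ?_
  have h2 : shift (X l - C (x l)) v f = 0 := by rw [show shift (X l - C (x l)) v = 0 from h1 l]; rfl
  rw [shift_apply, sub_mul, map_sub, ← smul_eq_C_mul, map_smul, sub_eq_zero] at h2
  exact h2

variable [FiniteDimensional ℂ E]

theorem TransversalLine.finiteDimensional_affineKernel (hT : TransversalLine D P δ u) {k : ℕ}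
    (hP : P.IsHomogeneous (k + 1)) : FiniteDimensional ℂ (affineKernel D δ u P Q) := by
  let ψ : affineKernel D δ u P Q →ₗ[ℂ] MultiIdx k → E :=
    LinearMap.pi fun i => LinearMap.applyₗ i.monomial ∘ₗ (affineKernel D δ u P Q).subtype
  refine FiniteDimensional.of_injective ψ ?_
  rw [injective_iff_map_eq_zero]
  intro v hv
  obtain ⟨h1, h2, h3, -⟩ := mem_affineKernel.1 v.2
  refine Subtype.ext (hT.eq_zero_of_degree hP h1 h2 h3 fun f hf => ?_)
  rw [eq_sum_monomial hf, map_sum]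
  refine Finset.sum_eq_zero fun i _ => ?_
  have : v.1 i.monomial = 0 := congrFun hv i
  rw [map_smul, this, smul_zero]

/-- Without tangent components, the functionals on the affine curve annihilating `P` and `Q` are
combinations of point functionals. -/
theorem affineKernel_le_span (hT : TransversalLine D P δ u) {k : ℕ}
    (hP : P.IsHomogeneous (k + 1)) (hx : ∀ x, HasNoTangent D P Q δ u x) :
    affineKernel D δ u P Q ≤ Submodule.span ℂ {w | ∃ x e, w = pointFunctional x e ∧
      ∑ l, x l • D l e = 0 ∧ eval x (lineForm δ u) = 1 ∧ eval x P = 0 ∧ eval x Q = 0} := by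
  have := hT.finiteDimensional_affineKernel (Q := Q) hP
  let A : Fin 3 → Module.End ℂ (affineKernel D δ u P Q) := fun l =>
    (shift (X l)).restrict fun v hv => shift_mem_affineKernel hv _
  have hcomm : Pairwise fun i j => Commute (A i) (A j) := fun i j _ => by
    refine LinearMap.ext fun v => Subtype.ext ?_
    exact shift_comm _ _ _
  -- The three commuting multiplications decompose the finite-dimensional space into joint
  -- generalized eigenspaces, indexed by points χ.
  have htop := Module.End.iSup_iInf_maxGenEigenspace_eq_top_of_iSup_maxGenEigenspace_eq_top_of_commute
    A hcomm fun l => Module.End.iSup_maxGenEigenspace_eq_top (A l)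
  have hpow : ∀ (l : Fin 3) (t : ℂ) (n : ℕ) (v : affineKernel D δ u P Q),
      (((A l - algebraMap ℂ _ t) ^ n) v).1 = shift ((X l - C t) ^ n) v.1 := by
    intro l t n
    induction n with
    | zero =>
      intro v
      exact LinearMap.ext fun f => by simp
    | succ n ih =>
      intro v
      rw [pow_succ, Module.End.mul_apply, ih, pow_succ, shift_mul]
      congr 1
      refine LinearMap.ext fun f => ?_
      rw [shift_apply, sub_mul, map_sub, ← smul_eq_C_mul, map_smul]
      rfl
  intro v hv
  have hmem : (⟨v, hv⟩ : affineKernel D δ u P Q) ∈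
      ⨆ χ : Fin 3 → ℂ, ⨅ i, (A i).maxGenEigenspace (χ i) := by rw [htop]; trivial
  refine Submodule.iSup_induction _ (motive := fun w : affineKernel D δ u P Q => w.1 ∈ _) hmem
    (fun χ w hw => ?_) (zero_mem _) fun a b ha hb => add_mem ha hb
  have h1 : ∀ l, ∃ n, shift ((X l - C (χ l)) ^ n) w.1 = 0 := by
    intro l
    obtain ⟨n, hn⟩ := (Module.End.mem_maxGenEigenspace (A l) (χ l) w).1
      ((Submodule.mem_iInf _).1 hw l)
    refine ⟨n, ?_⟩
    rw [← hpow, Algebra.algebraMap_eq_smul_one, hn]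
    rfl
  choose a ha using h1
  have h2 := (hx χ).eq_pointFunctional w.2 (nilpotentPart_of_pow χ a w.1 ha)
  have h3 := w.2
  rw [h2] at h3
  rcases pointFunctional_mem_affineKernel_iff.1 h3 with h0 | h0
  · rw [h2, h0, pointFunctional_zero]
    exact zero_mem _
  · exact Submodule.subset_span ⟨χ, _, h2, h0⟩

end Eigenvectors

/-! ### Homogenization and dehomogenization -/

section Homogeneous

theorem aeval_eq_eval_apply {σ : Type*} (x : σ → ℂ) (f : MvPolynomial σ ℂ) :
    aeval x f = eval x f :=
  DFunLike.congr_fun (coe_aeval_eq_eval x) f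

theorem IsHomogeneous.aeval_smul {A : Type*} [CommRing A] [Algebra ℂ A] {n : ℕ}
    {f : MvPolynomial (Fin 3) ℂ} (hf : f.IsHomogeneous n) (t : A) (x : Fin 3 → A) :
    aeval (fun i => t * x i) f = t ^ n * aeval x f := by
  let S : ℕ → Submodule ℂ (MvPolynomial (Fin 3) ℂ) := fun n =>
    { carrier := {f | aeval (fun i => t * x i) f = t ^ n * aeval x f}
      zero_mem' := by simp
      add_mem' := fun {f g} hf hg => by
        simp only [Set.mem_ofPred_eq] at hf hg ⊢
        rw [map_add, map_add, hf, hg, mul_add]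
      smul_mem' := fun c f hf => by
        simp only [Set.mem_ofPred_eq] at hf ⊢
        rw [map_smul, map_smul, hf, mul_smul_comm] }
  refine isHomogeneous_induction S (by simp [S]) (fun n l f hf => ?_) hf
  change aeval _ f = _ at hf
  change aeval _ (X l * f) = _
  rw [map_mul, map_mul, hf, aeval_X, aeval_X]
  ring

/-- Restriction of a form to the affine plane `x₀ = 1`. -/
def dehomogenize : MvPolynomial (Fin 3) ℂ →ₐ[ℂ] MvPolynomial (Fin 2) ℂ :=
  aeval ![1, X 0, X 1]

theorem eval_dehomogenize (f : MvPolynomial (Fin 3) ℂ) (y : Fin 2 → ℂ) :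
    eval y (dehomogenize f) = eval ![1, y 0, y 1] f := by
  rw [← aeval_eq_eval_apply, ← aeval_eq_eval_apply]
  have h : (aeval y).comp dehomogenize =
      (aeval ![1, y 0, y 1] : MvPolynomial (Fin 3) ℂ →ₐ[ℂ] ℂ) := by
    refine algHom_ext fun i => ?_
    fin_cases i <;> simp [dehomogenize]
  exact DFunLike.congr_fun h f

theorem IsHomogeneous.eval_eq {n : ℕ} {f : MvPolynomial (Fin 3) ℂ} (hf : f.IsHomogeneous n)
    {x : Fin 3 → ℂ} (hx : x 0 ≠ 0) :
    eval x f = x 0 ^ n * eval ![x 1 / x 0, x 2 / x 0] (dehomogenize f) := by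
  have h := IsHomogeneous.aeval_smul hf (x 0) ![1, x 1 / x 0, x 2 / x 0]
  rw [aeval_eq_eval_apply, aeval_eq_eval_apply] at h
  rw [eval_dehomogenize]
  have e : (fun i => x 0 * ![1, x 1 / x 0, x 2 / x 0] i) = x := by
    ext i
    fin_cases i
    · simp
    · simp [mul_div_cancel₀ _ hx]
    · simp [mul_div_cancel₀ _ hx]
  rw [e] at h
  exact h

theorem eq_of_dehomogenize_eq {n : ℕ} {f g : MvPolynomial (Fin 3) ℂ} (hf : f.IsHomogeneous n)
    (hg : g.IsHomogeneous n) (h : dehomogenize f = dehomogenize g) : f = g := by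
  -- The extra factor removes the line x₀ = 0, where dehomogenization gives no information.
  have h0 : X 0 * (f - g) = 0 := MvPolynomial.funext fun x => by
    rw [map_mul, eval_X, map_sub, map_zero]
    by_cases hx : x 0 = 0
    · rw [hx, zero_mul]
    · rw [IsHomogeneous.eval_eq hf hx, IsHomogeneous.eval_eq hg hx, h, sub_self, mul_zero]
  exact sub_eq_zero.1 ((mul_eq_zero.1 h0).resolve_left (X_ne_zero 0))

theorem totalDegree_dehomogenize_le {n : ℕ} {f : MvPolynomial (Fin 3) ℂ}
    (hf : f.IsHomogeneous n) : (dehomogenize f).totalDegree ≤ n := by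
  let S : ℕ → Submodule ℂ (MvPolynomial (Fin 3) ℂ) := fun n =>
    { carrier := {f | (dehomogenize f).totalDegree ≤ n}
      zero_mem' := by simp
      add_mem' := fun {f g} hf hg => by
        simp only [Set.mem_ofPred_eq] at hf hg ⊢
        rw [map_add]
        exact (totalDegree_add _ _).trans (max_le hf hg)
      smul_mem' := fun c f hf => by
        simp only [Set.mem_ofPred_eq] at hf ⊢
        rw [map_smul]
        exact (totalDegree_smul_le _ _).trans hf }
  refine isHomogeneous_induction S (by simp [S]) (fun n l f hf => ?_) hf
  change totalDegree _ ≤ _ at hf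
  change totalDegree (dehomogenize (X l * f)) ≤ _
  rw [map_mul, add_comm]
  refine (totalDegree_mul _ _).trans (add_le_add ?_ hf)
  rw [dehomogenize, aeval_X]
  fin_cases l <;> simp

/-- Homogenization of degree `n`. -/
def complexHomogenize (n : ℕ) (f : MvPolynomial (Fin 2) ℂ) : MvPolynomial (Fin 3) ℂ :=
  ∑ d ∈ f.support, C (f.coeff d) * (X 0 ^ (n - d 0 - d 1) * X 1 ^ d 0 * X 2 ^ d 1)

theorem isHomogeneous_complexHomogenize {n : ℕ} {f : MvPolynomial (Fin 2) ℂ}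
    (hf : f.totalDegree ≤ n) : (complexHomogenize n f).IsHomogeneous n := by
  refine IsHomogeneous.sum _ _ _ fun d hd => ?_
  have h1 : d 0 + d 1 ≤ n := by
    have h2 : (d.sum fun _ e => e) ≤ f.totalDegree := le_totalDegree hd
    rw [Finsupp.sum_fintype _ _ (by simp), Fin.sum_univ_two] at h2
    exact h2.trans hf
  have h3 := (((isHomogeneous_X_pow (R := ℂ) (0 : Fin 3) (n - d 0 - d 1)).mul
    (isHomogeneous_X_pow (1 : Fin 3) (d 0))).mul (isHomogeneous_X_pow (2 : Fin 3) (d 1)))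
  have h4 := (isHomogeneous_C (Fin 3) (f.coeff d)).mul h3
  convert h4 using 1
  omega

theorem dehomogenize_complexHomogenize (n : ℕ) (f : MvPolynomial (Fin 2) ℂ) :
    dehomogenize (complexHomogenize n f) = f := by
  conv_rhs => rw [f.as_sum]
  rw [complexHomogenize, map_sum]
  refine Finset.sum_congr rfl fun d _ => ?_
  rw [monomial_eq, Finsupp.prod_fintype _ _ (by simp), Fin.prod_univ_two]
  simp [dehomogenize]

/-- The degree condition on f says that the line at infinity is not a component of f = 0; the affine
quotient then has degree at most n - m and homogenizes correctly. -/
theorem dvd_of_dehomogenize_dvd {m n : ℕ} {f g : MvPolynomial (Fin 3) ℂ}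
    (hf : f.IsHomogeneous m) (hfm : (dehomogenize f).totalDegree = m) (hg : g.IsHomogeneous n)
    (h : dehomogenize f ∣ dehomogenize g) : f ∣ g := by
  obtain ⟨q, hq⟩ := h
  by_cases h0 : dehomogenize g = 0
  · rw [eq_of_dehomogenize_eq hg (isHomogeneous_zero _ _ n) (by rw [h0, map_zero])]
    exact dvd_zero f
  · have hd := totalDegree_dehomogenize_le hg
    have h1 : dehomogenize f ≠ 0 := fun h => h0 (by rw [hq, h, zero_mul])
    have h2 : q ≠ 0 := fun h => h0 (by rw [hq, h, mul_zero])
    rw [hq, totalDegree_mul_of_isDomain h1 h2, hfm] at hd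
    refine ⟨complexHomogenize (n - m) q, eq_of_dehomogenize_eq hg ?_ ?_⟩
    · have h3 := hf.mul (isHomogeneous_complexHomogenize (n := n - m) (f := q) (by omega))
      rwa [Nat.add_sub_cancel' (by omega)] at h3
    · rw [map_mul, dehomogenize_complexHomogenize, hq]

theorem coeff_aeval_scale {σ A : Type*} [CommRing A] [Algebra ℂ A] (v : σ → A)
    (f : MvPolynomial σ ℂ) (j : ℕ) :
    (aeval (fun i => Polynomial.X * Polynomial.C (v i)) f).coeff j =
      aeval v (homogeneousComponent j f) := by
  induction f using MvPolynomial.induction_on' with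
  | monomial d a =>
    rw [aeval_monomial, Polynomial.algebraMap_apply]
    have h : (d.prod fun i k => (Polynomial.X * Polynomial.C (v i)) ^ k) =
        Polynomial.X ^ d.degree * Polynomial.C (d.prod fun i k => v i ^ k) := by
      simp only [Finsupp.prod, mul_pow, Finset.prod_mul_distrib, Finset.prod_pow_eq_pow_sum,
        map_prod, map_pow, Finsupp.degree_apply]
    rw [h, mul_left_comm, ← Polynomial.C_mul, mul_comm (Polynomial.X ^ _),
      Polynomial.coeff_C_mul_X_pow]
    by_cases hj : j = d.degree
    · rw [if_pos hj, homogeneousComponent_of_mem (isHomogeneous_monomial a rfl), if_pos hj,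
        aeval_monomial]
    · rw [if_neg hj, homogeneousComponent_of_mem (isHomogeneous_monomial a rfl), if_neg hj,
        map_zero]
  | add p q hp hq => rw [map_add, Polynomial.coeff_add, hp, hq, map_add, map_add]

theorem homogeneousComponent_totalDegree_ne_zero {σ : Type*} {f : MvPolynomial σ ℂ} (hf : f ≠ 0) :
    homogeneousComponent f.totalDegree f ≠ 0 := by
  obtain ⟨d, hd, h⟩ := Finset.exists_mem_eq_sup f.support (support_nonempty.2 hf)
    (fun s => s.sum fun _ e => e)
  intro h0
  have h1 := congrArg (coeff d) h0
  rw [coeff_homogeneousComponent, if_pos, coeff_zero] at h1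
  · exact mem_support_iff.1 hd h1
  · rw [totalDegree, h, Finsupp.degree_apply]
    rfl

end Homogeneous

/-! ### The determinant of the pencil and transversal lines -/

section PencilDet

variable {m : ℕ}

/-- The determinant of the linear matrix pencil `∑ X l • M l`. -/
def pencilDet (M : Fin 3 → Matrix (Fin m) (Fin m) ℂ) : MvPolynomial (Fin 3) ℂ :=
  (∑ l, (X l : MvPolynomial (Fin 3) ℂ) • (M l).map (C : ℂ →+* MvPolynomial (Fin 3) ℂ)).det

variable (M : Fin 3 → Matrix (Fin m) (Fin m) ℂ)

theorem aeval_pencilDet {A : Type*} [CommRing A] [Algebra ℂ A] (x : Fin 3 → A) :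
    aeval x (pencilDet M) = (∑ l, x l • (M l).map (algebraMap ℂ A)).det := by
  rw [pencilDet, AlgHom.map_det]
  congr 1
  ext i j
  simp [Matrix.sum_apply]

theorem isHomogeneous_pencilDet : (pencilDet M).IsHomogeneous m := by
  rw [pencilDet, Matrix.det_apply]
  refine IsHomogeneous.sum _ _ _ fun σ _ => ?_
  have h : (∏ i, (∑ l, (X l : MvPolynomial (Fin 3) ℂ) • (M l).map (C : ℂ →+* MvPolynomial (Fin 3) ℂ)) (σ i) i).IsHomogeneous m := by
    have := IsHomogeneous.prod Finset.univ
      (fun i => (∑ l, (X l : MvPolynomial (Fin 3) ℂ) • (M l).map (C : ℂ →+* MvPolynomial (Fin 3) ℂ)) (σ i) i) (fun _ => 1) ?_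
    · simpa using this
    · intro i _
      rw [Matrix.sum_apply]
      refine IsHomogeneous.sum _ _ _ fun l _ => ?_
      exact (isHomogeneous_X ℂ l).mul (isHomogeneous_C _ _)
  rcases Int.units_eq_one_or (Equiv.Perm.sign σ) with hs | hs
  · rwa [hs, one_smul]
  · rw [hs, Units.neg_smul, one_smul]
    exact h.neg

/-- The part of degree m of the affine discriminant is det(y₁M₁ + y₂M₂). Full degree makes it
nonzero, so it cannot vanish in all directions (1, δ). -/
theorem exists_eval_pencilDet_ne_zero (hM : dehomogenize (pencilDet M) ≠ 0)
    (hdeg : (dehomogenize (pencilDet M)).totalDegree = m) :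
    ∃ δ : ℂ, eval ![0, 1, δ] (pencilDet M) ≠ 0 := by
  by_contra! h
  have key : ∀ y : Fin 2 → ℂ, eval y (homogeneousComponent m (dehomogenize (pencilDet M))) =
      eval ![0, y 0, y 1] (pencilDet M) := by
    intro y
    rw [← aeval_eq_eval_apply, ← coeff_aeval_scale, dehomogenize, ← AlgHom.comp_apply]
    have e : ((aeval fun i => Polynomial.X * Polynomial.C (y i)).comp
        (aeval ![1, X 0, X 1])) = (aeval ![1, Polynomial.X * Polynomial.C (y 0),
          Polynomial.X * Polynomial.C (y 1)] : MvPolynomial (Fin 3) ℂ →ₐ[ℂ] Polynomial ℂ) := by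
      refine algHom_ext fun i => ?_
      fin_cases i <;> simp
    rw [e, aeval_pencilDet, ← aeval_eq_eval_apply, aeval_pencilDet]
    have h2 := Polynomial.coeff_det_X_add_C_card (y 0 • M 1 + y 1 • M 2) (M 0)
    rw [Fintype.card_fin] at h2
    have e1 : ∑ l, (![1, Polynomial.X * Polynomial.C (y 0), Polynomial.X * Polynomial.C (y 1)] :
        Fin 3 → Polynomial ℂ) l • (M l).map (algebraMap ℂ (Polynomial ℂ)) =
        (Polynomial.X : Polynomial ℂ) • (y 0 • M 1 + y 1 • M 2).map Polynomial.C +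
          (M 0).map Polynomial.C := by
      refine Matrix.ext fun i j => ?_
      simp [Fin.sum_univ_three]
      ring
    have e2 : ∑ l, (![0, y 0, y 1] : Fin 3 → ℂ) l • (M l).map (algebraMap ℂ ℂ) =
        y 0 • M 1 + y 1 • M 2 := by
      refine Matrix.ext fun i j => ?_
      simp [Fin.sum_univ_three]
    rw [e1, e2, h2]
  refine homogeneousComponent_totalDegree_ne_zero hM ?_
  rw [hdeg]
  -- The factor X 0 disposes of the direction (0, 1), which no δ represents.
  have h0 : X 0 * homogeneousComponent m (dehomogenize (pencilDet M)) = 0 :=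
    MvPolynomial.funext fun y => by
      rw [map_mul, eval_X, key, map_zero]
      by_cases hy : y 0 = 0
      · rw [hy, zero_mul]
      · have h1 := IsHomogeneous.aeval_smul (isHomogeneous_pencilDet M) (y 0) ![0, 1, y 1 / y 0]
        have e : (fun i => y 0 * ![0, 1, y 1 / y 0] i) = ![0, y 0, y 1] := by
          ext i
          fin_cases i
          · simp
          · simp
          · simp [mul_div_cancel₀ _ hy]
        rw [e, aeval_eq_eval_apply, aeval_eq_eval_apply] at h1
        rw [h1, h, mul_zero, mul_zero]
  exact (mul_eq_zero.1 h0).resolve_left (X_ne_zero 0)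

/-- Elimination: the line `y₂ = u + δ y₁` avoids the common points of the curve with `g = 0`, for
a suitable `u`. -/
theorem exists_line_disjoint {δ : ℂ} (hδ : eval ![0, 1, δ] (pencilDet M) ≠ 0)
    (hirr : Irreducible (dehomogenize (pencilDet M))) {g : MvPolynomial (Fin 2) ℂ}
    (hg : ¬ dehomogenize (pencilDet M) ∣ g) :
    ∃ u : ℂ, ∀ s : ℂ, eval ![s, u + δ * s] (dehomogenize (pencilDet M)) = 0 →
      eval ![s, u + δ * s] g ≠ 0 := by
  set f := dehomogenize (pencilDet M) with hf
  let I : Ideal (MvPolynomial (Fin 2) ℂ) := Ideal.span {f}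
  have hI : I.IsPrime := (Ideal.span_singleton_prime hirr.ne_zero).2 hirr.prime
  let S := MvPolynomial (Fin 2) ℂ ⧸ I
  -- The coordinate ring of the affine curve is viewed as an algebra over ℂ[T] with T = y₂ - δy₁.
  let φ : Polynomial ℂ →ₐ[ℂ] S := (Ideal.Quotient.mkₐ ℂ I).comp
    (Polynomial.aeval (X 1 - C δ * X 0))
  let _ : Algebra (Polynomial ℂ) S := φ.toRingHom.toAlgebra
  have halg : ∀ q, algebraMap (Polynomial ℂ) S q = φ q := fun q => rfl
  let s : S := Ideal.Quotient.mk I (X 0)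
  have hs : IsIntegral (Polynomial ℂ) s := by
    let N1 : Matrix (Fin m) (Fin m) (Polynomial ℂ) := (M 1 + δ • M 2).map Polynomial.C
    let N0 : Matrix (Fin m) (Fin m) (Polynomial ℂ) :=
      (M 0).map Polynomial.C + (Polynomial.X : Polynomial ℂ) • (M 2).map Polynomial.C
    -- This is the equation of the curve on the line y₂ = T + δy₁, as a polynomial in y₁. Its
    -- leading coefficient det(M₁ + δM₂) is a nonzero constant, so y₁ is integral over ℂ[T].
    let F : Polynomial (Polynomial ℂ) :=
      ((Polynomial.X : Polynomial (Polynomial ℂ)) • N1.map Polynomial.C + N0.map Polynomial.C).det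
    have hdet : N1.det = Polynomial.C (eval ![0, 1, δ] (pencilDet M)) := by
      rw [← aeval_eq_eval_apply, aeval_pencilDet]
      have : (∑ l, ![0, 1, δ] l • (M l).map (algebraMap ℂ ℂ)) = M 1 + δ • M 2 := by
        ext i j
        simp [Fin.sum_univ_three]
      rw [this]
      exact (RingHom.map_det Polynomial.C _).symm
    have hunit : IsUnit N1.det := by
      rw [hdet]
      exact Polynomial.isUnit_C.2 (isUnit_iff_ne_zero.2 hδ)
    have hcoeff : F.coeff m = N1.det := by
      have := Polynomial.coeff_det_X_add_C_card N1 N0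
      rwa [Fintype.card_fin] at this
    have hnat : F.natDegree ≤ m := by
      have := Polynomial.natDegree_det_X_add_C_le N1 N0
      rwa [Fintype.card_fin] at this
    obtain ⟨w, hw⟩ := hunit
    have hmonic : (Polynomial.C (↑w⁻¹ : Polynomial ℂ) * F).Monic := by
      refine Polynomial.monic_of_natDegree_le_of_coeff_eq_one m
        ((Polynomial.natDegree_C_mul_le _ _).trans hnat) ?_
      rw [Polynomial.coeff_C_mul, hcoeff, ← hw, Units.inv_mul]
    refine ⟨_, hmonic, ?_⟩
    rw [Polynomial.eval₂_mul]
    have : Polynomial.eval₂ (algebraMap (Polynomial ℂ) S) s F = 0 := by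
      have h1 : Polynomial.eval₂ (algebraMap (Polynomial ℂ) S) s F = Ideal.Quotient.mk I f := by
        rw [hf, dehomogenize, aeval_pencilDet, RingHom.map_det, ← Polynomial.coe_eval₂RingHom,
          RingHom.map_det]
        congr 1
        refine Matrix.ext fun i j => ?_
        have e1 : ∀ a : ℂ, φ (Polynomial.C a) = Ideal.Quotient.mk I (C a) := fun a => by
          simp [φ, MvPolynomial.algebraMap_eq]
        have e2 : φ Polynomial.X = Ideal.Quotient.mk I (X 1 - C δ * X 0) := by
          simp [φ]
        have e3 : (algebraMap (Polynomial ℂ) S) Polynomial.X =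
            Ideal.Quotient.mk I (X 1) - Ideal.Quotient.mk I (C δ) * s := by
          rw [halg, e2, map_sub, map_mul]
        simp only [RingHom.mapMatrix_apply, Matrix.map_apply, Matrix.add_apply, Matrix.smul_apply,
          Fin.sum_univ_three, smul_eq_mul, map_add, map_mul, N1, N0,
          Polynomial.coe_eval₂RingHom, Polynomial.eval₂_X, Polynomial.eval₂_C,
          Polynomial.eval₂_add, Polynomial.eval₂_mul,
          MvPolynomial.algebraMap_eq, e3, halg (Polynomial.C _), e1]
        simp only [Matrix.cons_val_zero, Matrix.cons_val_one, Matrix.cons_val, map_one, s]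
        ring
      rw [h1]
      exact Ideal.Quotient.eq_zero_iff_mem.2 (Ideal.mem_span_singleton_self f)
    rw [this, mul_zero]
  have hint : ∀ p : MvPolynomial (Fin 2) ℂ, IsIntegral (Polynomial ℂ) (Ideal.Quotient.mk I p) := by
    have hC : ∀ a : ℂ, IsIntegral (Polynomial ℂ) (Ideal.Quotient.mk I (C a)) := fun a => by
      have : Ideal.Quotient.mk I (C a) = algebraMap (Polynomial ℂ) S (Polynomial.C a) := by
        rw [halg]
        simp [φ, MvPolynomial.algebraMap_eq]
      rw [this]
      exact isIntegral_algebraMap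
    have h1 : Ideal.Quotient.mk I (X 1) = algebraMap (Polynomial ℂ) S Polynomial.X +
        Ideal.Quotient.mk I (C δ) * s := by
      rw [halg]
      simp [φ, s]
    intro p
    induction p using MvPolynomial.induction_on with
    | C a => exact hC a
    | add p q hp hq => rw [map_add]; exact hp.add hq
    | mul_X p i hp =>
      rw [map_mul]
      refine hp.mul ?_
      fin_cases i
      · exact hs
      · exact h1 ▸ (isIntegral_algebraMap.add ((hC δ).mul hs))
  have hg0 : Ideal.Quotient.mk I g ≠ 0 := fun h =>
    hg (Ideal.mem_span_singleton.1 (Ideal.Quotient.eq_zero_iff_mem.1 h))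
  -- A nonzero ideal of a domain integral over ℂ[T] contains a nonzero h(T). Where h(u) ≠ 0, the
  -- line T = u misses the common zeros of f and g.
  have hne := Ideal.comap_ne_bot_of_integral_mem hg0
    (Ideal.mem_span_singleton_self (Ideal.Quotient.mk I g)) (hint g)
  obtain ⟨h, hh, hh0⟩ := Submodule.exists_mem_ne_zero_of_ne_bot hne
  obtain ⟨r, hr⟩ := Ideal.mem_span_singleton.1 (Ideal.mem_comap.1 hh)
  obtain ⟨r, rfl⟩ := Ideal.Quotient.mk_surjective r
  have hmem : Polynomial.aeval (X 1 - C δ * X 0) h - g * r ∈ I := by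
    rw [← Ideal.Quotient.eq_zero_iff_mem, map_sub, map_mul, ← hr, halg]
    simp [φ]
  obtain ⟨q, hq⟩ := Ideal.mem_span_singleton.1 hmem
  obtain ⟨u, hu⟩ := Polynomial.exists_eval_ne_zero_of_natDegree_lt_card h hh0
    ((Cardinal.natCast_lt_aleph0).trans_le (Cardinal.aleph0_le_mk ℂ))
  refine ⟨u, fun t hft hgt => hu ?_⟩
  have h2 := congrArg (eval ![t, u + δ * t]) hq
  rw [map_sub, map_mul, map_mul, hft, hgt, zero_mul, zero_mul, sub_zero] at h2
  rw [← h2, ← aeval_eq_eval_apply, ← Polynomial.aeval_algHom_apply]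
  simp
end PencilDet

/-! ### Taylor expansions and tangent cones -/

section Taylor

/-- The Taylor expansion of `f` at `x` in the direction of the generic vector `v`, as a polynomial
in the length of the step. -/
def expandAt {A : Type*} [CommRing A] [Algebra ℂ A] (x : Fin 3 → ℂ) (v : Fin 3 → A) :
    MvPolynomial (Fin 3) ℂ →ₐ[ℂ] Polynomial A :=
  aeval fun i => Polynomial.X * Polynomial.C (v i) + Polynomial.C (algebraMap ℂ A (x i))

variable {A : Type*} [CommRing A] [Algebra ℂ A] (x : Fin 3 → ℂ) (v : Fin 3 → A)

theorem coeff_expandAt (f : MvPolynomial (Fin 3) ℂ) (j : ℕ) :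
    (expandAt x v f).coeff j = aeval v (homogeneousComponent j (translate f x)) := by
  rw [← coeff_aeval_scale, translate, ← AlgHom.comp_apply, expandAt]
  congr 2
  refine algHom_ext fun i => ?_
  simp [Polynomial.algebraMap_apply]

theorem coeff_zero_expandAt (f : MvPolynomial (Fin 3) ℂ) :
    (expandAt x v f).coeff 0 = algebraMap ℂ A (eval x f) := by
  induction f using MvPolynomial.induction_on with
  | C a => simp [expandAt, Polynomial.algebraMap_apply]
  | add p q hp hq => rw [map_add, Polynomial.coeff_add, hp, hq, map_add, map_add]
  | mul_X p i hp =>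
    rw [map_mul, Polynomial.mul_coeff_zero, hp, map_mul, map_mul]
    simp [expandAt]

theorem coeff_one_expandAt (f : MvPolynomial (Fin 3) ℂ) :
    (expandAt x v f).coeff 1 = ∑ l, algebraMap ℂ A (eval x (pderiv l f)) * v l := by
  induction f using MvPolynomial.induction_on with
  | C a => simp [expandAt, Polynomial.algebraMap_apply]
  | add p q hp hq =>
    simp only [map_add, Polynomial.coeff_add, hp, hq, add_mul, Finset.sum_add_distrib]
  | mul_X p i hp =>
    have h1 : expandAt x v (X i) =
        Polynomial.X * Polynomial.C (v i) + Polynomial.C (algebraMap ℂ A (x i)) := by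
      simp [expandAt]
    rw [map_mul, h1, mul_add, Polynomial.coeff_add, Polynomial.coeff_mul_C, hp,
      mul_left_comm, Polynomial.coeff_X_mul, Polynomial.coeff_mul_C, coeff_zero_expandAt]
    have h2 : ∀ l, pderiv l (p * X i) = pderiv l p * X i + p * (if l = i then 1 else 0) := by
      intro l
      rw [pderiv_mul, pderiv_X]
      by_cases h : l = i
      · simp [h]
      · simp [h, Ne.symm h]
    simp only [h2, map_add, map_mul, eval_X, add_mul, Finset.sum_add_distrib]
    have h3 : ∀ l, (algebraMap ℂ A) (eval x (if l = i then (1 : MvPolynomial (Fin 3) ℂ) else 0)) * v l =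
        if l = i then v l else 0 := by
      intro l
      split_ifs <;> simp
    simp only [mul_assoc, h3]
    rw [Finset.sum_mul]
    simp only [mul_ite, mul_zero, Finset.sum_ite_eq', Finset.mem_univ, if_true]
    rw [add_comm]
    congr 1
    · refine Finset.sum_congr rfl fun l _ => ?_
      ring

theorem eval_expandAt (w : Fin 3 → ℂ) (f : MvPolynomial (Fin 3) ℂ) (t : ℂ) :
    (expandAt x w f).eval t = eval (fun i => x i + t * w i) f := by
  induction f using MvPolynomial.induction_on with
  | C a => simp [expandAt]
  | add p q hp hq => rw [map_add, Polynomial.eval_add, hp, hq, map_add]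
  | mul_X p i hp =>
    rw [map_mul, Polynomial.eval_mul, hp, map_mul]
    simp [expandAt, add_comm, mul_comm t]

theorem eval_aeval {σ τ : Type*} (g : σ → MvPolynomial τ ℂ) (w : τ → ℂ) (f : MvPolynomial σ ℂ) :
    eval w (aeval g f) = eval (fun i => eval w (g i)) f := by
  induction f using MvPolynomial.induction_on with
  | C a => simp
  | add p q hp hq => rw [map_add, map_add, hp, hq, map_add]
  | mul_X p i hp => rw [map_mul, map_mul, hp, map_mul, aeval_X, eval_X]

theorem coeff_zero_aeval (q : Fin 3 → Polynomial A) (f : MvPolynomial (Fin 3) ℂ) :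
    (aeval q f).coeff 0 = aeval (fun i => (q i).coeff 0) f := by
  induction f using MvPolynomial.induction_on with
  | C a => simp [Polynomial.algebraMap_apply]
  | add p q hp hq => rw [map_add, Polynomial.coeff_add, hp, hq, map_add]
  | mul_X p i hp =>
    rw [map_mul, Polynomial.mul_coeff_zero, hp, map_mul, aeval_X, aeval_X]

end Taylor

section LeadingForm

variable {Δ : MvPolynomial (Fin 3) ℂ} {x : Fin 3 → ℂ}

/-- Expanding along a generic vector turns the multiplicity into a trailing degree and the tangent
cone into a trailing coefficient, so that products can be handled over a domain. -/
theorem pointMultiplicity_eq_natTrailingDegree :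
    pointMultiplicity Δ x =
      (expandAt x (X : Fin 3 → MvPolynomial (Fin 3) ℂ) Δ).natTrailingDegree := by
  set q := expandAt x (X : Fin 3 → MvPolynomial (Fin 3) ℂ) Δ with hq
  have h1 : {k | homogeneousComponent k (translate Δ x) ≠ 0} = {k | q.coeff k ≠ 0} := by
    ext k
    rw [Set.mem_ofPred_eq, Set.mem_ofPred_eq, hq, coeff_expandAt, aeval_X_left_apply]
  rw [pointMultiplicity, h1]
  by_cases h0 : q = 0
  · simp [h0]
  · refine le_antisymm (Nat.sInf_le ?_) (Polynomial.natTrailingDegree_le_of_ne_zero ?_)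
    · exact Polynomial.trailingCoeff_nonzero_iff_nonzero.2 h0
    · exact Nat.sInf_mem (s := {k | q.coeff k ≠ 0})
        ⟨_, Polynomial.trailingCoeff_nonzero_iff_nonzero.2 h0⟩

theorem trailingCoeff_expandAt :
    (expandAt x (X : Fin 3 → MvPolynomial (Fin 3) ℂ) Δ).trailingCoeff = tangentCone Δ x := by
  rw [Polynomial.trailingCoeff, ← pointMultiplicity_eq_natTrailingDegree, coeff_expandAt,
    aeval_X_left_apply, tangentCone]

/-- If `Δ` divides the composition of the form `F` with forms `P i` vanishing at `x`, then `F`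
vanishes on the image of the tangent cone of `Δ` at `x` under the differential of `P`. -/
theorem eval_eq_zero_of_tangentCone {P : Fin 3 → MvPolynomial (Fin 3) ℂ} {d : ℕ}
    {F : MvPolynomial (Fin 3) ℂ} (hF : F.IsHomogeneous d) (hdvd : Δ ∣ aeval P F)
    (hx : ∀ i, eval x (P i) = 0) {v : Fin 3 → ℂ} (hv : eval v (tangentCone Δ x) = 0) :
    eval (fun i => ∑ l, eval x (pderiv l (P i)) * v l) F = 0 := by
  let θ := expandAt x (X : Fin 3 → MvPolynomial (Fin 3) ℂ)
  have h1 : ∀ i, ∃ q, θ (P i) = Polynomial.X * q := fun i => by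
    refine Polynomial.X_dvd_iff.2 ?_
    rw [coeff_zero_expandAt, hx, map_zero]
  choose q hq using h1
  have h2 : θ (aeval P F) = Polynomial.X ^ d * aeval q F := by
    rw [← IsHomogeneous.aeval_smul hF, comp_aeval_apply]
    simp only [hq]
  have h3 : ∀ i, (q i).coeff 0 = ∑ l, C (eval x (pderiv l (P i))) * X l := fun i => by
    have h4 := coeff_one_expandAt x (X : Fin 3 → MvPolynomial (Fin 3) ℂ) (P i)
    rw [show expandAt x X (P i) = _ from hq i, Polynomial.coeff_X_mul] at h4
    exact h4
  have h5 : eval v ((θ (aeval P F)).coeff d) =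
      eval (fun i => ∑ l, eval x (pderiv l (P i)) * v l) F := by
    rw [h2, Polynomial.coeff_X_pow_mul', if_pos le_rfl, Nat.sub_self, coeff_zero_aeval]
    simp only [h3]
    simp only [eval_aeval, map_sum, map_mul, eval_C, eval_X]
  rw [← h5]
  obtain ⟨G, hG⟩ := hdvd
  by_cases h0 : θ (aeval P F) = 0
  · rw [h0, Polynomial.coeff_zero, map_zero]
  rw [hG, map_mul] at h0
  have hmul := Polynomial.coeff_mul_natTrailingDegree_add_natTrailingDegree (p := θ Δ) (q := θ G)
  -- The left side is the coefficient of t^d in the expansion of Δ·G. Below the trailing degree of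
  -- the product it is zero; at that degree it is a multiple of the tangent cone, which vanishes at
  -- v; beyond it, divisibility of the product by t^d is violated.
  rcases lt_trichotomy d ((θ Δ).natTrailingDegree + (θ G).natTrailingDegree) with h | h | h
  · rw [hG, map_mul, Polynomial.coeff_eq_zero_of_lt_natTrailingDegree, map_zero]
    rwa [Polynomial.natTrailingDegree_mul (left_ne_zero_of_mul h0) (right_ne_zero_of_mul h0)]
  · rw [hG, map_mul, h, hmul, map_mul, show (θ Δ).trailingCoeff = _ from trailingCoeff_expandAt, hv,
      zero_mul]
  · rw [← map_mul, ← hG, h2, Polynomial.coeff_X_pow_mul', if_neg (not_le.2 h)] at hmul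
    rw [eq_comm, mul_eq_zero, Polynomial.trailingCoeff_eq_zero,
      Polynomial.trailingCoeff_eq_zero] at hmul
    exact absurd (mul_eq_zero.2 hmul) h0

end LeadingForm

/-! ### Nondegeneracy of the pencil at a point -/

section Determinant

variable {E : Type*} [AddCommGroup E] [Module ℂ E] [FiniteDimensional ℂ E]

/-- In a basis adapted to ker S, the columns of S + tT over ker S are divisible by t, so q = t^(dim
ker S) det N'. At t = 0 the columns of N' are those of T on ker S and of S on the complement, and T
e = S f is a nontrivial relation between them. -/
theorem coeff_finrank_ker_eq_zero {S T : E →ₗ[ℂ] E} {q : Polynomial ℂ}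
    (hq : ∀ t : ℂ, q.eval t = LinearMap.det (S + t • T)) {e : E} (he : e ≠ 0) (h0 : S e = 0)
    (hT : T e ∈ LinearMap.range S) :
    q.coeff (Module.finrank ℂ (LinearMap.ker S)) = 0 := by
  obtain ⟨F, hF⟩ := (LinearMap.ker S).exists_isCompl
  let b := ((Module.finBasis ℂ (LinearMap.ker S)).prod (Module.finBasis ℂ F)).map
    (Submodule.prodEquivOfIsCompl _ _ hF)
  have hbl : ∀ i, S (b (Sum.inl i)) = 0 := fun i => by
    have : b (Sum.inl i) = (Module.finBasis ℂ (LinearMap.ker S) i : E) := by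
      simp [b]
    rw [this]
    exact (Module.finBasis ℂ (LinearMap.ker S) i).2
  let MS := LinearMap.toMatrix b b S
  let MT := LinearMap.toMatrix b b T
  let ε := Sum.elim (fun _ : Fin (Module.finrank ℂ (LinearMap.ker S)) => (Polynomial.X : Polynomial ℂ))
    (fun _ : Fin (Module.finrank ℂ F) => 1)
  let N' : Matrix _ _ (Polynomial ℂ) := Matrix.of fun i j =>
    Sum.elim (fun j => Polynomial.C (MT i (Sum.inl j)))
      (fun j => Polynomial.C (MS i (Sum.inr j)) + Polynomial.X * Polynomial.C (MT i (Sum.inr j))) j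
  have hcol : ∀ i j, MS i (Sum.inl j) = 0 := fun i j => by
    simp [MS, LinearMap.toMatrix_apply, hbl]
  have hqN : q = Polynomial.X ^ Module.finrank ℂ (LinearMap.ker S) * N'.det := by
    have h1 : (∏ i, ε i) = Polynomial.X ^ Module.finrank ℂ (LinearMap.ker S) := by
      simp [ε, Fintype.prod_sum_type]
    rw [← h1, ← Matrix.det_mul_row]
    refine Polynomial.funext fun t => ?_
    rw [hq, ← LinearMap.det_toMatrix b, ← Polynomial.coe_evalRingHom, RingHom.map_det]
    congr 1
    refine Matrix.ext fun i j => ?_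
    rcases j with j | j
    · have := hcol i j
      simp only [MS] at this
      simp [ε, N', this, MT]
      exact mul_comm _ _
    · simp [ε, N', MS, MT]
      exact mul_comm _ _
  rw [hqN, Polynomial.coeff_X_pow_mul', if_pos le_rfl, Nat.sub_self,
    Polynomial.coeff_zero_eq_eval_zero, ← Polynomial.coe_evalRingHom, RingHom.map_det,
    ← Matrix.exists_mulVec_eq_zero_iff]
  obtain ⟨f, hf⟩ := hT
  let z : (Fin (Module.finrank ℂ (LinearMap.ker S)) ⊕ Fin (Module.finrank ℂ F)) → ℂ :=
    Sum.elim (fun i => b.repr e (Sum.inl i)) (fun i => - b.repr f (Sum.inr i))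
  have hker : ∀ i, b.repr e (Sum.inr i) = 0 := fun i => by
    have : e = Submodule.prodEquivOfIsCompl _ _ hF (⟨e, h0⟩, 0) := by simp
    have h2 : (Submodule.prodEquivOfIsCompl _ _ hF).symm e = (⟨e, h0⟩, 0) := by
      rw [LinearEquiv.symm_apply_eq]; exact this
    simp [b, h2]
  refine ⟨z, ?_, ?_⟩
  · intro hz
    apply he
    rw [← b.repr.map_eq_zero_iff]
    refine Finsupp.ext fun i => ?_
    rcases i with i | i
    · exact congrFun hz (Sum.inl i)
    · exact hker i
  · funext i
    have h2 : (LinearMap.toMatrix b b T).mulVec (b.repr e) i =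
        (LinearMap.toMatrix b b S).mulVec (b.repr f) i := by
      rw [LinearMap.toMatrix_mulVec_repr, LinearMap.toMatrix_mulVec_repr, hf]
    simp only [Matrix.mulVec, dotProduct, Fintype.sum_sum_type, hker, mul_zero,
      Finset.sum_const_zero, add_zero] at h2 ⊢
    have h3 : ∀ j, LinearMap.toMatrix b b S i (Sum.inl j) = 0 := hcol i
    simp only [h3, zero_mul, Finset.sum_const_zero, zero_add] at h2
    simp [N', z, MS, MT, h2]

end Determinant

section Nondegenerate

variable {E : Type*} [AddCommGroup E] [Module ℂ E] {D : Fin 3 → E →ₗ[ℂ] E}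

/-- The linear map induced by `∑ v l • D l` from the kernel to the cokernel of `∑ x l • D l` is
injective. -/
def IsNondegenerateAt (D : Fin 3 → E →ₗ[ℂ] E) (x v : Fin 3 → ℂ) : Prop :=
  ∀ e, ∑ l, x l • D l e = 0 → (∃ f, ∑ l, x l • D l f = ∑ l, v l • D l e) → e = 0

/-- On the kernel of the pencil at x the summand a x of the direction contributes nothing, so w
induces b times the map of v. -/
theorem IsNondegenerateAt.of_eq {x v w : Fin 3 → ℂ} (hw : IsNondegenerateAt D x w) {a b : ℂ}
    (h : w = a • x + b • v) : IsNondegenerateAt D x v := by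
  rintro e he ⟨f, hf⟩
  refine hw e he ⟨b • f, ?_⟩
  subst h
  simp only [map_smul, Pi.add_apply, Pi.smul_apply, add_smul, Finset.sum_add_distrib, smul_assoc,
    ← Finset.smul_sum, he, smul_zero, zero_add, ← hf]
  rw [Finset.smul_sum]
  exact Finset.sum_congr rfl fun l _ => smul_comm _ _ _

variable [FiniteDimensional ℂ E]

/-- By maximality the value of the tangent cone at v is the coefficient of t^(dim ker) in det(D(x) +
tD(v)), which vanishes when the induced map from kernel to cokernel is not injective. -/
theorem isNondegenerateAt_of_tangentCone {Δ : MvPolynomial (Fin 3) ℂ}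
    (hΔ : ∀ x, eval x Δ = LinearMap.det (∑ l, x l • D l)) {x v : Fin 3 → ℂ}
    (hmax : Module.finrank ℂ (LinearMap.ker (∑ l, x l • D l)) = pointMultiplicity Δ x)
    (hv : eval v (tangentCone Δ x) ≠ 0) : IsNondegenerateAt D x v := by
  rintro e he ⟨f, hf⟩
  by_contra h0
  refine hv ?_
  rw [tangentCone, ← hmax, ← aeval_eq_eval_apply, ← coeff_expandAt]
  refine coeff_finrank_ker_eq_zero (T := ∑ l, v l • D l) (fun t => ?_) h0
    (by simpa [LinearMap.sum_apply] using he)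
    ⟨f, by simpa [LinearMap.sum_apply] using hf⟩
  rw [eval_expandAt, hΔ]
  congr 1
  simp only [add_smul, Finset.sum_add_distrib, mul_smul, Finset.smul_sum]

/-- The vectors orthogonal to g form a plane, of which x and v are a basis. -/
theorem exists_eq_add_of_orthogonal {g x v w : Fin 3 → ℂ} (hg : g ≠ 0) (hx0 : x ≠ 0)
    (hv0 : ∀ t : ℂ, v ≠ t • x) (hx : ∑ l, g l * x l = 0) (hv : ∑ l, g l * v l = 0)
    (hw : ∑ l, g l * w l = 0) : ∃ a b : ℂ, w = a • x + b • v := by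
  have h1 : (Matrix.of ![x, v, w]).mulVec g = 0 := by
    funext i
    fin_cases i
    · simpa [Matrix.mulVec, dotProduct, mul_comm] using hx
    · simpa [Matrix.mulVec, dotProduct, mul_comm] using hv
    · simpa [Matrix.mulVec, dotProduct, mul_comm] using hw
  obtain ⟨z, hz, h2⟩ := Matrix.exists_vecMul_eq_zero_iff.2
    (Matrix.exists_mulVec_eq_zero_iff.1 ⟨g, hg, h1⟩)
  have h3 : z 0 • x + z 1 • v + z 2 • w = 0 := by
    rw [← h2]
    funext l
    simp [Matrix.vecMul, dotProduct, Fin.sum_univ_three]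
  by_cases hz2 : z 2 = 0
  · exfalso
    rw [hz2, zero_smul, add_zero] at h3
    by_cases hz1 : z 1 = 0
    · rw [hz1, zero_smul, add_zero] at h3
      refine hz (funext fun i => ?_)
      fin_cases i
      · exact (smul_eq_zero.1 h3).resolve_right hx0
      · exact hz1
      · exact hz2
    · refine hv0 (-(z 0 / z 1)) ?_
      have h4 := congrArg (fun r => (z 1)⁻¹ • r) h3
      simp only [smul_add, smul_smul, inv_mul_cancel₀ hz1, one_smul, smul_zero] at h4
      rw [neg_smul, eq_neg_iff_add_eq_zero, add_comm, div_eq_inv_mul]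
      exact h4
  · refine ⟨-(z 0 / z 2), -(z 1 / z 2), ?_⟩
    have h4 := congrArg (fun r => (z 2)⁻¹ • r) h3
    simp only [smul_add, smul_smul, inv_mul_cancel₀ hz2, one_smul, smul_zero] at h4
    rw [neg_smul, neg_smul, ← neg_add, eq_neg_iff_add_eq_zero, add_comm, div_eq_inv_mul,
      div_eq_inv_mul]
    exact h4

theorem sum_pderiv_mul_eq_zero {n : ℕ} {P : MvPolynomial (Fin 3) ℂ} (hP : P.IsHomogeneous n)
    {x : Fin 3 → ℂ} (hx : eval x P = 0) : ∑ l, eval x (pderiv l P) * x l = 0 := by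
  have h := congrArg (eval x) hP.sum_X_mul_pderiv
  rw [map_sum, map_nsmul, hx, smul_zero] at h
  simpa [mul_comm] using h

/-- A pencil which is nondegenerate in all nonzero directions coming from a linear family of
tangent vectors only admits such families of dimension at most one. -/
theorem eq_zero_of_isNondegenerateAt {x : Fin 3 → ℂ} {e : Fin 3 → E} {f : E}
    (he : ∀ l, ∑ i, x i • D i (e l) = 0) (hf : ∑ l, D l (e l) + ∑ l, x l • D l f = 0)
    (hnd : ∀ φ : Module.Dual ℂ E, (fun l => φ (e l)) ≠ 0 →
      IsNondegenerateAt D x fun l => φ (e l)) : e = 0 := by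
  by_contra h0
  obtain ⟨l₀, hl₀⟩ := Function.ne_iff.1 h0
  obtain ⟨φ, hφ⟩ : ∃ φ : Module.Dual ℂ E, φ (e l₀) ≠ 0 := by
    by_contra! h
    exact hl₀ ((Module.forall_dual_apply_eq_zero_iff ℂ _).1 h)
  have hφ0 : (fun l => φ (e l)) ≠ 0 := fun h => hφ (congrFun h l₀)
  -- If all directions φ(e) are multiples of one, then e_l = φ(e_l) e' with a single vector e', and
  -- the equation `hf` contradicts nondegeneracy. Otherwise there are two independent directions.
  by_cases hrank : ∀ ψ : Module.Dual ℂ E, ∃ t : ℂ, (fun l => ψ (e l)) = t • fun l => φ (e l)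
  · set e' := (φ (e l₀))⁻¹ • e l₀ with he'
    have hel : ∀ l, e l = φ (e l) • e' := fun l => by
      rw [← sub_eq_zero, ← Module.forall_dual_apply_eq_zero_iff ℂ]
      intro ψ
      obtain ⟨t, ht⟩ := hrank ψ
      have h1 := congrFun ht l
      have h2 := congrFun ht l₀
      simp only [Pi.smul_apply, smul_eq_mul] at h1 h2
      rw [map_sub, map_smul, he', map_smul, h1, h2, smul_eq_mul, smul_eq_mul]
      field_simp
      ring
    have h3 : e' = 0 := by
      refine hnd φ hφ0 e' ?_ ⟨-f, ?_⟩
      · have := he l₀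
        simp only [he', map_smul]
        simp only [smul_comm (x _) (φ (e l₀))⁻¹]
        rw [← Finset.smul_sum, this, smul_zero]
      · have h4 : ∑ l, φ (e l) • D l e' = ∑ l, D l (e l) :=
          Finset.sum_congr rfl fun l _ => by rw [← map_smul, ← hel]
        rw [h4, eq_neg_of_add_eq_zero_left hf]
        simp
    exact hl₀ (by rw [hel l₀, h3, smul_zero]; rfl)
  · push Not at hrank
    obtain ⟨ψ, hψ⟩ := hrank
    let S : E →ₗ[ℂ] E := ∑ l, x l • D l
    let K := LinearMap.ker S
    let A : Module.Dual ℂ E → K →ₗ[ℂ] (E ⧸ LinearMap.range S) := fun χ =>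
      (LinearMap.range S).mkQ ∘ₗ (∑ l, χ (e l) • D l) ∘ₗ K.subtype
    have hS : ∀ y, S y = ∑ l, x l • D l y := fun y => by simp [S, LinearMap.sum_apply]
    have hA : ∀ χ : Module.Dual ℂ E, (fun l => χ (e l)) ≠ 0 → Function.Injective (A χ) := by
      intro χ hχ
      rw [← LinearMap.ker_eq_bot, LinearMap.ker_eq_bot']
      intro y hy
      have h1 : (∑ l, χ (e l) • D l) (y : E) ∈ LinearMap.range S := by
        rw [← Submodule.Quotient.mk_eq_zero]
        exact hy
      obtain ⟨z, hz⟩ := h1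
      refine Subtype.ext (hnd χ hχ y ?_ ⟨z, ?_⟩)
      · rw [← hS]
        exact y.2
      · rw [← hS, hz]
        simp [LinearMap.sum_apply]
    have hdim : Module.finrank ℂ K = Module.finrank ℂ (E ⧸ LinearMap.range S) := by
      have h1 := S.finrank_range_add_finrank_ker
      have h2 := (LinearMap.range S).finrank_quotient_add_finrank
      change Module.finrank ℂ (LinearMap.ker S) = _
      omega
    let T := LinearMap.linearEquivOfInjective (A φ) (hA φ hφ0) hdim
    have hT : ∀ y, T y = A φ y := fun y => rfl
    have : Nontrivial K := ⟨⟨⟨e l₀, by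
      rw [LinearMap.mem_ker, hS]
      exact he l₀⟩, 0, fun h => hl₀ (congrArg Subtype.val h)⟩⟩
    -- The maps A φ and A ψ go between spaces of equal dimension. An eigenvalue t of A_φ⁻¹A_ψ makes
    -- the direction of ψ - tφ degenerate, although independence makes it nonzero.
    obtain ⟨t, ht⟩ := Module.End.exists_eigenvalue (T.symm.toLinearMap ∘ₗ A ψ : Module.End ℂ K)
    obtain ⟨y, hy⟩ := ht.exists_hasEigenvector
    have h1 := hy.apply_eq_smul
    rw [LinearMap.comp_apply, LinearEquiv.coe_coe, LinearEquiv.symm_apply_eq, map_smul, hT] at h1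
    refine hy.2 (hA (ψ - t • φ) ?_ ?_)
    · intro h
      refine hψ t (funext fun l => ?_)
      have := congrFun h l
      simp only [LinearMap.sub_apply, LinearMap.smul_apply, Pi.zero_apply] at this
      exact sub_eq_zero.1 this
    · have h2 : A (ψ - t • φ) y = A ψ y - t • A φ y := by
        simp only [A, LinearMap.comp_apply, LinearMap.sub_apply, LinearMap.smul_apply, sub_smul,
          Finset.sum_sub_distrib, map_sub, smul_assoc, ← Finset.smul_sum, map_smul]
      rw [h2, h1, sub_self, map_zero]

/-- Absence of tangent vectors off the image of the curve `Δ = 0` under `P`. -/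
theorem hasNoTangent {Δ : MvPolynomial (Fin 3) ℂ}
    (hΔ : ∀ x, eval x Δ = LinearMap.det (∑ l, x l • D l)) {n : ℕ}
    {P : Fin 3 → MvPolynomial (Fin 3) ℂ} (hP : ∀ i, (P i).IsHomogeneous n) (y : Fin 2 → ℂ)
    (hmax : ∀ x : Fin 3 → ℂ, x ≠ 0 → eval x Δ = 0 → (∀ i, eval x (P i) = 0) →
      Module.finrank ℂ (LinearMap.ker (∑ l, x l • D l)) = pointMultiplicity Δ x)
    (hsimple : ∀ x : Fin 3 → ℂ, x ≠ 0 → eval x Δ = 0 → (∀ i, eval x (P i) = 0) →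
      ∃ a g v : Fin 3 → ℂ, (∀ i, g i = ∑ l, a l * eval x (pderiv i (P l))) ∧
        g ≠ 0 ∧ ∑ i, g i * v i = 0 ∧ eval v (tangentCone Δ x) ≠ 0)
    (hoff : ∀ (x : Fin 3 → ℂ) (c : ℂ), eval x Δ = 0 →
      (∀ i, eval x (P i) = c * ![1, y 0, y 1] i) → c = 0)
    (htan : ∀ (x v : Fin 3 → ℂ) (c : ℂ), (∀ i, eval x (P i) = 0) →
      eval v (tangentCone Δ x) = 0 →
      (∀ i, ∑ l, eval x (pderiv l (P i)) * v l = c * ![1, y 0, y 1] i) → c = 0)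
    (δ u : ℂ) (x : Fin 3 → ℂ) :
    HasNoTangent D (P 1 - C (y 0) * P 0) (P 2 - C (y 1) * P 0) δ u x := by
  intro e f he hL hQ₁ hQ₂ hLe hf h₁ h₂
  by_contra h0
  obtain ⟨l₀, hl₀⟩ := Function.ne_iff.1 h0
  have hx0 : x ≠ 0 := by
    rintro rfl
    rw [eval_lineForm] at hL
    simp at hL
  have hdet : eval x Δ = 0 := by
    rw [hΔ]
    by_contra h
    have hunit := (LinearMap.isUnit_iff_isUnit_det _).2 (isUnit_iff_ne_zero.2 h)
    refine hl₀ (LinearMap.ker_eq_bot'.1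
      (LinearMap.ker_eq_bot.2 ((Module.End.isUnit_iff _).1 hunit).1) _ ?_)
    simpa [LinearMap.sum_apply] using he l₀
  simp only [map_sub, map_mul, eval_C, sub_eq_zero] at hQ₁ hQ₂
  have hc : eval x (P 0) = 0 := hoff x _ hdet fun i => by
    fin_cases i
    · simp
    · simp [hQ₁, mul_comm]
    · simp [hQ₂, mul_comm]
  have hbase : ∀ i, eval x (P i) = 0 := fun i => by
    fin_cases i
    · exact hc
    · simpa [hc] using hQ₁
    · simpa [hc] using hQ₂
  have hmax' := hmax x hx0 hdet hbase
  obtain ⟨a, g, w, hg, hg0, hgw, hw⟩ := hsimple x hx0 hdet hbase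
  refine h0 (eq_zero_of_isNondegenerateAt he hf fun φ hφ => ?_)
  set v : Fin 3 → ℂ := fun l => φ (e l) with hv
  -- L has value 1 at x and value 0 at v, so only v = 0 could be a multiple of x.
  have hvx : ∀ t : ℂ, v ≠ t • x := by
    intro t ht
    have h3 := congrArg φ hLe
    simp only [map_sum, map_smul, map_zero, smul_eq_mul] at h3
    have h4 : ∀ l, φ (e l) = t * x l := fun l => congrFun ht l
    have h5 : ∑ l, eval x (pderiv l (lineForm δ u)) * x l = eval x (lineForm δ u) := by
      have := congrArg (eval x) (isHomogeneous_lineForm δ u).sum_X_mul_pderiv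
      simpa [mul_comm] using this
    simp only [h4, mul_left_comm _ t] at h3
    rw [← Finset.mul_sum, h5, hL, mul_one] at h3
    exact hφ (by rw [ht, h3, zero_smul])
  have hgrad : ∀ i, ∑ l, eval x (pderiv l (P i)) * v l =
      (∑ l, eval x (pderiv l (P 0)) * v l) * ![1, y 0, y 1] i := by
    have aux : ∀ (i : Fin 3) (b : ℂ),
        ∑ l, eval x (pderiv l (P i - C b * P 0)) • e l = 0 →
        ∑ l, eval x (pderiv l (P i)) * v l = (∑ l, eval x (pderiv l (P 0)) * v l) * b := by
      intro i b h
      have h3 := congrArg φ h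
      simp only [map_sum, map_smul, map_zero, smul_eq_mul, map_sub, pderiv_C_mul,
        map_mul, eval_C, sub_mul, Finset.sum_sub_distrib, sub_eq_zero] at h3
      rw [h3, Finset.sum_mul]
      exact Finset.sum_congr rfl fun l _ => by ring
    intro i
    fin_cases i
    · simp
    · exact aux 1 _ h₁
    · exact aux 2 _ h₂
  -- For v in the tangent cone the differential of P kills v. Then x, v and the direction w provided
  -- by simplicity are all orthogonal to g, so w is a combination of x and v, and nondegeneracy
  -- passes from w to v. Off the tangent cone maximality suffices.
  by_cases hcv : eval v (tangentCone Δ x) = 0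
  · have hc0 := htan x v _ hbase hcv hgrad
    simp only [hc0, zero_mul] at hgrad
    have hgv : ∀ z : Fin 3 → ℂ, (∀ i, ∑ l, eval x (pderiv l (P i)) * z l = 0) →
        ∑ i, g i * z i = 0 := by
      intro z hz
      simp only [hg, Finset.sum_mul]
      rw [Finset.sum_comm]
      refine Finset.sum_eq_zero fun l _ => ?_
      simp only [mul_assoc, ← Finset.mul_sum, hz, mul_zero]
    obtain ⟨α, b, hwv⟩ := exists_eq_add_of_orthogonal hg0 hx0 hvx
      (hgv x fun i => sum_pderiv_mul_eq_zero (hP i) (hbase i)) (hgv v hgrad) hgw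
    exact (isNondegenerateAt_of_tangentCone hΔ hmax' hw).of_eq hwv
  · exact isNondegenerateAt_of_tangentCone hΔ hmax' hcv

end Nondegenerate

/-! ### The pencil of a vessel -/

section VesselPencil

variable {H E : Type*} [NormedAddCommGroup H] [InnerProductSpace ℂ H]
  [NormedAddCommGroup E] [InnerProductSpace ℂ E]

/-- The coefficients `γⁱⁿ, σ₂, -σ₁` of the pencil of a vessel. -/
def VesselData.coeffs (V : VesselData H E) : Fin 3 → E →ₗ[ℂ] E :=
  ![V.γin, V.σ₂, -V.σ₁]

theorem VesselData.sum_coeffs_apply (V : VesselData H E) (x : Fin 3 → ℂ) (e : E) :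
    ∑ l, x l • V.coeffs l e = V.pencil x e := by
  simp [Fin.sum_univ_three, coeffs, pencil, sub_eq_add_neg]

theorem VesselData.sum_coeffs (V : VesselData H E) (x : Fin 3 → ℂ) :
    ∑ l, x l • V.coeffs l = (V.pencil x : E →ₗ[ℂ] E) := by
  refine LinearMap.ext fun e => ?_
  rw [LinearMap.sum_apply]
  exact V.sum_coeffs_apply x e

variable [FiniteDimensional ℂ E]

/-- Matrices of the coefficients of the pencil of a vessel. -/
def VesselData.coeffMatrix (V : VesselData H E) (l : Fin 3) :
    Matrix (Fin (Module.finrank ℂ E)) (Fin (Module.finrank ℂ E)) ℂ :=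
  LinearMap.toMatrix (stdOrthonormalBasis ℂ E).toBasis (stdOrthonormalBasis ℂ E).toBasis
    (V.coeffs l)

theorem VesselData.homDiscriminant_eq (V : VesselData H E) :
    V.homDiscriminant = pencilDet V.coeffMatrix := by
  rw [homDiscriminant, pencilDet]
  congr 1
  refine Matrix.ext fun i j => ?_
  simp [Fin.sum_univ_three, coeffMatrix, coeffs, polyMatrix, sub_eq_add_neg]

theorem VesselData.discriminant_eq (V : VesselData H E) :
    V.discriminant = dehomogenize V.homDiscriminant := by
  rw [homDiscriminant, discriminant, AlgHom.map_det]
  congr 1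
  refine Matrix.ext fun i j => ?_
  simp [polyMatrix, dehomogenize]
  ring

theorem VesselData.eval_homDiscriminant (V : VesselData H E) (x : Fin 3 → ℂ) :
    eval x V.homDiscriminant = LinearMap.det (∑ l, x l • V.coeffs l) := by
  rw [homDiscriminant_eq, ← aeval_eq_eval_apply, aeval_pencilDet,
    ← LinearMap.det_toMatrix (stdOrthonormalBasis ℂ E).toBasis]
  congr 1
  simp [coeffMatrix, Fin.sum_univ_three]

theorem det_eq_zero_iff_exists {F : Type*} [AddCommGroup F] [Module ℂ F] [FiniteDimensional ℂ F]
    (T : F →ₗ[ℂ] F) : LinearMap.det T = 0 ↔ ∃ e, e ≠ 0 ∧ T e = 0 := by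
  rw [LinearMap.det_eq_zero_iff_ker_ne_bot, Submodule.ne_bot_iff]
  simp only [LinearMap.mem_ker, and_comm]

theorem VesselData.eval_homDiscriminant_eq_zero (V : VesselData H E) {x : Fin 3 → ℂ} :
    eval x V.homDiscriminant = 0 ↔ ∃ e, e ≠ 0 ∧ ∑ l, x l • V.coeffs l e = 0 := by
  rw [eval_homDiscriminant, det_eq_zero_iff_exists]
  simp [LinearMap.sum_apply]

theorem VesselData.mem_discriminantVariety (V : VesselData H E) {y : Fin 2 → ℂ} :
    y ∈ V.discriminantVariety ↔ ∃ e, e ≠ 0 ∧ V.pencil ![1, y 0, y 1] e = 0 := by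
  rw [discriminantVariety, Set.mem_ofPred_eq, discriminant_eq, eval_dehomogenize,
    eval_homDiscriminant_eq_zero]
  simp only [sum_coeffs_apply]

end VesselPencil

/-! ### The rational map and its image curve -/

section Forms

variable (p : Fin 3 → MvPolynomial (Fin 2) ℝ)

/-- The forms `P₀, P₁, P₂` with complex coefficients. -/
def complexForm (i : Fin 3) : MvPolynomial (Fin 3) ℂ := map (algebraMap ℝ ℂ) (form p i)

theorem eval_complexForm (i : Fin 3) (x : Fin 3 → ℂ) :
    eval x (complexForm p i) = aeval x (form p i) := by
  rw [complexForm, eval_map, aeval_def]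

theorem isHomogeneous_complexForm (i : Fin 3) : (complexForm p i).IsHomogeneous (mapDegree p) :=
  (form_isHomogeneous p i).map _

theorem eval_pderiv_complexForm (i l : Fin 3) (x : Fin 3 → ℂ) :
    eval x (pderiv l (complexForm p i)) = aeval x (pderiv l (form p i)) := by
  rw [complexForm, pderiv_map, eval_map, aeval_def]

theorem eval_complexForm_affine (i : Fin 3) (y : Fin 2 → ℂ) :
    eval ![1, y 0, y 1] (complexForm p i) = aeval y (p i) := by
  rw [eval_complexForm, form, homogenize, map_sum, aeval_def, eval₂_eq']
  refine Finset.sum_congr rfl fun d _ => ?_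
  simp [Fin.prod_univ_two]

theorem exists_mapDegree_eq {S : Set (Fin 2 → ℂ)}
    (hS : (imagePoints p S).Nontrivial) :
    ∃ k, mapDegree p = k + 1 := by
  refine Nat.exists_eq_succ_of_ne_zero fun h => ?_
  have h1 : ∀ i, p i = C ((p i).coeff 0) := fun i => by
    rw [← totalDegree_eq_zero_iff_eq_C]
    exact Nat.le_zero.1 (h ▸ Finset.le_sup (f := fun i => (p i).totalDegree) (Finset.mem_univ i))
  obtain ⟨_, ⟨y, _, rfl⟩, _, ⟨z, _, rfl⟩, hne⟩ := hS
  refine hne ?_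
  have h2 : ∀ i, aeval y (p i) = aeval z (p i) := fun i => by rw [h1 i]; simp
  simp only [h2]

variable {p} {Δ : MvPolynomial (Fin 3) ℂ} {m : ℕ}

/-- F(P) vanishes on the affine curve wherever P₀ does not, so P₀F(P) vanishes on all of it and the
Nullstellensatz for the prime (Δ) applies. The factor P₀ is dropped because it is nonzero somewhere
on the curve. -/
theorem dvd_aeval_complexForm (hΔ : Δ.IsHomogeneous m) (hirr : Irreducible (dehomogenize Δ))
    (hdeg : (dehomogenize Δ).totalDegree = m)
    (hne : (imagePoints p {y | eval y (dehomogenize Δ) = 0}).Nonempty)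
    {F : MvPolynomial (Fin 2) ℂ}
    (hF : F ∈ vanishingIdeal ℂ (imagePoints p {y | eval y (dehomogenize Δ) = 0})) :
    Δ ∣ aeval (complexForm p) (complexHomogenize F.totalDegree F) := by
  have hFh := isHomogeneous_complexHomogenize (le_refl F.totalDegree)
  refine dvd_of_dehomogenize_dvd hΔ hdeg (n := mapDegree p * F.totalDegree)
    (hFh.aeval _ (isHomogeneous_complexForm p)) ?_
  have hprime : (Ideal.span {dehomogenize Δ}).IsPrime :=
    (Ideal.span_singleton_prime hirr.ne_zero).2 hirr.prime
  have hmul : dehomogenize Δ ∣ dehomogenize (complexForm p 0) *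
      dehomogenize (aeval (complexForm p) (complexHomogenize F.totalDegree F)) := by
    rw [← Ideal.mem_span_singleton, ← MvPolynomial.IsPrime.vanishingIdeal_zeroLocus (K := ℂ)
      (Ideal.span {dehomogenize Δ}), mem_vanishingIdeal_iff]
    intro y hy
    have hy0 : eval y (dehomogenize Δ) = 0 := by
      rw [← aeval_eq_eval_apply]
      exact mem_zeroLocus_iff.1 hy _ (Ideal.mem_span_singleton_self _)
    rw [map_mul, aeval_eq_eval_apply, aeval_eq_eval_apply, eval_dehomogenize, eval_dehomogenize,
      eval_complexForm_affine, eval_aeval]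
    by_cases h0 : aeval y (p 0) = 0
    · rw [h0, zero_mul]
    · have h1 := CommVessel.IsHomogeneous.aeval_smul hFh (aeval y (p 0))
        ![1, aeval y (p 1) / aeval y (p 0), aeval y (p 2) / aeval y (p 0)]
      have h2 : (fun i => eval ![1, y 0, y 1] (complexForm p i)) = fun i => aeval y (p 0) *
          ![1, aeval y (p 1) / aeval y (p 0), aeval y (p 2) / aeval y (p 0)] i := by
        funext i
        rw [eval_complexForm_affine]
        fin_cases i
        · simp
        · simp [mul_div_cancel₀ _ h0]
        · simp [mul_div_cancel₀ _ h0]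
      rw [aeval_eq_eval_apply, aeval_eq_eval_apply] at h1
      have h3 := eval_dehomogenize (complexHomogenize F.totalDegree F)
        ![aeval y (p 1) / aeval y (p 0), aeval y (p 2) / aeval y (p 0)]
      simp only [Matrix.cons_val_zero, Matrix.cons_val_one] at h3
      have h4 := mem_vanishingIdeal_iff.1 hF _ ⟨y, ⟨hy0, h0⟩, rfl⟩
      rw [aeval_eq_eval_apply] at h4
      rw [h2, h1, ← h3, dehomogenize_complexHomogenize, h4, mul_zero, mul_zero]
  refine (hirr.prime.dvd_or_dvd hmul).resolve_left ?_
  rintro ⟨g, hg⟩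
  obtain ⟨_, y, ⟨hy, hy0⟩, _⟩ := hne
  refine hy0 ?_
  rw [← eval_complexForm_affine, ← eval_dehomogenize, hg, map_mul, show eval y _ = 0 from hy,
    zero_mul]

theorem eval_complexHomogenize_scale (F : MvPolynomial (Fin 2) ℂ) (c : ℂ) (y : Fin 2 → ℂ) :
    eval (fun i => c * ![1, y 0, y 1] i) (complexHomogenize F.totalDegree F) =
      c ^ F.totalDegree * eval y F := by
  have h := CommVessel.IsHomogeneous.aeval_smul
    (isHomogeneous_complexHomogenize (le_refl F.totalDegree)) c ![1, y 0, y 1]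
  rw [aeval_eq_eval_apply, aeval_eq_eval_apply, ← eval_dehomogenize,
    dehomogenize_complexHomogenize] at h
  exact h

/-- A polynomial separating y from the image is homogenized; at c(1, y₁, y₂) it takes the value c^d
F(y). -/
theorem exists_dvd_of_notMem_imageCurve (hΔ : Δ.IsHomogeneous m)
    (hirr : Irreducible (dehomogenize Δ)) (hdeg : (dehomogenize Δ).totalDegree = m)
    (hne : (imagePoints p {y | eval y (dehomogenize Δ) = 0}).Nonempty) {y : Fin 2 → ℂ}
    (hy : y ∉ imageCurve p {y | eval y (dehomogenize Δ) = 0}) :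
    ∃ (d : ℕ) (F : MvPolynomial (Fin 3) ℂ), F.IsHomogeneous d ∧ Δ ∣ aeval (complexForm p) F ∧
      ∀ c : ℂ, eval (fun i => c * ![1, y 0, y 1] i) F = 0 → c = 0 := by
  rw [imageCurve, mem_zeroLocus_iff] at hy
  push Not at hy
  obtain ⟨F, hF, hFy⟩ := hy
  refine ⟨_, _, isHomogeneous_complexHomogenize le_rfl,
    dvd_aeval_complexForm hΔ hirr hdeg hne hF, fun c hc => ?_⟩
  rw [eval_complexHomogenize_scale] at hc
  by_contra h
  rw [aeval_eq_eval_apply] at hFy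
  exact mul_ne_zero (pow_ne_zero _ h) hFy hc

/-- If Δ divided both forms, r would equal y at every point of the curve where P₀ ≠ 0. One of the
two forms is thus available for choosing a transversal line. -/
theorem not_dvd_of_nontrivial
    (hC : (imagePoints p {y | eval y (dehomogenize Δ) = 0}).Nontrivial) (y : Fin 2 → ℂ) :
    ¬ dehomogenize Δ ∣ dehomogenize (complexForm p 1 - C (y 0) * complexForm p 0) ∨
      ¬ dehomogenize Δ ∣ dehomogenize (complexForm p 2 - C (y 1) * complexForm p 0) := by
  by_contra! h
  have key : ∀ (j : Fin 3) (b : ℂ),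
      dehomogenize Δ ∣ dehomogenize (complexForm p j - C b * complexForm p 0) →
      ∀ z : Fin 2 → ℂ, eval z (dehomogenize Δ) = 0 → aeval z (p 0) ≠ 0 →
        aeval z (p j) / aeval z (p 0) = b := by
    rintro j b ⟨g, hg⟩ z hz h0
    have h1 := congrArg (eval z) hg
    rw [map_mul, hz, zero_mul, eval_dehomogenize, map_sub, map_mul, eval_C,
      eval_complexForm_affine, eval_complexForm_affine, sub_eq_zero] at h1
    rw [h1, mul_div_cancel_right₀ _ h0]
  obtain ⟨_, ⟨z, hz, rfl⟩, _, ⟨w, hw, rfl⟩, hne⟩ := hC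
  refine hne ?_
  simp only [key 1 _ h.1 z hz.1 hz.2, key 2 _ h.2 z hz.1 hz.2, key 1 _ h.1 w hw.1 hw.2,
    key 2 _ h.2 w hw.1 hw.2]

end Forms

section Vessel

variable {H E : Type*} [NormedAddCommGroup H] [InnerProductSpace ℂ H]
  [NormedAddCommGroup E] [InnerProductSpace ℂ E] [FiniteDimensional ℂ E]

theorem VesselData.exists_transversalLine (V : VesselData H E) (hirr : Irreducible V.discriminant)
    (hdeg : V.discriminant.totalDegree = Module.finrank ℂ E) {Q : MvPolynomial (Fin 3) ℂ}
    (hQ : ¬ dehomogenize V.homDiscriminant ∣ dehomogenize Q) :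
    ∃ δ u : ℂ, TransversalLine V.coeffs Q δ u := by
  rw [discriminant_eq, homDiscriminant_eq] at hirr hdeg
  rw [homDiscriminant_eq] at hQ
  obtain ⟨δ, hδ⟩ := exists_eval_pencilDet_ne_zero _ hirr.ne_zero hdeg
  obtain ⟨u, hu⟩ := exists_line_disjoint _ hδ hirr hQ
  refine ⟨δ, u, ?_, fun s hs => ?_⟩
  · rw [← homDiscriminant_eq] at hδ
    rw [injective_iff_map_eq_zero]
    intro e he
    by_contra h0
    refine hδ (V.eval_homDiscriminant_eq_zero.2 ⟨e, h0, ?_⟩)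
    rw [← he]
    simp [Fin.sum_univ_three]
  · rw [injective_iff_map_eq_zero]
    intro e he
    by_contra h0
    refine hu s ?_ ?_
    · rw [eval_dehomogenize, ← homDiscriminant_eq, eval_homDiscriminant_eq_zero]
      refine ⟨e, h0, ?_⟩
      rw [← he]
      simp [Fin.sum_univ_three, add_smul, smul_smul]
      rw [mul_comm s δ]
      abel
    · rw [eval_dehomogenize]
      exact hs

/-- The separating form F serves twice: it vanishes at P(x) for x on the curve, and at dP(v) for v
in the tangent cone at a base point. -/
theorem VesselData.hasNoTangent_of_notMem_imageCurve (V : VesselData H E)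
    (hirr : Irreducible V.discriminant)
    (hdeg : V.discriminant.totalDegree = Module.finrank ℂ E)
    {p : Fin 3 → MvPolynomial (Fin 2) ℝ} (hC : (imagePoints p V.discriminantVariety).Nontrivial)
    (hbase : ∀ x, IsBasePoint V p x → IsMaximalAt V x ∧ IsSimpleAt V p x)
    {y : Fin 2 → ℂ} (hy : y ∉ imageCurve p V.discriminantVariety) (δ u : ℂ) (x : Fin 3 → ℂ) :
    HasNoTangent V.coeffs (complexForm p 1 - C (y 0) * complexForm p 0)
      (complexForm p 2 - C (y 1) * complexForm p 0) δ u x := by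
  have hΔ : V.homDiscriminant.IsHomogeneous (Module.finrank ℂ E) := by
    rw [homDiscriminant_eq]
    exact isHomogeneous_pencilDet _
  rw [discriminantVariety] at hC hy
  rw [discriminant_eq] at hirr hdeg hC hy
  obtain ⟨d, F, hF, hdvd, hFy⟩ := exists_dvd_of_notMem_imageCurve hΔ hirr hdeg hC.nonempty hy
  have hb : ∀ x : Fin 3 → ℂ, x ≠ 0 → eval x V.homDiscriminant = 0 →
      (∀ i, eval x (complexForm p i) = 0) → IsBasePoint V p x :=
    fun x h1 h2 h3 => ⟨h1, h2, fun i => by rw [← eval_complexForm, h3]⟩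
  refine hasNoTangent V.eval_homDiscriminant (isHomogeneous_complexForm p) y
    (fun x h1 h2 h3 => ?_) (fun x h1 h2 h3 => ?_) (fun x c h1 h2 => hFy c ?_)
    (fun x v c h1 h2 h3 => hFy c ?_) δ u x
  · rw [sum_coeffs]
    exact (hbase x (hb x h1 h2 h3)).1
  · obtain ⟨a, g, v, hg, hv⟩ := (hbase x (hb x h1 h2 h3)).2
    refine ⟨a, g, v, fun i => ?_, hv⟩
    simp only [eval_pderiv_complexForm]
    exact hg i
  · obtain ⟨G, hG⟩ := hdvd
    have := congrArg (eval x) hG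
    rw [eval_aeval, map_mul, h1, zero_mul] at this
    simpa only [h2] using this
  · have := eval_eq_zero_of_tangentCone hF hdvd h1 h2
    simpa only [h3] using this

end Vessel

/-! ### Principal subspace and Bezout operator in terms of functionals -/

section ExpandKernel

variable {E : Type*} [AddCommGroup E] [Module ℂ E] {D : Fin 3 → E →ₗ[ℂ] E} {k : ℕ}

/-- The displayed equations are the pencil condition on monomials of degree k - 1; in all other
degrees that condition is empty. -/
theorem expand_mem_gradedKernel_iff {w : MultiIdx k → E} :
    expand k w ∈ gradedKernel D k ↔ ∀ (j : Fin 3 → ℕ) (a b c : MultiIdx k),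
      a.1 = j + Pi.single 0 1 → b.1 = j + Pi.single 1 1 → c.1 = j + Pi.single 2 1 →
        D 0 (w a) + D 1 (w b) + D 2 (w c) = 0 := by
  have hX : ∀ (l : Fin 3) (a : MultiIdx k) (d : Fin 3 →₀ ℕ),
      a.1 = (⇑d + Pi.single l 1 : Fin 3 → ℕ) →
      (X l * MvPolynomial.monomial d 1 : MvPolynomial (Fin 3) ℂ) = a.monomial := by
    intro l a d h
    rw [show (X l : MvPolynomial (Fin 3) ℂ) = MvPolynomial.monomial (Finsupp.single l 1) 1 from rfl,
      monomial_mul, one_mul, MultiIdx.monomial, add_comm]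
    have e : d + Finsupp.single l 1 = a.toFinsupp := by
      refine Finsupp.ext fun i => ?_
      have h1 : a.toFinsupp i = d i + (Pi.single l 1 : Fin 3 → ℕ) i := congrFun h i
      rw [Finsupp.add_apply, Finsupp.single_apply, h1, Pi.single_apply]
      simp only [eq_comm]
    rw [e]
  constructor
  · intro h j a b c ha hb hc
    have h1 := h.2 (MvPolynomial.monomial (Finsupp.equivFunOnFinite.symm j) 1)
    rw [Fin.sum_univ_three, hX 0 a _ ha, hX 1 b _ hb, hX 2 c _ hc, expand_monomial,
      expand_monomial, expand_monomial] at h1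
    exact h1
  · intro h
    refine ⟨expand_mem w, fun f => ?_⟩
    induction f using MvPolynomial.induction_on' with
    | add p q hp hq =>
      simp only [mul_add, map_add, Finset.sum_add_distrib, hp, hq, add_zero]
    | monomial d r =>
      have hr : ∀ l, (X l * MvPolynomial.monomial d r : MvPolynomial (Fin 3) ℂ) =
          r • (X l * MvPolynomial.monomial d 1) := fun l => by
        rw [← mul_smul_comm, smul_monomial, smul_eq_mul, mul_one]
      simp only [hr, map_smul, ← Finset.smul_sum]
      by_cases hd : d.degree + 1 = k
      · have hmem : ∀ l : Fin 3, (⇑d + Pi.single l 1 : Fin 3 → ℕ) ∈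
            Finset.Nat.antidiagonalTuple 3 k := fun l => by
          rw [Finset.Nat.mem_antidiagonalTuple, sum_add_single, ← hd, Finsupp.degree_eq_sum]
        rw [Fin.sum_univ_three, hX 0 ⟨_, hmem 0⟩ d rfl, hX 1 ⟨_, hmem 1⟩ d rfl,
          hX 2 ⟨_, hmem 2⟩ d rfl, expand_monomial, expand_monomial, expand_monomial,
          h d _ _ _ rfl rfl rfl, smul_zero]
      · have h0 : ∀ l, expand k w (X l * MvPolynomial.monomial d 1) = 0 := fun l =>
          expand_mem w _ (1 + d.degree) ((isHomogeneous_X ℂ l).mul (isHomogeneous_monomial 1 rfl))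
            (by omega)
        simp [h0]

theorem bezoutForm_congr {c : Fin 3 → MultiIdx k → MultiIdx k → ℂ}
    {v w : MvPolynomial (Fin 3) ℂ →ₗ[ℂ] E} (h : ∀ i : MultiIdx k, v i.monomial = w i.monomial)
    (ω : MvPolynomial (Fin 3) ℂ →ₗ[ℂ] Module.Dual ℂ E) :
    bezoutForm D c v ω = bezoutForm D c w ω := by
  simp only [bezoutForm_eq, h]

/-- A common point of the curve and Q = 0 on the line would be (0, 1, δ) up to scaling or an affine
point of the line; transversality excludes both. So all such points lie in the chart L ≠ 0. -/
theorem TransversalLine.eval_lineForm_ne_zero {Q : MvPolynomial (Fin 3) ℂ} {δ u : ℂ}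
    (hT : TransversalLine D Q δ u) {n : ℕ} (hQ : Q.IsHomogeneous n) {x : Fin 3 → ℂ} (hx : x ≠ 0)
    {e : E} (he : ∑ l, x l • D l e = 0) (he0 : e ≠ 0) (hxQ : eval x Q = 0) :
    eval x (lineForm δ u) ≠ 0 := by
  rw [eval_lineForm]
  intro h
  have h2 : x 2 = δ * x 1 + u * x 0 := by linear_combination h
  rw [Fin.sum_univ_three, h2] at he
  by_cases h0 : x 0 = 0
  · have h1 : x 1 ≠ 0 := fun h1 => hx (funext fun i => by
      fin_cases i
      · exact h0
      · exact h1
      · simpa [h0, h1] using h2)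
    refine he0 (hT.injective ?_)
    rw [map_zero]
    have h3 : x 1 • (D 1 + δ • D 2) e = 0 := by
      rw [← he, h0]
      simp [smul_smul, mul_comm]
    exact (smul_eq_zero.1 h3).resolve_left h1
  · refine he0 (hT.disjoint (x 1 / x 0) ?_ ?_)
    · have h3 := CommVessel.IsHomogeneous.eval_eq hQ h0
      rw [hxQ, eval_dehomogenize, eq_comm, mul_eq_zero] at h3
      have h4 := h3.resolve_left (pow_ne_zero _ h0)
      rw [← h4]
      congr 2
      funext i
      fin_cases i
      · simp
      · simp
      · simp [h2]
        field_simp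
        ring
    · rw [map_zero]
      have h3 : x 0 • (D 0 + u • D 2 + (x 1 / x 0) • (D 1 + δ • D 2)) e = 0 := by
        rw [← he]
        simp only [LinearMap.add_apply, LinearMap.smul_apply, smul_add, smul_smul, add_smul,
          mul_div_cancel₀ _ h0]
        rw [mul_comm δ, mul_comm u, ← mul_assoc, mul_div_cancel₀ _ h0]
        abel
      exact (smul_eq_zero.1 h3).resolve_left h0

end ExpandKernel

section Bridge

variable {H E : Type*} [NormedAddCommGroup H] [InnerProductSpace ℂ H]
  [NormedAddCommGroup E] [InnerProductSpace ℂ E] {V : VesselData H E} {k : ℕ}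

/-- The functional on forms of degree `k` with the given values at the monomials. -/
def BlownUp.toFunctional (w : BlownUp E k) : MvPolynomial (Fin 3) ℂ →ₗ[ℂ] E :=
  expand k fun i => w i

/-- The functional with values in the dual space attached to `w` by the inner product. -/
def BlownUp.toDualFunctional (w : BlownUp E k) :
    MvPolynomial (Fin 3) ℂ →ₗ[ℂ] Module.Dual ℂ E :=
  expand k fun i => (innerSL ℂ (w i) : E →ₗ[ℂ] ℂ)

theorem mem_principalSubspace_iff {w : BlownUp E k} :
    w ∈ principalSubspace V k ↔ BlownUp.toFunctional w ∈ gradedKernel V.coeffs k := by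
  rw [BlownUp.toFunctional, expand_mem_gradedKernel_iff]
  change (∀ (j : Fin 3 → ℕ) (a b c : MultiIdx k), _ → _ → _ → _) ↔ _
  simp [VesselData.coeffs, sub_eq_add_neg]

/-- The three coefficient matrices of a Bezout identity, in the order of the minors. -/
def BezoutCoeffs.toFun {p q : MvPolynomial (Fin 3) ℝ} (β : BezoutCoeffs k p q) :
    Fin 3 → MultiIdx k → MultiIdx k → ℂ :=
  ![fun i j => β.b12 i j, fun i j => β.b20 i j, fun i j => -β.b10 i j]

theorem BezoutCoeffs.isBezout {p q : MvPolynomial (Fin 3) ℝ} (β : BezoutCoeffs k p q)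
    (hp : p.IsHomogeneous (k + 1)) (hq : q.IsHomogeneous (k + 1)) :
    IsBezout β.toFun (map (algebraMap ℝ ℂ) p) (map (algebraMap ℝ ℂ) q) where
  left_isHomogeneous := hp.map _
  right_isHomogeneous := hq.map _
  identity x y := by
    have h := β.identity x y
    simp only [aeval_def] at h
    rw [eval_map, eval_map, eval_map, eval_map, h, Fin.sum_univ_three]
    simp only [← Finset.sum_add_distrib]
    refine Finset.sum_congr rfl fun i _ => Finset.sum_congr rfl fun j _ => ?_
    simp [toFun]
    ring

/-- The sign of β¹⁰ in `BezoutCoeffs.toFun`, due to the orientation of the minors, cancels the sign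
of σ₁ in `VesselData.coeffs`. -/
theorem inner_bezoutOperator {p q : MvPolynomial (Fin 3) ℝ} (β : BezoutCoeffs k p q)
    (w u : BlownUp E k) : inner ℂ w (bezoutOperator V β u) =
      bezoutForm V.coeffs β.toFun u.toFunctional w.toDualFunctional := by
  rw [bezoutForm_eq, PiLp.inner_apply, Finset.sum_comm]
  refine Finset.sum_congr rfl fun i _ => ?_
  have h : bezoutOperator V β u i = ∑ j,
      ((β.b12 i j : ℂ) • V.γin (u j) + (β.b10 i j : ℂ) • V.σ₁ (u j)
        + (β.b20 i j : ℂ) • V.σ₂ (u j)) := by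
    simp [bezoutOperator]
  rw [h, inner_sum, Finset.sum_comm]
  refine Finset.sum_congr rfl fun j _ => ?_
  rw [Fin.sum_univ_three]
  simp only [BlownUp.toFunctional, BlownUp.toDualFunctional, expand_monomial, BezoutCoeffs.toFun,
    VesselData.coeffs, inner_add_right, inner_smul_right]
  simp [inner_neg_right]
  ring

theorem toFunctional_vandermonde (x : Fin 3 → ℂ) (e : E) (i : MultiIdx k) :
    (vandermonde k x e).toFunctional i.monomial = pointFunctional x e i.monomial := by
  rw [BlownUp.toFunctional, expand_monomial, pointFunctional_apply, MultiIdx.eval_monomial]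
  rfl

theorem vandermonde_mem_principalSubspace {x : Fin 3 → ℂ} {e : E}
    (he : ∑ l, x l • V.coeffs l e = 0) : vandermonde k x e ∈ principalSubspace V k := by
  rw [mem_principalSubspace_iff, BlownUp.toFunctional, expand_mem_gradedKernel_iff]
  intro j a b c ha hb hc
  rw [Fin.sum_univ_three] at he
  simp only [vandermonde, ha, hb, hc, mon_add_single, map_smul]
  rw [mul_comm (x 0), mul_comm (x 1), mul_comm (x 2), mul_smul, mul_smul, mul_smul, ← smul_add,
    ← smul_add, he, smul_zero]

theorem vandermonde_smul (c : ℂ) (x : Fin 3 → ℂ) (e : E) :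
    vandermonde k (c • x) e = vandermonde k x (c ^ k • e) := by
  refine PiLp.ext fun i => ?_
  simp only [vandermonde, smul_smul]
  congr 1
  have h := Finset.Nat.mem_antidiagonalTuple.1 i.2
  simp only [mon, Pi.smul_apply, smul_eq_mul, mul_pow, Finset.prod_mul_distrib,
    Finset.prod_pow_eq_pow_sum, h]
  ring

variable [CompleteSpace E]

theorem exists_toDualFunctional_eq [FiniteDimensional ℂ E]
    {ω : MvPolynomial (Fin 3) ℂ →ₗ[ℂ] Module.Dual ℂ E}
    (hω : ω ∈ gradedPart (Module.Dual ℂ E) k) :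
    ∃ w : BlownUp E k, BlownUp.toDualFunctional w = ω := by
  refine ⟨WithLp.toLp 2 fun i => (InnerProductSpace.toDual ℂ E).symm
    (LinearMap.toContinuousLinearMap (ω i.monomial)), ?_⟩
  conv_rhs => rw [← expand_eq hω]
  rw [BlownUp.toDualFunctional]
  congr 1
  funext i
  refine LinearMap.ext fun e => ?_
  simp

variable [CompleteSpace H]

theorem VesselData.IsVessel.inner_coeffs (hV : V.IsVessel) (l : Fin 3) (e f : E) :
    inner ℂ (V.coeffs l e) f = inner ℂ e (V.coeffs l f) := by
  fin_cases l
  · exact hV.selfAdjoint_γin.isSymmetric e f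
  · exact hV.selfAdjoint_σ₂.isSymmetric e f
  · have := hV.selfAdjoint_σ₁.isSymmetric e f
    simpa [coeffs, inner_neg_left, inner_neg_right] using this

/-- Selfadjointness of the coefficients makes the inner product carry the pencil to its transpose,
so the same subspace serves for both arguments of the Bezout form. -/
theorem VesselData.IsVessel.mem_principalSubspace_iff_dual (hV : V.IsVessel) {w : BlownUp E k} :
    w ∈ principalSubspace V k ↔
      BlownUp.toDualFunctional w ∈ gradedKernel (dualPencil V.coeffs) k := by
  rw [mem_principalSubspace_iff, BlownUp.toFunctional, BlownUp.toDualFunctional,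
    expand_mem_gradedKernel_iff, expand_mem_gradedKernel_iff]
  refine forall_congr' fun j => forall_congr' fun a => forall_congr' fun b => forall_congr' fun c =>
    imp_congr_right fun _ => imp_congr_right fun _ => imp_congr_right fun _ => ?_
  rw [← inner_self_eq_zero (𝕜 := ℂ)]
  have key : ∀ f : E, inner ℂ (V.coeffs 0 (w a) + V.coeffs 1 (w b) + V.coeffs 2 (w c)) f =
      (dualPencil V.coeffs 0 (innerSL ℂ (w a) : E →ₗ[ℂ] ℂ) +
        dualPencil V.coeffs 1 (innerSL ℂ (w b) : E →ₗ[ℂ] ℂ) +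
        dualPencil V.coeffs 2 (innerSL ℂ (w c) : E →ₗ[ℂ] ℂ) : Module.Dual ℂ E) f := by
    intro f
    rw [inner_add_left, inner_add_left, hV.inner_coeffs, hV.inner_coeffs, hV.inner_coeffs]
    rfl
  constructor
  · intro h
    rw [inner_self_eq_zero] at h
    refine LinearMap.ext fun f => ?_
    rw [← key, h, inner_zero_left]
    rfl
  · intro h
    rw [key, h]
    rfl

/-- Real symmetric β and selfadjoint coefficients give a selfadjoint operator. For complex y the
pencil itself need not be selfadjoint, so its left radical is obtained from the three operators
separately. -/
theorem VesselData.IsVessel.inner_bezoutOperator_comm (hV : V.IsVessel)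
    {p q : MvPolynomial (Fin 3) ℝ} (β : BezoutCoeffs k p q) (w u : BlownUp E k) :
    inner ℂ w (bezoutOperator V β u) =
      (starRingEnd ℂ) (inner ℂ u (bezoutOperator V β w)) := by
  rw [inner_bezoutOperator, inner_bezoutOperator, bezoutForm_eq, bezoutForm_eq, map_sum]
  refine Finset.sum_congr rfl fun l _ => ?_
  rw [map_sum, Finset.sum_comm]
  refine Finset.sum_congr rfl fun i _ => ?_
  rw [map_sum]
  refine Finset.sum_congr rfl fun j _ => ?_
  simp only [BlownUp.toFunctional, BlownUp.toDualFunctional, expand_monomial]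
  rw [map_mul]
  congr 1
  · have h10 := β.symm10.apply i j
    have h20 := β.symm20.apply i j
    have h12 := β.symm12.apply i j
    fin_cases l
    · simp [BezoutCoeffs.toFun, h12]
    · simp [BezoutCoeffs.toFun, h20]
    · simp [BezoutCoeffs.toFun, h10]
  · change inner ℂ (w j) (V.coeffs l (u i)) = (starRingEnd ℂ) (inner ℂ (u i) (V.coeffs l (w j)))
    rw [inner_conj_symm, hV.inner_coeffs]

end Bridge

section Combination

variable {k : ℕ} {a b c : Fin 3 → MultiIdx k → MultiIdx k → ℂ} {P₀ P₁ P₂ : MvPolynomial (Fin 3) ℂ}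

/-- Bilinear antisymmetric expansion: [P₁ - sP₀, P₂ - tP₀] = [P₁, P₂] + s[P₂, P₀] - t[P₁, P₀]. -/
theorem IsBezout.combination (h₁₂ : IsBezout a P₁ P₂) (h₂₀ : IsBezout b P₂ P₀)
    (h₁₀ : IsBezout c P₁ P₀) (s t : ℂ) :
    IsBezout (a + s • b - t • c) (P₁ - C s * P₀) (P₂ - C t * P₀) where
  left_isHomogeneous := h₁₂.left_isHomogeneous.sub
    (by simpa using (isHomogeneous_C (Fin 3) s).mul h₂₀.right_isHomogeneous)
  right_isHomogeneous := h₁₂.right_isHomogeneous.sub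
    (by simpa using (isHomogeneous_C (Fin 3) t).mul h₂₀.right_isHomogeneous)
  identity x y := by
    have e₁ := h₁₂.identity x y
    have e₂ := h₂₀.identity x y
    have e₃ := h₁₀.identity x y
    simp only [map_sub, map_mul, eval_C, Pi.sub_apply, Pi.add_apply, Pi.smul_apply, smul_eq_mul,
      sub_mul, add_mul, Finset.sum_sub_distrib, Finset.sum_add_distrib, mul_assoc s, mul_assoc t,
      ← Finset.mul_sum] at e₁ e₂ e₃ ⊢
    linear_combination e₁ + s * e₂ - t * e₃

theorem bezoutForm_combination {E : Type*} [AddCommGroup E] [Module ℂ E] (D : Fin 3 → E →ₗ[ℂ] E)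
    (s t : ℂ) (v : MvPolynomial (Fin 3) ℂ →ₗ[ℂ] E)
    (ω : MvPolynomial (Fin 3) ℂ →ₗ[ℂ] Module.Dual ℂ E) :
    bezoutForm D (a + s • b - t • c) v ω =
      bezoutForm D a v ω + s * bezoutForm D b v ω - t * bezoutForm D c v ω := by
  simp only [bezoutForm_eq, Pi.sub_apply, Pi.add_apply, Pi.smul_apply, smul_eq_mul,
    sub_mul, add_mul, Finset.sum_sub_distrib, Finset.sum_add_distrib, mul_assoc s, mul_assoc t,
    ← Finset.mul_sum]

end Combination

/-! ### The span of the base points -/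

section BasePoints

variable {H E : Type*} [NormedAddCommGroup H] [InnerProductSpace ℂ H]
  [NormedAddCommGroup E] [InnerProductSpace ℂ E] {V : VesselData H E} {p : Fin 3 → MvPolynomial (Fin 2) ℝ} {k : ℕ}

/-- The values of a functional at the monomials of degree `k`. -/
def restrictDegree (E : Type*) [NormedAddCommGroup E] [InnerProductSpace ℂ E] (k : ℕ) :
    (MvPolynomial (Fin 3) ℂ →ₗ[ℂ] E) →ₗ[ℂ] BlownUp E k where
  toFun v := WithLp.toLp 2 fun i => v i.monomial
  map_add' _ _ := rfl
  map_smul' _ _ := rfl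

theorem restrictDegree_apply (v : MvPolynomial (Fin 3) ℂ →ₗ[ℂ] E) (i : MultiIdx k) :
    restrictDegree E k v i = v i.monomial :=
  rfl

theorem restrictDegree_pointFunctional (x : Fin 3 → ℂ) (e : E) :
    restrictDegree E k (pointFunctional x e) = vandermonde k x e := by
  refine PiLp.ext fun i => ?_
  rw [restrictDegree_apply, pointFunctional_apply, MultiIdx.eval_monomial]
  rfl

theorem restrictDegree_eq_iff {v : MvPolynomial (Fin 3) ℂ →ₗ[ℂ] E} {w : BlownUp E k} :
    restrictDegree E k v = w ↔ ∀ f, f.IsHomogeneous k → v f = w.toFunctional f := by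
  constructor
  · rintro rfl f hf
    conv_lhs => rw [eq_sum_monomial hf]
    conv_rhs => rw [eq_sum_monomial hf]
    simp only [map_sum, map_smul, BlownUp.toFunctional, expand_monomial, restrictDegree_apply]
  · intro h
    refine PiLp.ext fun i => ?_
    have := h _ i.isHomogeneous_monomial
    rwa [BlownUp.toFunctional, expand_monomial] at this

variable [FiniteDimensional ℂ E]

/-- The span of the Vandermonde vectors at the base points. -/
def baseSpan (V : VesselData H E) (p : Fin 3 → MvPolynomial (Fin 2) ℝ) (k : ℕ) :
    Submodule ℂ (BlownUp E k) :=
  Submodule.span ℂ {w | ∃ (x : Fin 3 → ℂ) (e : E), IsBasePoint V p x ∧ V.pencil x e = 0 ∧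
    w = vandermonde k x e}

theorem IsBasePoint.eval_complexForm {x : Fin 3 → ℂ} (hx : IsBasePoint V p x) (i : Fin 3) :
    eval x (complexForm p i) = 0 := by
  rw [CommVessel.eval_complexForm, hx.2.2 i]

/-- Every combination of Vandermonde vectors at base points is the restriction of a functional on
the affine part `L = 1` of the base locus. -/
theorem exists_restrictDegree_eq {δ u : ℂ} {j : Fin 3} {b : ℂ}
    (hT : TransversalLine V.coeffs (complexForm p j - C b * complexForm p 0) δ u)
    {w : BlownUp E k} (hw : w ∈ baseSpan V p k) :
    ∃ ν ∈ affineKernel V.coeffs δ u (complexForm p j - C b * complexForm p 0) (complexForm p 0),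
      restrictDegree E k ν = w := by
  rw [← Submodule.mem_map]
  revert w
  change baseSpan V p k ≤ _
  refine Submodule.span_le.2 ?_
  rintro _ ⟨x, e, hx, he, rfl⟩
  rw [← V.sum_coeffs_apply] at he
  have hQ : ∀ x : Fin 3 → ℂ, (∀ i, eval x (complexForm p i) = 0) →
      eval x (complexForm p j - C b * complexForm p 0) = 0 := fun x hx => by simp [hx]
  have hQh : (complexForm p j - C b * complexForm p 0).IsHomogeneous (mapDegree p) :=
    (isHomogeneous_complexForm p j).sub
      (by simpa using (isHomogeneous_C (Fin 3) b).mul (isHomogeneous_complexForm p 0))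
  by_cases he0 : e = 0
  · refine ⟨0, zero_mem _, ?_⟩
    rw [map_zero, he0, ← restrictDegree_pointFunctional, pointFunctional_zero, map_zero]
  have hL := hT.eval_lineForm_ne_zero hQh hx.1 he he0 (hQ x hx.eval_complexForm)
  set c := eval x (lineForm δ u) with hc
  have hscale : ∀ {n : ℕ} {f : MvPolynomial (Fin 3) ℂ}, f.IsHomogeneous n →
      eval (c⁻¹ • x) f = c⁻¹ ^ n * eval x f := fun hf => by
    have := CommVessel.IsHomogeneous.aeval_smul hf c⁻¹ x
    rwa [aeval_eq_eval_apply, aeval_eq_eval_apply] at this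
  have hx' : x = c • (c⁻¹ • x) := by rw [smul_smul, mul_inv_cancel₀ hL, one_smul]
  have h0 : ∀ i, eval (c⁻¹ • x) (complexForm p i) = 0 := fun i => by
    rw [hscale (isHomogeneous_complexForm p i), hx.eval_complexForm, mul_zero]
  refine ⟨pointFunctional (c⁻¹ • x) (c ^ k • e),
    pointFunctional_mem_affineKernel_iff.2 (Or.inr ⟨?_, ?_, hQ _ h0, h0 0⟩), ?_⟩
  · simp only [map_smul, Pi.smul_apply, smul_assoc, smul_comm _ (c ^ k), ← Finset.smul_sum, he,
      smul_zero]
  · rw [hscale (isHomogeneous_lineForm δ u), pow_one, ← hc, inv_mul_cancel₀ hL]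
  · rw [restrictDegree_pointFunctional]
    conv_rhs => rw [hx']
    exact (vandermonde_smul c _ e).symm

/-- A vector of the base span extends to a functional on the chart annihilated by P₀. By
`TransversalLine.eq_zero_of_degree` this extension would coincide with the point functional at the
rescaled x, on which P₀ does not vanish. -/
theorem vandermonde_notMem_baseSpan (hk : mapDegree p = k + 1) {δ u : ℂ} {j : Fin 3} {b : ℂ}
    (hT : TransversalLine V.coeffs (complexForm p j - C b * complexForm p 0) δ u)
    {x : Fin 3 → ℂ} {e : E} (hx0 : x ≠ 0) (he : ∑ l, x l • V.coeffs l e = 0) (he0 : e ≠ 0)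
    (hxQ : eval x (complexForm p j - C b * complexForm p 0) = 0)
    (hx : eval x (complexForm p 0) ≠ 0) : vandermonde k x e ∉ baseSpan V p k := by
  intro hmem
  obtain ⟨ν, hν, hνx⟩ := exists_restrictDegree_eq hT hmem
  rw [mem_affineKernel] at hν
  have hQh : (complexForm p j - C b * complexForm p 0).IsHomogeneous (k + 1) := by
    rw [← hk]
    exact (isHomogeneous_complexForm p j).sub
      (by simpa using (isHomogeneous_C (Fin 3) b).mul (isHomogeneous_complexForm p 0))
  have hL := hT.eval_lineForm_ne_zero hQh hx0 he he0 hxQ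
  set c := eval x (lineForm δ u) with hc
  have hscale : ∀ {n : ℕ} {f : MvPolynomial (Fin 3) ℂ}, f.IsHomogeneous n →
      eval (c⁻¹ • x) f = c⁻¹ ^ n * eval x f := fun hf => by
    have := CommVessel.IsHomogeneous.aeval_smul hf c⁻¹ x
    rwa [aeval_eq_eval_apply, aeval_eq_eval_apply] at this
  have hx' : x = c • (c⁻¹ • x) := by rw [smul_smul, mul_inv_cancel₀ hL, one_smul]
  have he' : ∑ l, (c⁻¹ • x) l • V.coeffs l (c ^ k • e) = 0 := by
    simp only [map_smul, Pi.smul_apply, smul_assoc, smul_comm _ (c ^ k), ← Finset.smul_sum, he,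
      smul_zero]
  set μ := pointFunctional (c⁻¹ • x) (c ^ k • e) with hμ
  have hμx : restrictDegree E k μ = vandermonde k x e := by
    rw [hμ, restrictDegree_pointFunctional]
    conv_rhs => rw [hx']
    exact (vandermonde_smul c _ e).symm
  have hL1 : eval (c⁻¹ • x) (lineForm δ u) = 1 := by
    rw [hscale (isHomogeneous_lineForm δ u), pow_one, ← hc, inv_mul_cancel₀ hL]
  have hQ1 : eval (c⁻¹ • x) (complexForm p j - C b * complexForm p 0) = 0 := by
    rw [hscale hQh, hxQ, mul_zero]
  have h0 : ν - μ = 0 := by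
    refine hT.eq_zero_of_degree hQh (sub_mem hν.1 (pointFunctional_mem he')) ?_ ?_ fun f hf => ?_
    · rw [map_sub, hν.2.1, hμ, shift_pointFunctional, hL1, one_smul]
    · rw [map_sub, hν.2.2.1, hμ, shift_pointFunctional, hQ1, zero_smul, sub_zero]
    · rw [LinearMap.sub_apply, restrictDegree_eq_iff.1 hνx f hf, restrictDegree_eq_iff.1 hμx f hf,
        sub_self]
  have h1 : ν (complexForm p 0) = 0 := by
    have := LinearMap.congr_fun hν.2.2.2 1
    rwa [shift_apply, mul_one] at this
  rw [sub_eq_zero.1 h0, hμ, pointFunctional_apply, hscale (isHomogeneous_complexForm p 0),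
    smul_smul] at h1
  refine he0 ((smul_eq_zero.1 h1).resolve_left ?_)
  exact mul_ne_zero (mul_ne_zero (pow_ne_zero _ (inv_ne_zero hL)) hx) (pow_ne_zero _ hL)

end BasePoints

/-! ### The pencil of the transformed vessel -/

section Pencil

variable {H E : Type*} [NormedAddCommGroup H] [InnerProductSpace ℂ H]
  [NormedAddCommGroup E] [InnerProductSpace ℂ E] {V : VesselData H E} {p : Fin 3 → MvPolynomial (Fin 2) ℝ} {k : ℕ}

/-- The coefficients of the Bezout identity for `P₁ - y₁ P₀` and `P₂ - y₂ P₀`. -/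
def bezoutCoeffsAt (β : ∀ i j, BezoutCoeffs k (form p i) (form p j)) (y : Fin 2 → ℂ) :
    Fin 3 → MultiIdx k → MultiIdx k → ℂ :=
  (β 1 2).toFun + y 0 • (β 2 0).toFun - y 1 • (β 1 0).toFun

theorem isBezout_bezoutCoeffsAt (hk : mapDegree p = k + 1)
    (β : ∀ i j, BezoutCoeffs k (form p i) (form p j)) (y : Fin 2 → ℂ) :
    IsBezout (bezoutCoeffsAt β y) (complexForm p 1 - C (y 0) * complexForm p 0)
      (complexForm p 2 - C (y 1) * complexForm p 0) := by
  have h : ∀ i, (form p i).IsHomogeneous (k + 1) := fun i => hk ▸ form_isHomogeneous p i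
  exact IsBezout.combination ((β 1 2).isBezout (h 1) (h 2)) ((β 2 0).isBezout (h 2) (h 0))
    ((β 1 0).isBezout (h 1) (h 0)) _ _

/-- The sesquilinear form of the pencil of the transformed vessel. -/
def pencilForm (V : VesselData H E) (β : ∀ i j, BezoutCoeffs k (form p i) (form p j))
    (y : Fin 2 → ℂ) (w u : BlownUp E k) : ℂ :=
  inner ℂ w (bezoutOperator V (β 1 2) u) + y 0 * inner ℂ w (bezoutOperator V (β 2 0) u)
    - y 1 * inner ℂ w (bezoutOperator V (β 1 0) u)

theorem pencilForm_eq (β : ∀ i j, BezoutCoeffs k (form p i) (form p j)) (y : Fin 2 → ℂ)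
    (w u : BlownUp E k) : pencilForm V β y w u =
      bezoutForm V.coeffs (bezoutCoeffsAt β y) u.toFunctional w.toDualFunctional := by
  rw [bezoutCoeffsAt, bezoutForm_combination, pencilForm, inner_bezoutOperator,
    inner_bezoutOperator, inner_bezoutOperator]

theorem pencilForm_add_right (β : ∀ i j, BezoutCoeffs k (form p i) (form p j)) (y : Fin 2 → ℂ)
    (w u v : BlownUp E k) :
    pencilForm V β y w (u + v) = pencilForm V β y w u + pencilForm V β y w v := by
  simp only [pencilForm, map_add, inner_add_right]
  ring

theorem pencilForm_add_left (β : ∀ i j, BezoutCoeffs k (form p i) (form p j)) (y : Fin 2 → ℂ)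
    (w u v : BlownUp E k) :
    pencilForm V β y (w + v) u = pencilForm V β y w u + pencilForm V β y v u := by
  simp only [pencilForm, inner_add_left]
  ring

variable [CompleteSpace H] [FiniteDimensional ℂ E] [CompleteSpace E]

theorem toFunctional_mem_bezoutKernel_iff (hV : V.IsVessel)
    (β : ∀ i j, BezoutCoeffs k (form p i) (form p j)) (y : Fin 2 → ℂ) {u : BlownUp E k} :
    u.toFunctional ∈ bezoutKernel V.coeffs (bezoutCoeffsAt β y) ↔
      ∀ w ∈ principalSubspace V k, pencilForm V β y w u = 0 := by
  constructor
  · intro h w hw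
    rw [pencilForm_eq]
    exact h _ (hV.mem_principalSubspace_iff_dual.1 hw)
  · intro h ω hω
    obtain ⟨w, rfl⟩ := exists_toDualFunctional_eq hω.1
    rw [← pencilForm_eq]
    exact h w (hV.mem_principalSubspace_iff_dual.2 hω)

/-- All three forms vanish at a base point, so its Vandermonde vectors are in the kernel of each
Bezout form, independently of y. -/
theorem inner_bezoutOperator_eq_zero (hV : V.IsVessel) (hk : mapDegree p = k + 1) {δ : ℂ}
    (hδ : Function.Injective (V.coeffs 1 + δ • V.coeffs 2)) {i j : Fin 3}
    (β : BezoutCoeffs k (form p i) (form p j)) {w u : BlownUp E k}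
    (hw : w ∈ principalSubspace V k) (hu : u ∈ baseSpan V p k) :
    inner ℂ w (bezoutOperator V β u) = 0 := by
  have h : ∀ i, (form p i).IsHomogeneous (k + 1) := fun i => hk ▸ form_isHomogeneous p i
  have hle : baseSpan V p k ≤ LinearMap.ker
      ((innerSL ℂ w).toLinearMap ∘ₗ (bezoutOperator V β).toLinearMap) := by
    refine Submodule.span_le.2 ?_
    rintro _ ⟨x, e, hx, he, rfl⟩
    rw [← V.sum_coeffs_apply] at he
    change inner ℂ w (bezoutOperator V β _) = 0
    rw [inner_bezoutOperator, bezoutForm_congr (toFunctional_vandermonde x e)]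
    exact (β.isBezout (h i) (h j)).pointFunctional_mem_bezoutKernel hδ hx.1 he
      (hx.eval_complexForm i) (hx.eval_complexForm j) _
      (hV.mem_principalSubspace_iff_dual.1 hw)
  exact hle hu

theorem pencilForm_eq_zero_of_right (hV : V.IsVessel) (hk : mapDegree p = k + 1) {δ : ℂ}
    (hδ : Function.Injective (V.coeffs 1 + δ • V.coeffs 2))
    (β : ∀ i j, BezoutCoeffs k (form p i) (form p j)) (y : Fin 2 → ℂ) {w u : BlownUp E k}
    (hw : w ∈ principalSubspace V k) (hu : u ∈ baseSpan V p k) : pencilForm V β y w u = 0 := by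
  simp only [pencilForm, inner_bezoutOperator_eq_zero hV hk hδ _ hw hu]
  ring

theorem pencilForm_eq_zero_of_left (hV : V.IsVessel) (hk : mapDegree p = k + 1) {δ : ℂ}
    (hδ : Function.Injective (V.coeffs 1 + δ • V.coeffs 2))
    (β : ∀ i j, BezoutCoeffs k (form p i) (form p j)) (y : Fin 2 → ℂ) {w u : BlownUp E k}
    (hw : w ∈ baseSpan V p k) (hu : u ∈ principalSubspace V k) : pencilForm V β y w u = 0 := by
  simp only [pencilForm, hV.inner_bezoutOperator_comm _ w u,
    inner_bezoutOperator_eq_zero hV hk hδ _ hu hw, map_zero]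
  ring

/-- Off the image curve, the common kernel of the pencil is spanned by the base points. -/
theorem mem_baseSpan_of_pencilForm_eq_zero (hV : V.IsVessel) (hirr : Irreducible V.discriminant)
    (hdeg : V.discriminant.totalDegree = Module.finrank ℂ E)
    (hC : (imagePoints p V.discriminantVariety).Nontrivial)
    (hbase : ∀ x, IsBasePoint V p x → IsMaximalAt V x ∧ IsSimpleAt V p x)
    (hk : mapDegree p = k + 1) (β : ∀ i j, BezoutCoeffs k (form p i) (form p j))
    {y : Fin 2 → ℂ} (hy : y ∉ imageCurve p V.discriminantVariety) {u : BlownUp E k}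
    (hu : u ∈ principalSubspace V k)
    (h : ∀ w ∈ principalSubspace V k, pencilForm V β y w u = 0) : u ∈ baseSpan V p k := by
  set Q₁ := complexForm p 1 - C (y 0) * complexForm p 0 with hQ₁
  set Q₂ := complexForm p 2 - C (y 1) * complexForm p 0 with hQ₂
  have hc := isBezout_bezoutCoeffsAt hk β y
  rw [← hQ₁, ← hQ₂] at hc
  have hK := (toFunctional_mem_bezoutKernel_iff hV β y).2 h
  have hg := mem_principalSubspace_iff.1 hu
  have hno := V.hasNoTangent_of_notMem_imageCurve hirr hdeg hC hbase hy
  have hno' : ∀ δ u x, HasNoTangent V.coeffs Q₂ Q₁ δ u x :=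
    fun δ u x e f h1 h2 h3 h4 h5 h6 h7 h8 => hno δ u x e f h1 h2 h4 h3 h5 h6 h8 h7
  obtain ⟨ν, hν, hνu⟩ : ∃ ν ∈ Submodule.span ℂ {w | ∃ x e, w = pointFunctional x e ∧
      ∑ l, x l • V.coeffs l e = 0 ∧ x ≠ 0 ∧ eval x Q₁ = 0 ∧ eval x Q₂ = 0},
      restrictDegree E k ν = u := by
    have hne : ∀ {δ u : ℂ} {x : Fin 3 → ℂ}, eval x (lineForm δ u) = 1 → x ≠ 0 := by
      rintro δ u x hx rfl
      rw [eval_lineForm] at hx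
      simp at hx
    have hC' := hC
    rw [VesselData.discriminantVariety, V.discriminant_eq] at hC'
    -- The line must be transversal with respect to a form not vanishing identically on the curve,
    -- and only one of Q₁, Q₂ is sure to be such. In the second case their roles are exchanged,
    -- which reverses the sign of the coefficients.
    rcases not_dvd_of_nontrivial hC' y with hQ | hQ
    · obtain ⟨δ, s, hT⟩ := V.exists_transversalLine hirr hdeg hQ
      obtain ⟨ν, hν, hνu⟩ := hc.exists_extension hT hg hK
      refine ⟨ν, Submodule.span_mono ?_
        (affineKernel_le_span hT hc.left_isHomogeneous (hno δ s) hν), restrictDegree_eq_iff.2 hνu⟩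
      rintro _ ⟨x, e, rfl, he, hL, h1, h2⟩
      exact ⟨x, e, rfl, he, hne hL, h1, h2⟩
    · obtain ⟨δ, s, hT⟩ := V.exists_transversalLine hirr hdeg hQ
      have hK' : u.toFunctional ∈ bezoutKernel V.coeffs (-bezoutCoeffsAt β y) := fun ω hω => by
        rw [bezoutForm_neg, hK ω hω, neg_zero]
      obtain ⟨ν, hν, hνu⟩ := hc.swap.exists_extension hT hg hK'
      refine ⟨ν, Submodule.span_mono ?_
        (affineKernel_le_span hT hc.right_isHomogeneous (hno' δ s) hν),
        restrictDegree_eq_iff.2 hνu⟩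
      rintro _ ⟨x, e, rfl, he, hL, h1, h2⟩
      exact ⟨x, e, rfl, he, hne hL, h2, h1⟩
  rw [← hνu, ← Submodule.mem_comap]
  refine Submodule.span_le.2 ?_ hν
  rintro _ ⟨x, e, rfl, he, hx0, h1, h2⟩
  change restrictDegree E k (pointFunctional x e) ∈ baseSpan V p k
  rw [restrictDegree_pointFunctional]
  by_cases he0 : e = 0
  · rw [he0, ← restrictDegree_pointFunctional, pointFunctional_zero, map_zero]
    exact zero_mem _
  have hdet := V.eval_homDiscriminant_eq_zero.2 ⟨e, he0, he⟩
  simp only [hQ₁, hQ₂, map_sub, map_mul, eval_C, sub_eq_zero] at h1 h2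
  -- Otherwise (P₀, P₁, P₂)(x) would be a nonzero multiple of (1, y₁, y₂), which the form separating
  -- y from the image curve forbids, also for x at infinity.
  have hP0 : eval x (complexForm p 0) = 0 := by
    by_contra h0
    have hΔ : V.homDiscriminant.IsHomogeneous (Module.finrank ℂ E) := by
      rw [VesselData.homDiscriminant_eq]
      exact isHomogeneous_pencilDet _
    rw [VesselData.discriminantVariety, V.discriminant_eq] at hC hy
    rw [V.discriminant_eq] at hirr hdeg
    obtain ⟨d, F, hF, ⟨G, hG⟩, hFy⟩ :=
      exists_dvd_of_notMem_imageCurve hΔ hirr hdeg hC.nonempty hy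
    refine h0 (hFy _ ?_)
    have h3 := congrArg (eval x) hG
    rw [eval_aeval, map_mul, hdet, zero_mul] at h3
    rw [← h3]
    congr 2
    funext i
    fin_cases i
    · simp
    · simp [h1, mul_comm]
    · simp [h2, mul_comm]
  refine Submodule.subset_span ⟨x, e, ⟨hx0, hdet, fun i => ?_⟩, ?_, rfl⟩
  · rw [← eval_complexForm]
    fin_cases i
    · exact hP0
    · simpa [hP0] using h1
    · simpa [hP0] using h2
  · rwa [← V.sum_coeffs_apply]

end Pencil

/-! ### Compression to the complement of the base points -/

section Reduced

variable {H E : Type*} [NormedAddCommGroup H] [InnerProductSpace ℂ H]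
  [NormedAddCommGroup E] [InnerProductSpace ℂ E]
  {V : VesselData H E} {p : Fin 3 → MvPolynomial (Fin 2) ℝ}

theorem VesselData.inner_pencil (W : VesselData H E) (x : Fin 3 → ℂ) (w u : E) :
    inner ℂ w (W.pencil x u) =
      x 0 * inner ℂ w (W.γin u) + x 1 * inner ℂ w (W.σ₂ u) - x 2 * inner ℂ w (W.σ₁ u) := by
  simp [VesselData.pencil]

variable [FiniteDimensional ℂ E]

theorem inner_compress {F : Submodule ℂ E} (T : E →L[ℂ] E) (w u : F) :
    inner ℂ w (VesselData.compress F T u) = inner ℂ (w : E) (T u) :=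
  F.inner_orthogonalProjectionOnto_eq_of_mem_left w (T u)

theorem VesselData.restrict_pencil_eq_zero_iff (W : VesselData H E) {F : Submodule ℂ E}
    (x : Fin 3 → ℂ) (u : F) :
    (W.restrict F).pencil x u = 0 ↔ ∀ w ∈ F, inner ℂ w (W.pencil x u) = 0 := by
  have h : ∀ w : F, inner ℂ w ((W.restrict F).pencil x u) = inner ℂ (w : E) (W.pencil x u) := by
    intro w
    simp only [inner_pencil, restrict, inner_compress]
  constructor
  · intro h0 w hw
    rw [← h ⟨w, hw⟩, h0, inner_zero_right]
  · intro h0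
    refine ext_inner_left ℂ fun w => ?_
    rw [h, h0 _ w.2, inner_zero_right]

/-- The Vandermonde vectors already lie in the principal subspace, and in finite dimension the
double orthogonal complement of their span is the span. -/
theorem mem_baseSpan_iff {w : principalSubspace V (mapDegree p - 1)} :
    (w : BlownUp E (mapDegree p - 1)) ∈ baseSpan V p (mapDegree p - 1) ↔
      w ∈ (reducedSubspace V p)ᗮ := by
  rw [reducedSubspace, Submodule.orthogonal_orthogonal, baseSpan]
  have : {w | ∃ (x : Fin 3 → ℂ) (e : E), IsBasePoint V p x ∧ V.pencil x e = 0 ∧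
      w = vandermonde (mapDegree p - 1) x e} =
      (principalSubspace V (mapDegree p - 1)).subtype '' {w | ∃ (x : Fin 3 → ℂ) (e : E),
        IsBasePoint V p x ∧ V.pencil x e = 0 ∧
        (w : BlownUp E (mapDegree p - 1)) = vandermonde (mapDegree p - 1) x e} := by
    ext v
    constructor
    · rintro ⟨x, e, hx, he, rfl⟩
      exact ⟨⟨_, vandermonde_mem_principalSubspace (V := V) (by rwa [V.sum_coeffs_apply])⟩,
        ⟨x, e, hx, he, rfl⟩, rfl⟩
    · rintro ⟨w, ⟨x, e, hx, he, h⟩, rfl⟩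
      exact ⟨x, e, hx, he, h⟩
  rw [this, ← Submodule.map_span]
  exact ⟨fun ⟨v, hv, h⟩ => Subtype.ext h ▸ hv, fun h => ⟨w, h, rfl⟩⟩

variable [CompleteSpace H] {β : ∀ i j, BezoutCoeffs (mapDegree p - 1) (form p i) (form p j)}

theorem inner_pencil_transform (y : Fin 2 → ℂ) (w u : principalSubspace V (mapDegree p - 1)) :
    inner ℂ w ((transform V p β).pencil ![1, y 0, y 1] u) =
      pencilForm V β y (w : BlownUp E (mapDegree p - 1)) u := by
  rw [VesselData.inner_pencil, pencilForm]
  simp only [transform, inner_compress, Matrix.cons_val_zero, Matrix.cons_val_one,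
    Matrix.cons_val, one_mul]

theorem discriminantVariety_reducedTransform [CompleteSpace E] (hV : V.IsVessel) (hirr : Irreducible V.discriminant)
    (hdeg : V.discriminant.totalDegree = Module.finrank ℂ E)
    (hC : (imagePoints p V.discriminantVariety).Nontrivial)
    (hbase : ∀ x, IsBasePoint V p x → IsMaximalAt V x ∧ IsSimpleAt V p x) :
    (reducedTransform V p β).discriminantVariety = imageCurve p V.discriminantVariety := by
  have hk : mapDegree p = mapDegree p - 1 + 1 := by
    obtain ⟨k, hk⟩ := exists_mapDegree_eq p hC
    omega
  have hC' := hC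
  rw [VesselData.discriminantVariety, V.discriminant_eq] at hC'
  obtain ⟨δ₀, hδ₀⟩ : ∃ δ : ℂ, Function.Injective (V.coeffs 1 + δ • V.coeffs 2) := by
    rcases not_dvd_of_nontrivial hC' 0 with hQ | hQ <;>
    · obtain ⟨δ, s, hT⟩ := V.exists_transversalLine hirr hdeg hQ
      exact ⟨δ, hT.injective⟩
  refine Set.Subset.antisymm (fun y hy => ?_) ?_
  · by_contra hyC
    obtain ⟨u, hu0, hu⟩ := (VesselData.mem_discriminantVariety _).1 hy
    have hmem : (u : principalSubspace V (mapDegree p - 1)) ∈ (reducedSubspace V p)ᗮ := by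
      rw [← mem_baseSpan_iff]
      refine mem_baseSpan_of_pencilForm_eq_zero hV hirr hdeg hC hbase hk β hyC u.1.2
        fun w hw => ?_
      -- Being killed by the compressed pencil tests only against E''. The other component of w is
      -- in the base span, which is in the left radical, so u is orthogonal to the whole principal
      -- subspace under the form.
      obtain ⟨a, ha, b, hb, hab⟩ := (reducedSubspace V p).exists_add_mem_mem_orthogonal
        (⟨w, hw⟩ : principalSubspace V (mapDegree p - 1))
      have h1 : w = (a : BlownUp E (mapDegree p - 1)) + b := congrArg Subtype.val hab
      rw [h1, pencilForm_add_left, pencilForm_eq_zero_of_left hV hk hδ₀ β y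
        (mem_baseSpan_iff.2 hb) u.1.2, add_zero]
      rw [← inner_pencil_transform]
      exact (VesselData.restrict_pencil_eq_zero_iff _ _ _).1 hu a ha
    have h0 : (u : principalSubspace V (mapDegree p - 1)) = 0 := by
      rw [← inner_self_eq_zero (𝕜 := ℂ)]
      exact hmem _ u.2
    exact hu0 (Subtype.ext h0)
  · intro y hy
    -- The discriminant of V'' is a polynomial, so its vanishing at the points r(z) carries over to
    -- their Zariski closure.
    have hD := mem_zeroLocus_iff.1 hy (reducedTransform V p β).discriminant
    rw [aeval_eq_eval_apply] at hD
    refine hD (mem_vanishingIdeal_iff.2 ?_)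
    rintro _ ⟨z, ⟨hz, hz0⟩, rfl⟩
    rw [aeval_eq_eval_apply]
    set y : Fin 2 → ℂ := ![aeval z (p 1) / aeval z (p 0), aeval z (p 2) / aeval z (p 0)] with hy
    change y ∈ (reducedTransform V p β).discriminantVariety
    obtain ⟨e, he0, he⟩ := V.mem_discriminantVariety.1 hz
    rw [← V.sum_coeffs_apply] at he
    set x : Fin 3 → ℂ := ![1, z 0, z 1] with hx
    have hx0 : x ≠ 0 := fun h => one_ne_zero (congrFun h 0)
    have hP0 : eval x (complexForm p 0) ≠ 0 := by rwa [hx, eval_complexForm_affine]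
    have hQ₁ : eval x (complexForm p 1 - C (y 0) * complexForm p 0) = 0 := by
      rw [map_sub, map_mul, eval_C, hx, eval_complexForm_affine, eval_complexForm_affine]
      simp [hy, div_mul_cancel₀ _ hz0]
    have hQ₂ : eval x (complexForm p 2 - C (y 1) * complexForm p 0) = 0 := by
      rw [map_sub, map_mul, eval_C, hx, eval_complexForm_affine, eval_complexForm_affine]
      simp [hy, div_mul_cancel₀ _ hz0]
    have hnot : vandermonde (mapDegree p - 1) x e ∉ baseSpan V p (mapDegree p - 1) := by
      rcases not_dvd_of_nontrivial hC' y with hQ | hQ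
      · obtain ⟨δ, s, hT⟩ := V.exists_transversalLine hirr hdeg hQ
        exact vandermonde_notMem_baseSpan hk hT hx0 he he0 hQ₁ hP0
      · obtain ⟨δ, s, hT⟩ := V.exists_transversalLine hirr hdeg hQ
        exact vandermonde_notMem_baseSpan hk hT hx0 he he0 hQ₂ hP0
    let v : principalSubspace V (mapDegree p - 1) := ⟨_, vandermonde_mem_principalSubspace he⟩
    have hv : ∀ w ∈ principalSubspace V (mapDegree p - 1),
        pencilForm V β y w (v : BlownUp E (mapDegree p - 1)) = 0 := by
      intro w hw
      rw [pencilForm_eq, bezoutForm_congr (toFunctional_vandermonde x e)]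
      exact (isBezout_bezoutCoeffsAt hk β y).pointFunctional_mem_bezoutKernel hδ₀ hx0 he hQ₁ hQ₂ _
        (hV.mem_principalSubspace_iff_dual.1 hw)
    -- The component a in E'' is nonzero because v is not in the base span, and it stays in the
    -- kernel because b is in the right radical.
    obtain ⟨a, ha, b, hb, hab⟩ := (reducedSubspace V p).exists_add_mem_mem_orthogonal v
    refine (VesselData.mem_discriminantVariety _).2 ⟨⟨a, ha⟩, ?_, ?_⟩
    · intro h0
      have h1 : a = 0 := congrArg Subtype.val h0
      rw [h1, zero_add] at hab
      exact hnot (mem_baseSpan_iff.2 (hab ▸ hb : v ∈ (reducedSubspace V p)ᗮ))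
    · refine (VesselData.restrict_pencil_eq_zero_iff _ _ _).2 fun w _ => ?_
      have h1 := hv w w.2
      rw [hab, Submodule.coe_add, pencilForm_add_right, pencilForm_eq_zero_of_right hV hk hδ₀ β y
        w.2 (mem_baseSpan_iff.2 hb), add_zero] at h1
      rw [inner_pencil_transform]
      exact h1

end Reduced

end CommVessel

end

theorem theorem3p4 {H E : Type*}
    [NormedAddCommGroup H] [InnerProductSpace ℂ H] [CompleteSpace H]
    [NormedAddCommGroup E] [InnerProductSpace ℂ E] [FiniteDimensional ℂ E] [CompleteSpace E]
    (V : CommVessel.VesselData H E) (hV : V.IsVessel)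
    (hirr : Irreducible V.discriminant)
    (hdeg : V.discriminant.totalDegree = Module.finrank ℂ E)
    (p : Fin 3 → MvPolynomial (Fin 2) ℝ)
    (hdef : IsUnit (CommVessel.opEval (p 0) V.A₁ V.A₂))
    (hcurve : (CommVessel.imagePoints p V.discriminantVariety).Nontrivial)
    (hbase : ∀ x, CommVessel.IsBasePoint V p x →
      CommVessel.IsMaximalAt V x ∧ CommVessel.IsSimpleAt V p x)
    (β : ∀ i j, CommVessel.BezoutCoeffs (CommVessel.mapDegree p - 1)
      (CommVessel.form p i) (CommVessel.form p j)) :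
    (CommVessel.reducedTransform V p β).discriminantVariety =
      CommVessel.imageCurve p V.discriminantVariety :=
  CommVessel.discriminantVariety_reducedTransform hV hirr hdeg hcurve hbase
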